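/- Polygons are simple polygons in the Euclidean plane, not necessarily convex. A pentagon is called Cairo (respectively Prismatic) if it is convex, circumscribed about a circle, and has two nonadjacent (respectively adjacent) right angles and three angles equal to $2\pi/3$. A pentagon of unit area is called efficient if its perimeter is at most that of a unit-area Cairo pentagon. Theorem. Let a flat torus $\mathbb{R}^2/\Lambda$ be tiled edge-to-edge by finitely many polygons of unit area (that is, any two adjacent tiles meet only along entire common edges or at common vertices), where each tile is either congruent (possibly by a reflection) to one fixed efficient pentagon $P$, or a non-convex quadrilateral; the quadrilaterals may differ from one another, and either kind of tile may be absent. Then the perimeter per tile of the tiling, i.e. the total length of its edges, each counted once, divided by the number of tiles, is not less than half the perimeter of a unit-area Cairo or Prismatic pentagon. -/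

import Mathlib

open scoped Pointwise

noncomputable section

/-- The Euclidean plane. -/
abbrev Plane : Type := EuclideanSpace ℝ (Fin 2)

/-- A closed polygonal path is simple if it has at least three vertices, its vertices are distinct,
and two different edges meet at most in common endpoints. -/
def Polygon.IsSimple {n : ℕ} (p : Polygon Plane n) : Prop :=
  3 ≤ n ∧ Function.Injective p.vertices ∧
    ∀ i j : Fin n, i ≠ j →
      p.edgeSet ℝ i ∩ p.edgeSet ℝ j ⊆ {p i, p (finRotate n i)} ∩ {p j, p (finRotate n j)}

/-- A (filled) simple polygon with `n` sides, convex or not. Its region is the compact set, equal to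
the closure of its interior, whose frontier is the given simple closed polygonal path; this
determines the region as the path together with the inside of the path. -/
structure SimplePolygon (n : ℕ) where
  /-- the boundary path -/
  path : Polygon Plane n
  /-- the closed region bounded by the path -/
  region : Set Plane
  isSimple : path.IsSimple
  isCompact_region : IsCompact region
  closure_interior_region : closure (interior region) = region
  frontier_region : frontier region = path.boundary ℝ

namespace SimplePolygon

variable {n : ℕ}

/-- The `k`-th vertex. -/
def vertex (P : SimplePolygon n) (k : Fin n) : Plane := P.path k

/-- The `k`-th edge, from vertex `k` to the cyclically next vertex, as a closed segment. -/
def edge (P : SimplePolygon n) (k : Fin n) : Set Plane := P.path.edgeSet ℝ k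

/-- The perimeter: the sum of the lengths of the edges. -/
def perimeter (P : SimplePolygon n) : ℝ := ∑ k, dist (P.vertex k) (P.vertex (finRotate n k))

/-- The area: the Lebesgue measure of the region. -/
def area (P : SimplePolygon n) : ℝ := MeasureTheory.volume.real P.region

/-- A polygon is convex if its region is a convex set, that is, no interior angle exceeds `π`. -/
def IsConvex (P : SimplePolygon n) : Prop := Convex ℝ P.region

/-- The angle at the `k`-th vertex, measured in `[0, π]`. For a convex polygon this is the interior
angle. -/
def angle (P : SimplePolygon n) (k : Fin n) : ℝ :=
  EuclideanGeometry.angle (P.vertex ((finRotate n).symm k)) (P.vertex k) (P.vertex (finRotate n k))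

/-- The polygon is circumscribed about a circle: some circle whose closed disk lies in the polygon
touches every edge. -/
def IsCircumscribed (P : SimplePolygon n) : Prop :=
  ∃ (c : Plane) (r : ℝ), 0 < r ∧ Metric.closedBall c r ⊆ P.region ∧
    ∀ k, (Metric.sphere c r ∩ P.edge k).Nonempty

/-- A Cairo pentagon: circumscribed about a circle, with two nonadjacent right angles and three
angles of `2π/3`. -/
def IsCairo (P : SimplePolygon 5) : Prop :=
  P.IsConvex ∧ P.IsCircumscribed ∧ ∃ k : Fin 5,
    P.angle k = Real.pi / 2 ∧ P.angle (k + 1) = 2 * Real.pi / 3 ∧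
    P.angle (k + 2) = Real.pi / 2 ∧ P.angle (k + 3) = 2 * Real.pi / 3 ∧
    P.angle (k + 4) = 2 * Real.pi / 3

/-- A Prismatic pentagon: circumscribed about a circle, with two adjacent right angles and three
angles of `2π/3`. -/
def IsPrismatic (P : SimplePolygon 5) : Prop :=
  P.IsConvex ∧ P.IsCircumscribed ∧ ∃ k : Fin 5,
    P.angle k = Real.pi / 2 ∧ P.angle (k + 1) = Real.pi / 2 ∧
    P.angle (k + 2) = 2 * Real.pi / 3 ∧ P.angle (k + 3) = 2 * Real.pi / 3 ∧
    P.angle (k + 4) = 2 * Real.pi / 3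

/-- A unit-area pentagon is efficient if its perimeter is at most that of a unit-area Cairo
pentagon. -/
def IsEfficient (P : SimplePolygon 5) : Prop :=
  P.area = 1 ∧ ∃ C : SimplePolygon 5, C.IsCairo ∧ C.area = 1 ∧ P.perimeter ≤ C.perimeter

/-- Two polygons are congruent (`Q` is a copy of `P`) if some isometry of the plane, possibly
orientation reversing, carries the region and the set of vertices of one to those of the other. -/
def Congruent {m : ℕ} (P : SimplePolygon m) (Q : SimplePolygon n) : Prop :=
  ∃ g : Plane ≃ᵢ Plane, g '' P.region = Q.region ∧
    g '' Set.range P.vertex = Set.range Q.vertex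

end SimplePolygon

/-- A flat torus `Plane ⧸ lattice`, given by a basis of the lattice, together with finitely many
polygons to be placed on it, each given by one of its lifts to the plane. -/
structure TorusTiles where
  /-- a basis of the plane that generates the lattice -/
  basis : Module.Basis (Fin 2) ℝ Plane
  /-- the number of polygons on the torus -/
  numTiles : ℕ
  /-- the number of sides of each polygon -/
  sides : Fin numTiles → ℕ
  /-- the polygons, lifted to the plane -/
  tile : (i : Fin numTiles) → SimplePolygon (sides i)

namespace TorusTiles

/-- The lattice of the torus. -/
def lattice (D : TorusTiles) : AddSubgroup Plane := AddSubgroup.closure (Set.range D.basis)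

/-- All lifts to the plane of the polygons on the torus: a lift is one of the given polygons
translated by a lattice vector. -/
abbrev Lift (D : TorusTiles) : Type := Fin D.numTiles × D.lattice

/-- The region of a lift. -/
def liftRegion (D : TorusTiles) (p : D.Lift) : Set Plane :=
  (p.2 : Plane) +ᵥ (D.tile p.1).region

/-- The vertices of a lift. -/
def liftVertex (D : TorusTiles) (p : D.Lift) (k : Fin (D.sides p.1)) : Plane :=
  (p.2 : Plane) +ᵥ (D.tile p.1).vertex k

/-- The edges of a lift. -/
def liftEdge (D : TorusTiles) (p : D.Lift) (k : Fin (D.sides p.1)) : Set Plane :=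
  (p.2 : Plane) +ᵥ (D.tile p.1).edge k

/-- The sides of the polygons: pairs of a polygon and the index of one of its edges. -/
abbrev Side (D : TorusTiles) : Type := (i : Fin D.numTiles) × Fin (D.sides i)

/-- The closed segment in the plane of a side. -/
def sideSet (D : TorusTiles) (s : D.Side) : Set Plane := (D.tile s.1).edge s.2

/-- Two sides are the same edge on the torus if a lattice translation carries one to the other. -/
def sideSetoid (D : TorusTiles) : Setoid D.Side where
  r s s' := ∃ t ∈ D.lattice, t +ᵥ D.sideSet s = D.sideSet s'
  iseqv :=
    { refl := fun _ => ⟨0, D.lattice.zero_mem, zero_vadd _ _⟩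
      symm := by
        rintro s s' ⟨t, ht, h⟩
        exact ⟨-t, D.lattice.neg_mem ht, by rw [← h, neg_vadd_vadd]⟩
      trans := by
        rintro s s' s'' ⟨t, ht, h⟩ ⟨u, hu, h'⟩
        exact ⟨u + t, D.lattice.add_mem hu ht, by rw [← h', ← h, add_vadd]⟩ }

/-- The edges on the torus. An edge shared by two polygons is one element. -/
abbrev Edge (D : TorusTiles) : Type := Quotient D.sideSetoid

/-- The length of an edge on the torus (a segment is as long as its diameter). -/
def edgeLength (D : TorusTiles) : D.Edge → ℝ :=
  Quotient.lift (fun s => Metric.diam (D.sideSet s)) (by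
    rintro s s' ⟨t, -, h⟩
    rw [← h]
    exact ((isometry_vadd Plane t).diam_image (D.sideSet s)).symm)

/-- The perimeter: the total length of the edges on the torus, each edge counted once. -/
def perimeter (D : TorusTiles) : ℝ := ∑ᶠ e : D.Edge, D.edgeLength e

/-- The perimeter per tile. -/
def perimeterPerTile (D : TorusTiles) : ℝ := D.perimeter / D.numTiles

end TorusTiles

/-- An edge-to-edge tiling of a flat torus by finitely many polygons: the lifts of the polygons
cover the plane, different lifts have disjoint interiors, and different lifts meet only along
entire common edges or at common vertices. -/
structure TorusTiling extends TorusTiles where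
  covers : ∀ x : Plane, ∃ p : toTorusTiles.Lift, x ∈ toTorusTiles.liftRegion p
  disjoint_interiors : ∀ p q : toTorusTiles.Lift, p ≠ q →
    Disjoint (interior (toTorusTiles.liftRegion p)) (interior (toTorusTiles.liftRegion q))
  edge_to_edge : ∀ p q : toTorusTiles.Lift, p ≠ q →
    ∀ x ∈ toTorusTiles.liftRegion p ∩ toTorusTiles.liftRegion q,
      (∃ k l, x = toTorusTiles.liftVertex p k ∧ x = toTorusTiles.liftVertex q l) ∨
      (∃ k l, toTorusTiles.liftEdge p k = toTorusTiles.liftEdge q l ∧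
        x ∈ toTorusTiles.liftEdge p k)

end

/-!
Write `S = 2 + √3`. A Cairo or Prismatic pentagon of unit area has perimeter at most `2 * √S`: by the
tangent lengths its perimeter is `2 * S` times its inradius, and its area is at least half the inradius
times the perimeter (`SimplePolygon.perimeter_sq_le_of_isCairo_or_isPrismatic`). So it is enough to
show that the average perimeter of the tiles is at least `2 * √S`, because each edge of the tiling
belongs to at most two sides of tiles (`TorusTiling.card_sides_le_two`,
`TorusTiling.sum_perimeter_le`).

Pentagons. If a vertex of a pentagon of unit area lies in the convex hull of the other four, the
isoperimetric inequality for four points makes the perimeter at least `4`, which is more than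
`2 * √S`. Hence an efficient pentagon has its vertices in convex position and is a convex pentagon
(`SimplePolygon.exists_path_of_convexPosition`). If its angles are `α k`, its perimeter `p` satisfies
`p ^ 2 ≥ 4 * ∑ k, cot (α k / 2)`, the isoperimetric inequality of Lhuilier
(`IsStrictlyConvexPath.isoperimetric`); its proof compares the pentagon with a circle that touches three
suitable sides.

Quadrilaterals. A non-convex quadrilateral lies in the triangle of three of its vertices
(`SimplePolygon.nonconvex_quadrilateral_bounds`). So its perimeter is at least that of an equilateral
triangle of unit area, about `4.559`, well above `2 * √S`, which is about `3.864`. Its angles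
contribute little to the vertices of the tiling: the sum of the areas cut out of small disks at its
vertices corresponds to an angle sum of at most `3 * π`.

Vertices. Angles are measured by the area that a tile cuts out of a small disk about a vertex. Since the
tiling is edge-to-edge, a vertex of one tile is a vertex of every tile that contains it, and these
tiles fill the disk (`TorusTiling.exists_sum_volume_inter_ball`); so the angles at each vertex of the
tiling add up to `2 * π`. The function `cot (a / 2)` is convex on `(0, π)`; its tangents at `2 * π / 3`
and at `π / 2` bound the sum of `cot (α / 2)` over the pentagon corners at one vertex by a linear
function of the number of these corners and of the angle taken by quadrilaterals
(`sum_cotHalf_ge_of_sum_eq_two_pi`). Added up over all vertices, with `n` pentagons and `m`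
quadrilaterals, this gives `n * p ^ 2 ≥ 4 * (n * S - c * m)` where `c = 18 - 6 * √3 - 2 * π`
(`TorusTiling.sum_cotHalf_ge`). The resulting defect of the pentagons is smaller than the surplus of
the quadrilaterals (`perimeter_arith`).
-/


open scoped Pointwise

open MeasureTheory Filter Topology

/-! ### The signed area form and circular sectors -/

/-- The signed area of the parallelogram spanned by two vectors of the plane. -/
noncomputable def wedge (a b : Plane) : ℝ := a 0 * b 1 - a 1 * b 0

theorem plane_inner_eq (a b : Plane) : inner ℝ a b = a 0 * b 0 + a 1 * b 1 := by
  simp [PiLp.inner_apply, Fin.sum_univ_two]; ring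

theorem plane_norm_sq (a : Plane) : ‖a‖ ^ 2 = a 0 ^ 2 + a 1 ^ 2 := by
  simp [EuclideanSpace.norm_sq_eq, Fin.sum_univ_two]

theorem inner_sq_add_wedge_sq (a b : Plane) :
    (inner ℝ a b : ℝ) ^ 2 + wedge a b ^ 2 = ‖a‖ ^ 2 * ‖b‖ ^ 2 := by
  rw [plane_inner_eq, plane_norm_sq, plane_norm_sq, wedge]; ring

theorem wedge_swap (a b : Plane) : wedge a b = -wedge b a := by simp only [wedge]; ring

theorem wedge_self (a : Plane) : wedge a a = 0 := by simp only [wedge]; ring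

theorem wedge_smul_right (t : ℝ) (a b : Plane) : wedge a (t • b) = t * wedge a b := by
  simp [wedge]; ring

theorem wedge_smul_left (t : ℝ) (a b : Plane) : wedge (t • a) b = t * wedge a b := by
  simp [wedge]; ring

theorem wedge_add_right (a b c : Plane) : wedge a (b + c) = wedge a b + wedge a c := by
  simp [wedge]; ring

theorem wedge_sub_right (a b c : Plane) : wedge a (b - c) = wedge a b - wedge a c := by
  simp [wedge]; ring

theorem abs_wedge_le (a b : Plane) : |wedge a b| ≤ ‖a‖ * ‖b‖ := by
  refine abs_le_of_sq_le_sq ?_ (by positivity)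
  nlinarith [inner_sq_add_wedge_sq a b, sq_nonneg (inner ℝ a b : ℝ)]

theorem sin_angle_mul_norms (u v : Plane) :
    ‖u‖ * ‖v‖ * Real.sin (InnerProductGeometry.angle u v) = |wedge u v| := by
  have h1 := InnerProductGeometry.sin_angle_mul_norm_mul_norm u v
  rw [mul_comm, h1]
  rw [← Real.sqrt_sq_eq_abs]
  congr 1
  simp only [plane_inner_eq, wedge]; ring

theorem cos_angle_mul_norms (u v : Plane) :
    ‖u‖ * ‖v‖ * Real.cos (InnerProductGeometry.angle u v) = inner ℝ u v := by
  rw [mul_comm]; exact InnerProductGeometry.cos_angle_mul_norm_mul_norm u v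

/-- The isometry of the plane with the complex numbers that takes a given unit vector to `1` and
preserves the orientation. -/
noncomputable def toComplexOf (e : Plane) (he : ‖e‖ = 1) : Plane ≃ₗᵢ[ℝ] ℂ :=
  LinearIsometry.toLinearIsometryEquiv
    { toFun := fun z => ⟨inner ℝ e z, wedge e z⟩
      map_add' := fun x y => by
        apply Complex.ext <;> simp [inner_add_right, wedge_add_right]
      map_smul' := fun c x => by
        apply Complex.ext <;> simp [inner_smul_right, wedge_smul_right]
      norm_map' := fun x => by
        have h := inner_sq_add_wedge_sq e x
        rw [he] at h
        rw [← sq_eq_sq₀ (norm_nonneg _) (norm_nonneg _)]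
        show ‖(⟨inner ℝ e x, wedge e x⟩ : ℂ)‖ ^ 2 = _
        rw [Complex.sq_norm, Complex.normSq_apply]
        simp only
        linarith }
    (by simp)

theorem toComplexOf_apply (e : Plane) (he : ‖e‖ = 1) (z : Plane) :
    toComplexOf e he z = ⟨inner ℝ e z, wedge e z⟩ := rfl

/-- The area of a circular sector with vertex at the origin of the complex plane, one side of which
lies on the positive real axis. -/
theorem volume_complex_sector {θ ε : ℝ} (hθ : 0 < θ) (hθ' : θ < Real.pi) (hε : 0 < ε) :
    volume {w : ℂ | 0 ≤ w.im ∧ 0 ≤ w.re * Real.sin θ - w.im * Real.cos θ ∧ ‖w‖ < ε} =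
      ENNReal.ofReal (θ * ε ^ 2 / 2) := by
  set S := {w : ℂ | 0 ≤ w.im ∧ 0 ≤ w.re * Real.sin θ - w.im * Real.cos θ ∧ ‖w‖ < ε} with hS
  have hSm : MeasurableSet S := by
    refine MeasurableSet.inter ?_ (MeasurableSet.inter ?_ ?_)
    · exact (isClosed_le continuous_const Complex.continuous_im).measurableSet
    · exact (isClosed_le continuous_const
      ((Complex.continuous_re.mul continuous_const).sub
        (Complex.continuous_im.mul continuous_const))).measurableSet
    · exact (isOpen_lt continuous_norm continuous_const).measurableSet
  rw [← lintegral_indicator_one hSm, ← Complex.lintegral_comp_polarCoord_symm]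
  have hset : ∀ p ∈ polarCoord.target,
      ENNReal.ofReal p.1 • S.indicator (1 : ℂ → ENNReal) (Complex.polarCoord.symm p) =
        (Set.Ioo 0 ε ×ˢ Set.Icc 0 θ).indicator (fun q : ℝ × ℝ => ENNReal.ofReal q.1) p := by
    rintro ⟨r, φ⟩ hp
    simp only [polarCoord_target, Set.mem_prod, Set.mem_Ioi, Set.mem_Ioo] at hp
    obtain ⟨hr, h1, h2⟩ := hp
    have hmem : Complex.polarCoord.symm (r, φ) ∈ S ↔ (r, φ) ∈ Set.Ioo 0 ε ×ˢ Set.Icc 0 θ := by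
      have him : (Complex.polarCoord.symm (r, φ)).im = r * Real.sin φ := by
        simp [Complex.polarCoord_symm_apply, Complex.sin_ofReal_re]
      have hre : (Complex.polarCoord.symm (r, φ)).re = r * Real.cos φ := by
        simp [Complex.polarCoord_symm_apply, Complex.cos_ofReal_re]
      have hn : ‖Complex.polarCoord.symm (r, φ)‖ = r := by
        rw [Complex.norm_polarCoord_symm]; exact abs_of_pos hr
      have hsub : (r * Real.cos φ) * Real.sin θ - (r * Real.sin φ) * Real.cos θ =
          r * Real.sin (θ - φ) := by rw [Real.sin_sub]; ring
      simp only [hS, Set.mem_ofPred_eq, him, hre, hn, hsub, Set.mem_prod, Set.mem_Ioo, Set.mem_Icc]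
      constructor
      · rintro ⟨ha, hb, hc⟩
        have hφ : 0 ≤ φ := by
          by_contra h
          push Not at h
          have := Real.sin_neg_of_neg_of_neg_pi_lt h h1
          nlinarith
        refine ⟨⟨hr, hc⟩, hφ, ?_⟩
        by_contra h
        push Not at h
        have := Real.sin_neg_of_neg_of_neg_pi_lt (x := θ - φ) (by linarith) (by linarith)
        nlinarith
      · rintro ⟨⟨-, hc⟩, ha, hb⟩
        refine ⟨mul_nonneg hr.le (Real.sin_nonneg_of_nonneg_of_le_pi ha h2.le),
          mul_nonneg hr.le (Real.sin_nonneg_of_nonneg_of_le_pi (by linarith) (by linarith)), hc⟩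
    by_cases hm : Complex.polarCoord.symm (r, φ) ∈ S
    · rw [Set.indicator_of_mem hm, Set.indicator_of_mem (hmem.1 hm)]; simp
    · rw [Set.indicator_of_notMem hm, Set.indicator_of_notMem (fun h => hm (hmem.2 h))]; simp
  rw [setLIntegral_congr_fun polarCoord.open_target.measurableSet hset]
  have hT : MeasurableSet (Set.Ioo 0 ε ×ˢ Set.Icc 0 θ : Set (ℝ × ℝ)) :=
    measurableSet_Ioo.prod measurableSet_Icc
  rw [setLIntegral_indicator hT]
  have hsub : (Set.Ioo 0 ε ×ˢ Set.Icc 0 θ : Set (ℝ × ℝ)) ∩ polarCoord.target =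
      Set.Ioo 0 ε ×ˢ Set.Icc 0 θ := by
    apply Set.inter_eq_left.2
    rintro ⟨r, φ⟩ ⟨⟨h1, h2⟩, h3, h4⟩
    simp only at h1 h2 h3 h4
    simp only [polarCoord_target, Set.mem_prod, Set.mem_Ioi, Set.mem_Ioo]
    exact ⟨h1, by linarith, by linarith⟩
  rw [hsub, Measure.volume_eq_prod, setLIntegral_prod _ (by fun_prop)]
  simp only [setLIntegral_const, Real.volume_Icc, sub_zero]
  rw [lintegral_mul_const _ (by fun_prop)]
  rw [← ofReal_integral_eq_lintegral_ofReal]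
  · rw [← integral_Ioc_eq_integral_Ioo, ← intervalIntegral.integral_of_le hε.le, integral_id,
      ← ENNReal.ofReal_mul (by nlinarith [sq_nonneg ε])]
    congr 1; ring
  · exact (continuous_id.integrableOn_Icc (a := 0) (b := ε)).mono_set Set.Ioo_subset_Icc_self
  · exact (ae_restrict_iff' measurableSet_Ioo).2 (Filter.Eventually.of_forall fun x hx => hx.1.le)

/-- The angular sector swept counterclockwise from direction `u` to direction `v`. -/
def sector (u v : Plane) : Set Plane := {z | 0 ≤ wedge u z ∧ 0 ≤ wedge z v}

theorem volume_sector_inter_ball {u v : Plane} (h : 0 < wedge u v) {ε : ℝ} (hε : 0 < ε) :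
    volume (sector u v ∩ Metric.ball 0 ε) =
      ENNReal.ofReal (InnerProductGeometry.angle u v * ε ^ 2 / 2) := by
  have hu : u ≠ 0 := by rintro rfl; simp [wedge] at h
  have hv : v ≠ 0 := by rintro rfl; simp [wedge] at h
  have hun : 0 < ‖u‖ := norm_pos_iff.2 hu
  have hvn : 0 < ‖v‖ := norm_pos_iff.2 hv
  have he : ‖(‖u‖⁻¹ • u : Plane)‖ = 1 := by
    rw [norm_smul, norm_inv, norm_norm, inv_mul_cancel₀ hun.ne']
  set θ := InnerProductGeometry.angle u v
  have hs := sin_angle_mul_norms u v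
  have hc := cos_angle_mul_norms u v
  rw [abs_of_pos h] at hs
  have hsin : 0 < Real.sin θ := by
    by_contra hneg
    push Not at hneg
    have : ‖u‖ * ‖v‖ * Real.sin θ ≤ 0 := mul_nonpos_of_nonneg_of_nonpos (by positivity) hneg
    linarith
  have hθ : 0 < θ := by
    rcases (InnerProductGeometry.angle_nonneg u v).eq_or_lt with h0 | h0
    · exfalso; change 0 = θ at h0; rw [← h0] at hsin; simp at hsin
    · exact h0
  have hθ' : θ < Real.pi := by
    rcases (InnerProductGeometry.angle_le_pi u v).eq_or_lt with h0 | h0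
    · exfalso; change θ = _ at h0; rw [h0] at hsin; simp at hsin
    · exact h0
  rw [← volume_complex_sector hθ hθ' hε]
  have hmp := (toComplexOf _ he).measurePreserving
  rw [← hmp.measure_preimage_emb (toComplexOf _ he).toMeasurableEquiv.measurableEmbedding]
  congr 1
  ext z
  have hnorm : ‖toComplexOf _ he z‖ = ‖z‖ := (toComplexOf _ he).norm_map z
  rw [Set.mem_preimage, Set.mem_ofPred_eq, hnorm, toComplexOf_apply]
  simp only [sector, Set.mem_inter_iff, Set.mem_ofPred_eq, Metric.mem_ball, dist_zero_right]
  rw [and_assoc]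
  have e1 : wedge (‖u‖⁻¹ • u) z = ‖u‖⁻¹ * wedge u z := wedge_smul_left _ _ _
  have e2 : ‖v‖ * (inner ℝ (‖u‖⁻¹ • u) z * Real.sin θ - wedge (‖u‖⁻¹ • u) z * Real.cos θ) =
      wedge z v := by
    rw [e1, real_inner_smul_left]
    have hu2 := plane_norm_sq u
    have : ‖u‖ ^ 2 * (‖v‖ * (‖u‖⁻¹ * inner ℝ u z * Real.sin θ - ‖u‖⁻¹ * wedge u z * Real.cos θ)) =
      inner ℝ u z * (‖u‖ * ‖v‖ * Real.sin θ) - wedge u z * (‖u‖ * ‖v‖ * Real.cos θ) := by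
      field_simp
    rw [hs, hc] at this
    have h2 : inner ℝ u z * wedge u v - wedge u z * inner ℝ u v = ‖u‖ ^ 2 * wedge z v := by
      rw [hu2, plane_inner_eq, plane_inner_eq]; simp only [wedge]; ring
    rw [h2] at this
    exact mul_left_cancel₀ (by positivity) this
  rw [← e2, e1, mul_nonneg_iff_of_pos_left (inv_pos.2 hun), mul_nonneg_iff_of_pos_left hvn]

/-! ### Areas of triangles -/

theorem mem_convexHull_triple {a b c z : Plane} :
    z ∈ convexHull ℝ {a, b, c} ↔
      ∃ s t : ℝ, 0 ≤ s ∧ 0 ≤ t ∧ s + t ≤ 1 ∧ z = a + (s • (b - a) + t • (c - a)) := by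
  rw [convexHull_insert (by simp), convexHull_pair]
  simp only [mem_convexJoin, Set.mem_singleton_iff, exists_eq_left]
  constructor
  · rintro ⟨y, ⟨p, q, hp, hq, hpq, rfl⟩, ⟨m, n, hm, hn, hmn, rfl⟩⟩
    refine ⟨n * p, n * q, by positivity, by positivity, ?_, ?_⟩
    · rw [← mul_add, hpq]; linarith
    · have h1 : m = 1 - n := by linarith
      have h2 : p = 1 - q := by linarith
      subst h1 h2
      module
  · rintro ⟨s, t, hs, ht, hst, rfl⟩
    rcases (add_nonneg hs ht).eq_or_lt with h0 | h0
    · have hs0 : s = 0 := by linarith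
      have ht0 : t = 0 := by linarith
      subst hs0 ht0
      exact ⟨b, left_mem_segment _ _ _, by simp [left_mem_segment]⟩
    · refine ⟨(s / (s + t)) • b + (t / (s + t)) • c,
        ⟨_, _, by positivity, by positivity, by field_simp, rfl⟩, ?_⟩
      refine ⟨1 - (s + t), s + t, by linarith, h0.le, by ring, ?_⟩
      rw [smul_add, smul_smul, smul_smul, mul_div_cancel₀ _ h0.ne', mul_div_cancel₀ _ h0.ne']
      module

theorem volume_prod_standard_triangle :
    volume {p : ℝ × ℝ | 0 ≤ p.1 ∧ 0 ≤ p.2 ∧ p.1 + p.2 ≤ 1} = ENNReal.ofReal (1 / 2) := by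
  have hm : MeasurableSet {p : ℝ × ℝ | 0 ≤ p.1 ∧ 0 ≤ p.2 ∧ p.1 + p.2 ≤ 1} := by
    refine MeasurableSet.inter ?_ (MeasurableSet.inter ?_ ?_)
    · exact (isClosed_le continuous_const continuous_fst).measurableSet
    · exact (isClosed_le continuous_const continuous_snd).measurableSet
    · exact (isClosed_le (continuous_fst.add continuous_snd) continuous_const).measurableSet
  rw [Measure.volume_eq_prod, Measure.prod_apply hm]
  have : ∀ x : ℝ, volume (Prod.mk x ⁻¹' {p : ℝ × ℝ | 0 ≤ p.1 ∧ 0 ≤ p.2 ∧ p.1 + p.2 ≤ 1}) =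
      (Set.Icc 0 1).indicator (fun x : ℝ => ENNReal.ofReal (1 - x)) x := by
    intro x
    by_cases hx : x ∈ Set.Icc (0 : ℝ) 1
    · rw [Set.indicator_of_mem hx]
      have : Prod.mk x ⁻¹' {p : ℝ × ℝ | 0 ≤ p.1 ∧ 0 ≤ p.2 ∧ p.1 + p.2 ≤ 1} =
          Set.Icc 0 (1 - x) := by
        ext y
        simp only [Set.mem_preimage, Set.mem_ofPred_eq, Set.mem_Icc]
        exact ⟨fun h => ⟨h.2.1, by linarith [h.2.2]⟩, fun h => ⟨hx.1, h.1, by linarith [h.2]⟩⟩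
      rw [this, Real.volume_Icc, sub_zero]
    · rw [Set.indicator_of_notMem hx]
      have : Prod.mk x ⁻¹' {p : ℝ × ℝ | 0 ≤ p.1 ∧ 0 ≤ p.2 ∧ p.1 + p.2 ≤ 1} = ∅ := by
        ext y
        simp only [Set.mem_preimage, Set.mem_ofPred_eq, Set.mem_empty_iff_false, iff_false]
        exact fun h => hx ⟨h.1, by linarith [h.2.1, h.2.2]⟩
      rw [this, measure_empty]
  simp_rw [this]
  rw [lintegral_indicator measurableSet_Icc, ← ofReal_integral_eq_lintegral_ofReal]
  · rw [integral_Icc_eq_integral_Ioc, ← intervalIntegral.integral_of_le zero_le_one]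
    congr 1
    rw [intervalIntegral.integral_sub (by simp) (by simp)]
    simp; norm_num
  · exact (Continuous.integrableOn_Icc (by fun_prop))
  · exact (ae_restrict_iff' measurableSet_Icc).2
      (Filter.Eventually.of_forall fun x hx => by simpa using hx.2)

theorem volume_standard_triangle :
    volume {z : Plane | 0 ≤ z 0 ∧ 0 ≤ z 1 ∧ z 0 + z 1 ≤ 1} = ENNReal.ofReal (1 / 2) := by
  rw [← volume_prod_standard_triangle]
  have h1 := EuclideanSpace.volume_preserving_symm_measurableEquiv_toLp (Fin 2)
  have h2 := volume_preserving_finTwoArrow ℝ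
  have h := h2.comp h1
  rw [← (h2.comp h1).measure_preimage_emb]
  · rfl
  · exact (MeasurableEquiv.measurableEmbedding _).comp (MeasurableEquiv.measurableEmbedding _)

/-- The area of a triangle. -/
theorem volume_convexHull_triple (a b c : Plane) :
    volume (convexHull ℝ {a, b, c}) = ENNReal.ofReal (|wedge (b - a) (c - a)| / 2) := by
  let B := (EuclideanSpace.basisFun (Fin 2) ℝ).toBasis
  let M : Matrix (Fin 2) (Fin 2) ℝ := !![(b - a) 0, (c - a) 0; (b - a) 1, (c - a) 1]
  have hL : ∀ z : Plane, Matrix.toLin B B M z = z 0 • (b - a) + z 1 • (c - a) := by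
    intro z
    rw [Matrix.toLin_apply]
    ext i
    fin_cases i <;>
    · simp [B, M, Matrix.mulVec, dotProduct, Fin.sum_univ_two]
      try ring
  have hset : convexHull ℝ {a, b, c} =
      (a + ·) '' (Matrix.toLin B B M '' {z : Plane | 0 ≤ z 0 ∧ 0 ≤ z 1 ∧ z 0 + z 1 ≤ 1}) := by
    ext z
    rw [mem_convexHull_triple]
    constructor
    · rintro ⟨s, t, hs, ht, hst, rfl⟩
      refine ⟨_, ⟨!₂[s, t], ⟨by simpa, by simpa, by simpa⟩, rfl⟩, ?_⟩
      simp [hL]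
    · rintro ⟨_, ⟨w, ⟨h0, h1, h2⟩, rfl⟩, rfl⟩
      exact ⟨w 0, w 1, h0, h1, h2, by simp [hL]⟩
  rw [hset, Set.image_add_left, measure_preimage_add, Measure.addHaar_image_linearMap,
    volume_standard_triangle, LinearMap.det_toLin, Matrix.det_fin_two,
    ← ENNReal.ofReal_mul (abs_nonneg _)]
  simp only [M, wedge, Matrix.of_apply, Matrix.cons_val]
  congr 1
  rw [show ((b - a) 0 * (c - a) 1 - (c - a) 0 * (b - a) 1) =
    (b - a) 0 * (c - a) 1 - (b - a) 1 * (c - a) 0 by ring]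
  ring

theorem volume_real_convexHull_triple (a b c : Plane) :
    volume.real (convexHull ℝ {a, b, c}) = |wedge (b - a) (c - a)| / 2 := by
  rw [Measure.real, volume_convexHull_triple, ENNReal.toReal_ofReal (by positivity)]

theorem volume_triple_ne_top (a b c : Plane) : volume (convexHull ℝ {a, b, c}) ≠ ⊤ := by
  rw [volume_convexHull_triple]; exact ENNReal.ofReal_ne_top

theorem volume_segment_eq_zero (a b : Plane) : volume (segment ℝ a b) = 0 := by
  have h := volume_convexHull_triple a b b
  rw [show ({a, b, b} : Set Plane) = {a, b} by simp, convexHull_pair, wedge_self] at h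
  simpa using h

/-- The isoperimetric inequality for triangles, from Heron's formula and the inequality of
arithmetic and geometric means. -/
theorem triangle_area_sq_le (a b c : Plane) :
    432 * (|wedge (b - a) (c - a)| / 2) ^ 2 ≤ (dist a b + dist b c + dist c a) ^ 4 := by
  have hu : dist a b = ‖b - a‖ := by rw [dist_comm, dist_eq_norm]
  have hv : dist c a = ‖c - a‖ := dist_eq_norm _ _
  have hw : dist b c = ‖(b - a) - (c - a)‖ := by rw [dist_eq_norm]; congr 1; abel
  rw [hu, hv, hw]
  generalize b - a = u
  generalize c - a = v
  have h1 := inner_sq_add_wedge_sq u v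
  have h2 : ‖u - v‖ ^ 2 = ‖u‖ ^ 2 - 2 * inner ℝ u v + ‖v‖ ^ 2 := norm_sub_sq_real u v
  have t1 : ‖u - v‖ ≤ ‖u‖ + ‖v‖ := norm_sub_le u v
  have t2 : ‖u‖ ≤ ‖u - v‖ + ‖v‖ := by simpa using norm_add_le (u - v) v
  have t3 : ‖v‖ ≤ ‖u - v‖ + ‖u‖ := by
    have := norm_add_le (v - u) u; rw [norm_sub_rev] at this; simpa using this
  have hx := norm_nonneg u
  have hy := norm_nonneg v
  have hz := norm_nonneg (u - v)
  rw [div_pow, sq_abs]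
  generalize ‖u‖ = x at *
  generalize ‖v‖ = y at *
  generalize ‖u - v‖ = z at *
  have hin : (inner ℝ u v : ℝ) = (x ^ 2 + y ^ 2 - z ^ 2) / 2 := by linarith
  rw [hin] at h1
  have hW : wedge u v ^ 2 = (x + y + z) * ((y + z - x) * (x + z - y) * (x + y - z)) / 4 := by
    nlinarith
  rw [hW]
  have hp : 0 ≤ y + z - x := by linarith
  have hq : 0 ≤ x + z - y := by linarith
  have hr : 0 ≤ x + y - z := by linarith
  have key : ∀ p q r : ℝ, 0 ≤ p → 0 ≤ q → 0 ≤ r → 27 * (p * q * r) ≤ (p + q + r) ^ 3 := by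
    intro p q r hp hq hr
    nlinarith [mul_nonneg hp (sq_nonneg (q - r)), mul_nonneg hq (sq_nonneg (p - r)),
      mul_nonneg hr (sq_nonneg (p - q)), mul_nonneg (add_nonneg (add_nonneg hp hq) hr)
      (add_nonneg (add_nonneg (sq_nonneg (p - q)) (sq_nonneg (q - r))) (sq_nonneg (p - r)))]
  have := key _ _ _ hp hq hr
  rw [show y + z - x + (x + z - y) + (x + y - z) = x + y + z by ring] at this
  have h3 := mul_le_mul_of_nonneg_left this (show 0 ≤ x + y + z by positivity)
  nlinarith

/-! ### Convex hulls of four points -/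

theorem abs_wedge_sub_le_dist_mul_dist (a b c : Plane) :
    |wedge (b - a) (c - a)| ≤ dist a b * dist b c := by
  have : wedge (b - a) (c - a) = wedge (b - a) (c - b) := by simp [wedge]; ring
  rw [this, dist_comm a b, dist_comm b c, dist_eq_norm, dist_eq_norm]
  exact abs_wedge_le _ _

theorem volume_real_triple_le (a b c : Plane) :
    volume.real (convexHull ℝ {a, b, c}) ≤ dist a b * dist b c / 2 := by
  rw [volume_real_convexHull_triple]
  linarith [abs_wedge_sub_le_dist_mul_dist a b c]

theorem volume_real_triple_le_sq (a b c : Plane) :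
    16 * volume.real (convexHull ℝ {a, b, c}) ≤ (dist a b + dist b c + dist c a) ^ 2 := by
  rw [volume_real_convexHull_triple]
  refine le_of_sq_le_sq ?_ (by positivity)
  have := triangle_area_sq_le a b c
  nlinarith [sq_nonneg (|wedge (b - a) (c - a)| / 2)]

/-- The convex hull of four points, two pairs of which span crossing segments, is covered by the two
triangles on either side of one of these segments. -/
theorem convexHull_subset_of_segments_inter {a b c d z : Plane} (h1 : z ∈ segment ℝ a c)
    (h2 : z ∈ segment ℝ b d) :
    convexHull ℝ {a, b, c, d} ⊆ convexHull ℝ {a, b, c} ∪ convexHull ℝ {c, d, a} := by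
  have hset : ({a, b, c, d} : Set Plane) = {a, c} ∪ {b, d} := by
    ext x; simp only [Set.mem_insert_iff, Set.mem_singleton_iff, Set.mem_union]; tauto
  rw [hset, convexHull_union (by simp) (by simp), convexHull_pair, convexHull_pair]
  intro x hx
  obtain ⟨s, hs, t, ht, hx⟩ := mem_convexJoin.1 hx
  have hsub : ∀ {p q : Plane} {S : Set Plane}, p ∈ S → q ∈ S → segment ℝ p q ⊆ convexHull ℝ S :=
    fun hp hq => segment_subset_convexHull hp hq
  have ht' : t ∈ segment ℝ b z ∪ segment ℝ z d := by
    have h : Wbtw ℝ b z d := mem_segment_iff_wbtw.1 h2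
    have h' : Wbtw ℝ b t d := mem_segment_iff_wbtw.1 ht
    obtain ⟨u, ⟨hu0, hu1⟩, rfl⟩ := h
    obtain ⟨v, ⟨hv0, hv1⟩, rfl⟩ := h'
    rw [← affineSegment_eq_segment, ← affineSegment_eq_segment]
    rcases le_total v u with hle | hle
    · left
      rcases hu0.eq_or_lt with h0 | h0
      · have : v = 0 := by linarith
        subst this; simp [← h0]
      · refine ⟨v / u, ⟨by positivity, (div_le_one h0).2 hle⟩, ?_⟩
        simp only [AffineMap.lineMap_apply_module']
        rw [add_sub_cancel_right, smul_smul, div_mul_cancel₀ _ h0.ne']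
    · right
      rcases hu1.eq_or_lt with h0 | h0
      · have : v = 1 := by linarith
        subst this; simp [h0]
      · have h3 : 0 < 1 - u := by linarith
        refine ⟨(v - u) / (1 - u), ⟨div_nonneg (by linarith) h3.le,
          (div_le_one h3).2 (by linarith)⟩, ?_⟩
        simp only [AffineMap.lineMap_apply_module']
        rw [show d - (u • (d - b) + b) = (1 - u) • (d - b) by module, smul_smul,
          div_mul_cancel₀ _ h3.ne']
        module
  rcases ht' with ht' | ht'
  · left
    refine (convex_convexHull ℝ _).segment_subset (hsub (by simp) (by simp) hs) ?_ hx
    exact (convex_convexHull ℝ _).segment_subset (subset_convexHull ℝ _ (by simp))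
      (hsub (p := a) (q := c) (by simp) (by simp) h1) ht'
  · right
    refine (convex_convexHull ℝ _).segment_subset
      (hsub (p := a) (q := c) (by simp) (by simp) hs) ?_ hx
    exact (convex_convexHull ℝ _).segment_subset
      (hsub (p := a) (q := c) (by simp) (by simp) h1) (subset_convexHull ℝ _ (by simp)) ht'

theorem volume_real_convexHull_le_of_segments_inter {a b c d z : Plane} (h1 : z ∈ segment ℝ a c)
    (h2 : z ∈ segment ℝ b d) :
    4 * volume.real (convexHull ℝ {a, b, c, d}) ≤
      (dist a b + dist c d) * (dist b c + dist d a) := by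
  have step : ∀ {a b c d : Plane}, z ∈ segment ℝ a c → z ∈ segment ℝ b d →
      volume.real (convexHull ℝ {a, b, c, d}) ≤
        dist a b * dist b c / 2 + dist c d * dist d a / 2 := by
    intro a b c d h1 h2
    calc _ ≤ volume.real (convexHull ℝ {a, b, c} ∪ convexHull ℝ {c, d, a}) :=
          measureReal_mono (convexHull_subset_of_segments_inter h1 h2)
            (measure_union_ne_top (volume_triple_ne_top _ _ _) (volume_triple_ne_top _ _ _))
      _ ≤ _ := measureReal_union_le _ _
      _ ≤ _ := add_le_add (volume_real_triple_le _ _ _) (volume_real_triple_le _ _ _)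
  have s1 := step h1 h2
  have s2 := step h2 (segment_symm ℝ a c ▸ h1)
  rw [show ({b, c, d, a} : Set Plane) = {a, b, c, d} by
    ext x; simp only [Set.mem_insert_iff, Set.mem_singleton_iff]; tauto] at s2
  nlinarith

theorem dist_add_dist_le_of_segments_inter {a b c d z : Plane} (h1 : z ∈ segment ℝ a c)
    (h2 : z ∈ segment ℝ b d) : dist a b + dist c d ≤ dist a c + dist b d := by
  have e1 := (mem_segment_iff_wbtw.1 h1).dist_add_dist
  have e2 := (mem_segment_iff_wbtw.1 h2).dist_add_dist
  have t1 := dist_triangle a z b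
  have t2 := dist_triangle c z d
  rw [dist_comm z b] at t1
  rw [dist_comm c z] at t2
  linarith

/-- Of four points of the plane, either one lies in the triangle of the other three, or two disjoint
pairs span crossing segments. This is Radon's theorem in the plane. -/
theorem four_points_cases (a b c d : Plane) :
    a ∈ convexHull ℝ {b, c, d} ∨ b ∈ convexHull ℝ {a, c, d} ∨ c ∈ convexHull ℝ {a, b, d} ∨
      d ∈ convexHull ℝ {a, b, c} ∨ (∃ z, z ∈ segment ℝ a b ∧ z ∈ segment ℝ c d) ∨
      (∃ z, z ∈ segment ℝ a c ∧ z ∈ segment ℝ b d) ∨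
      (∃ z, z ∈ segment ℝ a d ∧ z ∈ segment ℝ b c) := by
  have hna : ¬ AffineIndependent ℝ ![a, b, c, d] := by
    intro h
    have := h.card_le_finrank_succ
    have h2 : Module.finrank ℝ (vectorSpan ℝ (Set.range ![a, b, c, d])) ≤ Module.finrank ℝ Plane :=
      Submodule.finrank_le _
    rw [finrank_euclideanSpace] at h2
    simp only [Nat.succ_eq_add_one, Nat.reduceAdd, Fintype.card_fin] at this h2
    omega
  obtain ⟨I, z, hz1, hz2⟩ := Convex.radon_partition hna
  wlog h0 : (0 : Fin 4) ∈ I generalizing I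
  · exact this Iᶜ hz2 (by rwa [compl_compl]) h0
  have hull : ∀ {S : Set (Fin 4)} {T : Set (Fin 4)}, z ∈ convexHull ℝ (![a, b, c, d] '' S) →
      S = T → z ∈ convexHull ℝ (![a, b, c, d] '' T) := fun h e => e ▸ h
  by_cases i1 : (1 : Fin 4) ∈ I <;> by_cases i2 : (2 : Fin 4) ∈ I <;>
    by_cases i3 : (3 : Fin 4) ∈ I
  · have := hull (T := ∅) hz2 (by ext x; fin_cases x <;> simp [*])
    simp at this
  · have e1 := hull (T := {0, 1, 2}) hz1 (by ext x; fin_cases x <;> simp [*])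
    have e2 := hull (T := {3}) hz2 (by ext x; fin_cases x <;> simp [*])
    simp [Set.image_insert_eq] at e1 e2
    subst e2; tauto
  · have e1 := hull (T := {0, 1, 3}) hz1 (by ext x; fin_cases x <;> simp [*])
    have e2 := hull (T := {2}) hz2 (by ext x; fin_cases x <;> simp [*])
    simp [Set.image_insert_eq] at e1 e2
    subst e2; tauto
  · have e1 := hull (T := {0, 1}) hz1 (by ext x; fin_cases x <;> simp [*])
    have e2 := hull (T := {2, 3}) hz2 (by ext x; fin_cases x <;> simp [*])
    simp [Set.image_insert_eq, convexHull_pair] at e1 e2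
    exact Or.inr (Or.inr (Or.inr (Or.inr (Or.inl ⟨z, e1, e2⟩))))
  · have e1 := hull (T := {0, 2, 3}) hz1 (by ext x; fin_cases x <;> simp [*])
    have e2 := hull (T := {1}) hz2 (by ext x; fin_cases x <;> simp [*])
    simp [Set.image_insert_eq] at e1 e2
    subst e2; tauto
  · have e1 := hull (T := {0, 2}) hz1 (by ext x; fin_cases x <;> simp [*])
    have e2 := hull (T := {1, 3}) hz2 (by ext x; fin_cases x <;> simp [*])
    simp [Set.image_insert_eq, convexHull_pair] at e1 e2
    exact Or.inr (Or.inr (Or.inr (Or.inr (Or.inr (Or.inl ⟨z, e1, e2⟩)))))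
  · have e1 := hull (T := {0, 3}) hz1 (by ext x; fin_cases x <;> simp [*])
    have e2 := hull (T := {1, 2}) hz2 (by ext x; fin_cases x <;> simp [*])
    simp [Set.image_insert_eq, convexHull_pair] at e1 e2
    exact Or.inr (Or.inr (Or.inr (Or.inr (Or.inr (Or.inr ⟨z, e1, e2⟩)))))
  · have e1 := hull (T := {0}) hz1 (by ext x; fin_cases x <;> simp [*])
    have e2 := hull (T := {1, 2, 3}) hz2 (by ext x; fin_cases x <;> simp [*])
    simp [Set.image_insert_eq] at e1 e2
    subst e1; tauto

theorem convexHull_insert_of_mem {x : Plane} {S : Set Plane} (h : x ∈ convexHull ℝ S) :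
    convexHull ℝ (insert x S) = convexHull ℝ S := by
  refine Set.Subset.antisymm (convexHull_min (Set.insert_subset h (subset_convexHull ℝ S))
    (convex_convexHull ℝ S)) (convexHull_mono (Set.subset_insert x S))

/-- The isoperimetric inequality for the convex hull of four points and any closed path through
them. -/
theorem volume_real_convexHull_four_le (a b c d : Plane) :
    16 * volume.real (convexHull ℝ {a, b, c, d}) ≤
      (dist a b + dist b c + dist c d + dist d a) ^ 2 := by
  have tri : ∀ x y z w : Plane, x ∈ convexHull ℝ {y, z, w} →
      16 * volume.real (convexHull ℝ {x, y, z, w}) ≤ (dist y z + dist z w + dist w y) ^ 2 := by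
    intro x y z w h
    rw [convexHull_insert_of_mem h]
    exact volume_real_triple_le_sq y z w
  rcases four_points_cases a b c d with h | h | h | h | ⟨z, h1, h2⟩ | ⟨z, h1, h2⟩ | ⟨z, h1, h2⟩
  · refine (tri _ _ _ _ h).trans (pow_le_pow_left₀ (by positivity) ?_ 2)
    linarith [dist_triangle d a b, dist_comm b d]
  · rw [Set.insert_comm a b]
    refine (tri _ _ _ _ h).trans (pow_le_pow_left₀ (by positivity) ?_ 2)
    linarith [dist_triangle a b c]
  · rw [show ({a, b, c, d} : Set Plane) = {c, a, b, d} by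
      ext x; simp only [Set.mem_insert_iff, Set.mem_singleton_iff]; tauto]
    refine (tri _ _ _ _ h).trans (pow_le_pow_left₀ (by positivity) ?_ 2)
    linarith [dist_triangle b c d]
  · rw [show ({a, b, c, d} : Set Plane) = {d, a, b, c} by
      ext x; simp only [Set.mem_insert_iff, Set.mem_singleton_iff]; tauto]
    refine (tri _ _ _ _ h).trans (pow_le_pow_left₀ (by positivity) ?_ 2)
    linarith [dist_triangle c d a]
  · rw [show ({a, b, c, d} : Set Plane) = {a, c, b, d} by
      ext x; simp only [Set.mem_insert_iff, Set.mem_singleton_iff]; tauto]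
    have e1 := volume_real_convexHull_le_of_segments_inter h1 h2
    have e2 := dist_add_dist_le_of_segments_inter h1 h2
    rw [dist_comm c b] at e1
    nlinarith [sq_nonneg (dist a b + dist c d - (dist b c + dist d a)), dist_nonneg (x := b) (y := c),
      dist_nonneg (x := d) (y := a), dist_comm b d, dist_comm a c]
  · have e1 := volume_real_convexHull_le_of_segments_inter h1 h2
    nlinarith [sq_nonneg (dist a b + dist c d - (dist b c + dist d a))]
  · rw [show ({a, b, c, d} : Set Plane) = {a, b, d, c} by
      ext x; simp only [Set.mem_insert_iff, Set.mem_singleton_iff]; tauto]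
    have e1 := volume_real_convexHull_le_of_segments_inter h1 h2
    have e2 := dist_add_dist_le_of_segments_inter (segment_symm ℝ a d ▸ h1) h2
    rw [dist_comm d c, dist_comm c a] at e1
    rw [dist_comm d b, dist_comm a c] at e2
    nlinarith [sq_nonneg (dist a b + dist c d - (dist b c + dist d a)), dist_nonneg (x := a) (y := b),
      dist_nonneg (x := c) (y := d), dist_comm b d, dist_comm a c]

/-! ### Orientation and simple polygons -/

theorem IsPreconnected.subset_interior_of_disjoint_frontier {X : Type*} [TopologicalSpace X]
    {U R : Set X} (hU : IsPreconnected U) (hd : Disjoint U (frontier R)) (hn : (U ∩ R).Nonempty) :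
    U ⊆ interior R := by
  have hsub : U ⊆ interior R ∪ (closure R)ᶜ := by
    intro x hx
    by_cases h : x ∈ interior R
    · exact Or.inl h
    · refine Or.inr fun h' => Set.disjoint_left.1 hd hx ⟨h', h⟩
  refine hU.subset_left_of_subset_union isOpen_interior isClosed_closure.isOpen_compl ?_ hsub ?_
  · exact Set.disjoint_left.2 fun x h1 h2 => h2 (subset_closure (interior_subset h1))
  · obtain ⟨x, hx, hxR⟩ := hn
    rcases hsub hx with h | h
    · exact ⟨x, hx, h⟩
    · exact absurd (subset_closure hxR) h

/-- Twice the signed area of the triangle `a b c`, positive if it is traversed counterclockwise. -/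
noncomputable def orient (a b c : Plane) : ℝ := wedge (b - a) (c - a)

theorem orient_rotate (a b c : Plane) : orient b c a = orient a b c := by
  simp [orient, wedge]; ring

theorem orient_swap (a b c : Plane) : orient b a c = -orient a b c := by
  simp [orient, wedge]; ring

theorem orient_self_left (a b : Plane) : orient a b a = 0 := by simp [orient, wedge]

theorem orient_self_right (a b : Plane) : orient a b b = 0 := by simp [orient, wedge_self]

theorem orient_combo (a b p q : Plane) {s t : ℝ} (h : s + t = 1) :
    orient a b (s • p + t • q) = s * orient a b p + t * orient a b q := by
  obtain rfl : s = 1 - t := by linarith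
  simp [orient, wedge]; ring

theorem orient_eq_zero_of_mem_segment {a b z : Plane} (h : z ∈ segment ℝ a b) :
    orient a b z = 0 := by
  obtain ⟨s, t, -, -, hst, rfl⟩ := h
  rw [orient_combo _ _ _ _ hst, orient_self_left, orient_self_right]; ring

theorem continuous_orient (a b : Plane) : Continuous (orient a b) := by
  unfold orient wedge; fun_prop

theorem convex_orient_pos (a b : Plane) (s : ℝ) : Convex ℝ {z | 0 < s * orient a b z} := by
  intro p hp q hq α β hα hβ hαβ
  simp only [Set.mem_ofPred_eq] at hp hq ⊢
  rw [orient_combo _ _ _ _ hαβ]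
  rcases hα.eq_or_lt with h | h
  · have : β = 1 := by linarith
    subst this; rw [← h]; linarith
  · have := mul_pos h hp
    have := mul_nonneg hβ hq.le
    linarith

theorem convex_orient_nonneg (a b : Plane) : Convex ℝ {z | 0 ≤ orient a b z} := by
  intro p hp q hq α β hα hβ hαβ
  simp only [Set.mem_ofPred_eq] at hp hq ⊢
  rw [orient_combo _ _ _ _ hαβ]
  positivity

theorem volume_line_eq_zero {a b : Plane} (hne : a ≠ b) : volume {z | orient a b z = 0} = 0 := by
  have hsub : {z | orient a b z = 0} ⊆
      (AffineSubspace.mk' a (LinearMap.ker (⟨⟨fun z => wedge (b - a) z, wedge_add_right _⟩,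
        fun c z => wedge_smul_right c _ z⟩ : Plane →ₗ[ℝ] ℝ)) : AffineSubspace ℝ Plane) := by
    intro z h
    rw [Set.mem_ofPred_eq, orient] at h
    simpa [AffineSubspace.mem_mk'] using h
  refine measure_mono_null hsub (Measure.addHaar_affineSubspace _ _ fun htop => ?_)
  have hdir := congrArg AffineSubspace.direction htop
  rw [AffineSubspace.direction_mk', AffineSubspace.direction_top] at hdir
  have hmem : (!₂[-(b - a) 1, (b - a) 0] : Plane) ∈ (⊤ : Submodule ℝ Plane) := trivial
  rw [← hdir, LinearMap.mem_ker] at hmem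
  change wedge (b - a) !₂[-(b - a) 1, (b - a) 0] = 0 at hmem
  have h2 := plane_norm_sq (b - a)
  simp only [wedge, Matrix.cons_val] at hmem
  have : ‖b - a‖ ^ 2 = 0 := by rw [h2]; linarith
  exact hne (sub_eq_zero.1 (norm_eq_zero.1 (pow_eq_zero_iff two_ne_zero |>.1 this))).symm

namespace SimplePolygon

variable {n : ℕ} (P : SimplePolygon n)

theorem edge_eq_segment (k : Fin n) :
    P.edge k = segment ℝ (P.vertex k) (P.vertex (finRotate n k)) :=
  affineSegment_eq_segment ℝ _ _

theorem vertex_injective : Function.Injective P.vertex := P.isSimple.2.1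

theorem frontier_eq_iUnion_edge : frontier P.region = ⋃ k, P.edge k := P.frontier_region

theorem isClosed_region : IsClosed P.region := P.isCompact_region.isClosed

theorem vertex_mem_edge (k : Fin n) : P.vertex k ∈ P.edge k := by
  rw [edge_eq_segment]; exact left_mem_segment _ _ _

theorem vertex_rotate_mem_edge (k : Fin n) : P.vertex (finRotate n k) ∈ P.edge k := by
  rw [edge_eq_segment]; exact right_mem_segment _ _ _

theorem edge_subset_frontier (k : Fin n) : P.edge k ⊆ frontier P.region := by
  rw [frontier_eq_iUnion_edge]; exact Set.subset_iUnion _ k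

theorem edge_subset_region (k : Fin n) : P.edge k ⊆ P.region :=
  (P.edge_subset_frontier k).trans P.isClosed_region.frontier_subset

theorem vertex_mem_region (k : Fin n) : P.vertex k ∈ P.region :=
  P.edge_subset_region k (P.vertex_mem_edge k)

theorem finRotate_ne {n : ℕ} (P : SimplePolygon n) (k : Fin n) : finRotate n k ≠ k := by
  have h3 := P.isSimple.1
  obtain ⟨m, rfl⟩ : ∃ m, n = m + 2 := ⟨n - 2, by omega⟩
  rw [finRotate_apply]
  simp

theorem vertex_ne_vertex_rotate (k : Fin n) : P.vertex k ≠ P.vertex (finRotate n k) :=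
  fun h => P.finRotate_ne k (P.vertex_injective h).symm

theorem edge_inter_subset {i j : Fin n} (h : i ≠ j) : P.edge i ∩ P.edge j ⊆
    {P.vertex i, P.vertex (finRotate n i)} ∩ {P.vertex j, P.vertex (finRotate n j)} :=
  P.isSimple.2.2 i j h

/-- A vertex lies on no edge but the two of which it is an endpoint. -/
theorem eq_of_vertex_mem_edge {i j : Fin n} (h : P.vertex i ∈ P.edge j) :
    P.vertex i = P.vertex j ∨ P.vertex i = P.vertex (finRotate n j) := by
  by_cases hij : i = j
  · exact Or.inl (by rw [hij])
  · exact (P.edge_inter_subset hij ⟨P.vertex_mem_edge i, h⟩).2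

theorem volume_frontier : volume (frontier P.region) = 0 := by
  rw [frontier_eq_iUnion_edge, measure_iUnion_null_iff]
  intro k
  rw [edge_eq_segment]
  exact volume_segment_eq_zero _ _

theorem volume_region_ne_top : volume P.region ≠ ⊤ := P.isCompact_region.measure_ne_top

/-- A polygon lies in the convex hull of its vertices: a linear functional attains its maximum over
the region on the boundary. -/
theorem region_subset_convexHull : P.region ⊆ convexHull ℝ (Set.range P.vertex) := by
  intro x hx
  by_contra hxc
  have hfin : (Set.range P.vertex).Finite := Set.finite_range _
  obtain ⟨f, u, hf1, hf2⟩ := geometric_hahn_banach_closed_point (convex_convexHull ℝ _)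
    (hfin.isClosed_convexHull (𝕜 := ℝ)) hxc
  obtain ⟨y, hy, hmax⟩ := P.isCompact_region.exists_isMaxOn ⟨x, hx⟩ f.continuous.continuousOn
  have hfy : u < f y := lt_of_lt_of_le hf2 (hmax hx)
  have hyf : y ∈ frontier P.region := by
    refine ⟨subset_closure hy, fun hyi => ?_⟩
    have hloc : IsLocalMax f y :=
      Filter.eventually_of_mem (mem_interior_iff_mem_nhds.1 hyi) fun z hz => hmax hz
    have h0 := hloc.fderiv_eq_zero
    rw [f.fderiv] at h0
    have hvert : (Set.range P.vertex).Nonempty := by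
      have := P.isSimple.1
      exact ⟨_, ⟨⟨0, by omega⟩, rfl⟩⟩
    obtain ⟨v, hv⟩ := hvert
    have := hf1 v (subset_convexHull ℝ _ hv)
    simp only [h0, zero_apply] at this hf2
    linarith
  rw [frontier_eq_iUnion_edge, Set.mem_iUnion] at hyf
  obtain ⟨k, hk⟩ := hyf
  rw [edge_eq_segment] at hk
  have := hf1 y ((segment_subset_convexHull (Set.mem_range_self _) (Set.mem_range_self _)) hk)
  linarith

/-- Near the midpoint of an edge a polygon contains one of the two half disks cut off by the edge. -/
theorem exists_halfDisk_subset (k : Fin n) {a b : Plane} (hab : segment ℝ a b = P.edge k)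
    (hne : a ≠ b) (hm : midpoint ℝ a b ≠ P.vertex k)
    (hm' : midpoint ℝ a b ≠ P.vertex (finRotate n k)) :
    ∃ σ : Bool, ∃ ε > 0, ∀ z ∈ Metric.ball (midpoint ℝ a b) ε,
      0 < (bif σ then 1 else -1) * orient a b z → z ∈ interior P.region := by
  set m := midpoint ℝ a b with hmdef
  have hmk : m ∈ P.edge k := by rw [← hab]; exact midpoint_mem_segment a b
  have hopen : IsOpen (⋃ j ∈ ({k}ᶜ : Set (Fin n)), P.edge j)ᶜ := by
    refine (Set.Finite.isClosed_biUnion (Set.toFinite _) fun j _ => ?_).isOpen_compl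
    rw [edge_eq_segment, ← convexHull_pair]
    exact (Set.toFinite _).isClosed_convexHull (𝕜 := ℝ)
  have hmem : m ∈ (⋃ j ∈ ({k}ᶜ : Set (Fin n)), P.edge j)ᶜ := by
    simp only [Set.mem_compl_iff, Set.mem_iUnion, not_exists]
    intro j hj hmj
    rcases (P.edge_inter_subset (fun h => hj h.symm : k ≠ j) ⟨hmk, hmj⟩).1 with h | h
    · exact hm h
    · exact hm' h
  obtain ⟨ε, hε, hball⟩ := Metric.isOpen_iff.1 hopen m hmem
  have hmR : m ∈ closure (interior P.region) := by
    rw [P.closure_interior_region]; exact P.edge_subset_region k hmk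
  obtain ⟨y, hy, hym⟩ := Metric.mem_closure_iff.1 hmR ε hε
  -- the interior is open, so it also contains a point off the line of the edge
  have hy' : ∃ y' ∈ interior P.region, y' ∈ Metric.ball m ε ∧ orient a b y' ≠ 0 := by
    by_contra hcon
    push Not at hcon
    have hO : IsOpen (interior P.region ∩ Metric.ball m ε) :=
      isOpen_interior.inter Metric.isOpen_ball
    have hnull : volume (interior P.region ∩ Metric.ball m ε) = 0 :=
      measure_mono_null (fun z hz => hcon z hz.1 hz.2) (volume_line_eq_zero hne)
    have := (hO.measure_eq_zero_iff volume).1 hnull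
    exact Set.notMem_empty y (this ▸ ⟨hy, by rwa [Metric.mem_ball, dist_comm]⟩)
  obtain ⟨y', hy1, hy2, hy3⟩ := hy'
  have main : ∀ s : ℝ, 0 < s * orient a b y' → ∀ z ∈ Metric.ball m ε,
      0 < s * orient a b z → z ∈ interior P.region := by
    intro s hs z hz hzs
    have hconv := (convex_ball m ε).inter (convex_orient_pos a b s)
    refine hconv.isPreconnected.subset_interior_of_disjoint_frontier ?_
      ⟨y', ⟨hy2, hs⟩, interior_subset hy1⟩ ⟨hz, hzs⟩
    rw [frontier_eq_iUnion_edge]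
    refine Set.disjoint_left.2 ?_
    rintro w ⟨hw1, hw2⟩ hw3
    obtain ⟨j, hj⟩ := Set.mem_iUnion.1 hw3
    by_cases hjk : j = k
    · subst hjk
      rw [← hab] at hj
      simp only [Set.mem_ofPred_eq, orient_eq_zero_of_mem_segment hj, mul_zero, lt_irrefl] at hw2
    · exact hball hw1 (Set.mem_biUnion (show j ∈ ({k}ᶜ : Set (Fin n)) from hjk) hj)
  rcases lt_or_gt_of_ne hy3 with h | h
  · exact ⟨false, ε, hε, main (-1) (by linarith)⟩
  · exact ⟨true, ε, hε, main 1 (by linarith)⟩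

end SimplePolygon

/-! ### Polygons with vertices in convex position -/

/-- A closed path with vertices `w 0, …, w (n - 1)` is strictly convex (and runs counterclockwise) if
each of its edges has all other vertices strictly on its left. -/
def IsStrictlyConvexPath {n : ℕ} [NeZero n] (w : Fin n → Plane) : Prop :=
  ∀ i j, j ≠ i → j ≠ i + 1 → 0 < orient (w i) (w (i + 1)) (w j)

/-- The intersection of the closed half planes on the left of the edges of a closed path. -/
def leftHalfPlanes {n : ℕ} [NeZero n] (w : Fin n → Plane) : Set Plane :=
  {z | ∀ i, 0 ≤ orient (w i) (w (i + 1)) z}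

theorem convex_leftHalfPlanes {n : ℕ} [NeZero n] (w : Fin n → Plane) :
    Convex ℝ (leftHalfPlanes w) := by
  have : leftHalfPlanes w = ⋂ i, {z | 0 ≤ orient (w i) (w (i + 1)) z} := by
    ext z; simp [leftHalfPlanes]
  rw [this]
  exact convex_iInter fun i => convex_orient_nonneg _ _

theorem IsStrictlyConvexPath.convexHull_subset {n : ℕ} [NeZero n] {w : Fin n → Plane}
    (h : IsStrictlyConvexPath w) : convexHull ℝ (Set.range w) ⊆ leftHalfPlanes w := by
  refine convexHull_min ?_ (convex_leftHalfPlanes w)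
  rintro _ ⟨j, rfl⟩ i
  by_cases h1 : j = i
  · rw [h1, orient_self_left]
  · by_cases h2 : j = i + 1
    · rw [h2, orient_self_right]
    · exact (h i j h1 h2).le

/-- Of three points on a line one lies between the other two. -/
theorem collinear_cases {a b c : Plane} (hab : a ≠ b) (h : orient a b c = 0) :
    a ∈ segment ℝ b c ∨ b ∈ segment ℝ a c ∨ c ∈ segment ℝ a b := by
  have hd : 0 < ‖b - a‖ ^ 2 := by
    have : b - a ≠ 0 := sub_ne_zero.2 hab.symm
    positivity
  have hcol : Collinear ℝ {a, b, c} := by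
    rw [collinear_iff_of_mem (p₀ := a) (by simp)]
    refine ⟨b - a, ?_⟩
    simp only [Set.mem_insert_iff, Set.mem_singleton_iff, forall_eq_or_imp, forall_eq]
    refine ⟨⟨0, by simp⟩, ⟨1, by simp⟩, inner ℝ (b - a) (c - a) / ‖b - a‖ ^ 2, ?_⟩
    have key : c - a = (inner ℝ (b - a) (c - a) / ‖b - a‖ ^ 2 : ℝ) • (b - a) := by
      have hc : ∀ i, ‖b - a‖ ^ 2 * (c - a) i = inner ℝ (b - a) (c - a) * (b - a) i := by
        rw [plane_norm_sq, plane_inner_eq]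
        rw [orient, wedge] at h
        intro i
        fin_cases i
        · simp only [Fin.zero_eta]; linear_combination (-(b - a) 1) * h
        · simp only [Fin.mk_one]; linear_combination ((b - a) 0) * h
      ext i
      rw [PiLp.smul_apply, smul_eq_mul, div_mul_eq_mul_div, eq_div_iff hd.ne', mul_comm]
      exact hc i
    rw [vadd_eq_add, ← key]; abel
  rcases hcol.wbtw_or_wbtw_or_wbtw with h | h | h
  · exact Or.inr (Or.inl (mem_segment_iff_wbtw.2 h))
  · exact Or.inr (Or.inr (mem_segment_iff_wbtw.2 h.symm))
  · exact Or.inl (mem_segment_iff_wbtw.2 h.symm)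

/-- If two points lie on opposite sides of the line through `a` and `b`, then either the two segments
cross or `a` or `b` lies in the triangle formed by the other points. -/
theorem opposite_sides_cases {a b c d : Plane} (hab : a ≠ b)
    (h : orient a b c * orient a b d < 0) :
    a ∈ convexHull ℝ {b, c, d} ∨ b ∈ convexHull ℝ {a, c, d} ∨
      ∃ z, z ∈ segment ℝ a b ∧ z ∈ segment ℝ c d := by
  have hz : ∃ z ∈ segment ℝ c d, orient a b z = 0 := by
    have hne : orient a b c - orient a b d ≠ 0 := by
      intro h0
      have : orient a b c = orient a b d := by linarith
      rw [this] at h; nlinarith [mul_self_nonneg (orient a b d)]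
    rcases lt_or_gt_of_ne (left_ne_zero_of_mul h.ne) with hc | hc
    · have hd : 0 < orient a b d := by nlinarith
      refine ⟨(orient a b d / (orient a b d - orient a b c)) • c +
        (-orient a b c / (orient a b d - orient a b c)) • d, ⟨_, _, ?_, ?_, ?_, rfl⟩, ?_⟩
      · exact div_nonneg hd.le (by linarith)
      · exact div_nonneg (by linarith) (by linarith)
      · rw [← add_div, ← sub_eq_add_neg, div_self (by linarith)]
      · rw [orient_combo]
        · ring
        · rw [← add_div, ← sub_eq_add_neg, div_self (by linarith)]
    · have hd : orient a b d < 0 := by nlinarith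
      refine ⟨(-orient a b d / (orient a b c - orient a b d)) • c +
        (orient a b c / (orient a b c - orient a b d)) • d, ⟨_, _, ?_, ?_, ?_, rfl⟩, ?_⟩
      · exact div_nonneg (by linarith) (by linarith)
      · exact div_nonneg hc.le (by linarith)
      · rw [← add_div, neg_add_eq_sub, div_self (by linarith)]
      · rw [orient_combo]
        · ring
        · rw [← add_div, neg_add_eq_sub, div_self (by linarith)]
  obtain ⟨z, hz1, hz2⟩ := hz
  have hull : ∀ {S : Set Plane}, c ∈ S → d ∈ S → z ∈ convexHull ℝ S :=
    fun hc hd => segment_subset_convexHull hc hd hz1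
  rcases collinear_cases hab hz2 with h | h | h
  · exact Or.inl ((convex_convexHull ℝ _).segment_subset (subset_convexHull ℝ _ (by simp))
      (hull (by simp) (by simp)) h)
  · exact Or.inr (Or.inl ((convex_convexHull ℝ _).segment_subset
      (subset_convexHull ℝ _ (by simp)) (hull (by simp) (by simp)) h))
  · exact Or.inr (Or.inr ⟨z, h, hz1⟩)

namespace SimplePolygon

variable {n : ℕ} (P : SimplePolygon n)

theorem orient_ne_zero_of_convexPosition
    (hconv : ∀ i, P.vertex i ∉ convexHull ℝ (P.vertex '' {i}ᶜ)) {i j k : Fin n} (hij : i ≠ j)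
    (hik : i ≠ k) (hjk : j ≠ k) : orient (P.vertex i) (P.vertex j) (P.vertex k) ≠ 0 := by
  intro h
  have hull : ∀ {a b c : Fin n}, b ≠ a → c ≠ a → P.vertex a ∉ segment ℝ (P.vertex b) (P.vertex c) :=
    fun hb hc hm => hconv _ (segment_subset_convexHull (Set.mem_image_of_mem _ hb)
      (Set.mem_image_of_mem _ hc) hm)
  rcases collinear_cases (P.vertex_injective.ne hij) h with h | h | h
  · exact hull hij.symm hik.symm h
  · exact hull hij hjk.symm h
  · exact hull hik hjk h

variable [NeZero n]

/-- For a simple polygon with vertices in convex position, any edge has the two endpoints of any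
disjoint edge on the same side: otherwise the edges would cross. -/
theorem orient_mul_orient_pos_of_convexPosition
    (hconv : ∀ i, P.vertex i ∉ convexHull ℝ (P.vertex '' {i}ᶜ)) {i k : Fin n} (h1 : k ≠ i)
    (h2 : k ≠ i + 1) (h3 : k + 1 ≠ i) (h4 : k + 1 ≠ i + 1) :
    0 < orient (P.vertex i) (P.vertex (i + 1)) (P.vertex k) *
      orient (P.vertex i) (P.vertex (i + 1)) (P.vertex (k + 1)) := by
  have hi : i ≠ i + 1 := by have := P.finRotate_ne i; rw [finRotate_apply] at this; exact this.symm
  have n1 := P.orient_ne_zero_of_convexPosition hconv hi h1.symm h2.symm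
  have n2 := P.orient_ne_zero_of_convexPosition hconv hi h3.symm h4.symm
  by_contra hneg
  have hneg' := lt_of_le_of_ne (not_lt.1 hneg) (mul_ne_zero n1 n2)
  have hull : ∀ {a b c d : Fin n}, b ≠ a → c ≠ a → d ≠ a →
      P.vertex a ∉ convexHull ℝ {P.vertex b, P.vertex c, P.vertex d} := by
    intro a b c d hb hc hd hm
    refine hconv a (convexHull_mono ?_ hm)
    rintro _ (rfl | rfl | rfl)
    exacts [Set.mem_image_of_mem _ hb, Set.mem_image_of_mem _ hc, Set.mem_image_of_mem _ hd]
  rcases opposite_sides_cases (P.vertex_injective.ne hi) hneg' with h | h | ⟨z, hz1, hz2⟩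
  · exact hull hi.symm h1 h3 h
  · exact hull hi h2 h4 h
  · have e1 : z ∈ P.edge i := by rw [edge_eq_segment, finRotate_apply]; exact hz1
    have e2 : z ∈ P.edge k := by rw [edge_eq_segment, finRotate_apply]; exact hz2
    obtain ⟨hA, hB⟩ := P.edge_inter_subset h1.symm ⟨e1, e2⟩
    rw [finRotate_apply] at hA hB
    rcases hA with rfl | rfl <;> rcases hB with hB | hB <;> have hB := P.vertex_injective hB
    exacts [h1 hB.symm, h3 hB.symm, h2 hB.symm, h4 hB.symm]

open Fin.NatCast Fin.CommRing in
/-- For a simple polygon with vertices in convex position, any edge has all other vertices on the same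
side, by induction along the path. -/
theorem orient_mul_orient_pos_of_ne
    (hconv : ∀ i, P.vertex i ∉ convexHull ℝ (P.vertex '' {i}ᶜ)) {i j : Fin n} (h1 : j ≠ i)
    (h2 : j ≠ i + 1) :
    0 < orient (P.vertex i) (P.vertex (i + 1)) (P.vertex (i + 2)) *
      orient (P.vertex i) (P.vertex (i + 1)) (P.vertex j) := by
  have h3n := P.isSimple.1
  have hval : ∀ a : ℕ, a < n → ((a : Fin n) : ℕ) = a := fun a ha => Fin.val_cast_of_lt ha
  have hinj : ∀ a b : ℕ, a < n → b < n → i + (a : Fin n) = i + (b : Fin n) → a = b := by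
    intro a b ha hb h
    have := congrArg Fin.val (add_left_cancel h)
    rwa [hval a ha, hval b hb] at this
  have key : ∀ t : ℕ, t + 2 < n → 0 < orient (P.vertex i) (P.vertex (i + 1)) (P.vertex (i + 2)) *
      orient (P.vertex i) (P.vertex (i + 1)) (P.vertex (i + ((t + 2 : ℕ) : Fin n))) := by
    intro t
    induction t with
    | zero =>
      intro ht
      have h02 : i ≠ i + 2 := fun h => by
        have := hinj 0 2 (by omega) (by omega) (by simpa using h); omega
      have h12 : i + 1 ≠ i + 2 := fun h => by
        have := hinj 1 2 (by omega) (by omega) (by simpa using h); omega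
      have h01 : i ≠ i + 1 := fun h => by
        have := hinj 0 1 (by omega) (by omega) (by simpa using h); omega
      have := P.orient_ne_zero_of_convexPosition hconv h01 h02 h12
      simpa using mul_self_pos.2 this
    | succ t ih =>
      intro ht
      have ih := ih (by omega)
      have hk : i + ((t + 2 : ℕ) : Fin n) + 1 = i + ((t + 1 + 2 : ℕ) : Fin n) := by
        push_cast; ring
      have step := P.orient_mul_orient_pos_of_convexPosition hconv
        (i := i) (k := i + ((t + 2 : ℕ) : Fin n))
        (fun h => by have := hinj (t + 2) 0 (by omega) (by omega) (by simpa using h); omega)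
        (fun h => by have := hinj (t + 2) 1 (by omega) (by omega) (by simpa using h); omega)
        (fun h => by
          rw [hk] at h
          have := hinj (t + 1 + 2) 0 (by omega) (by omega) (by simpa using h); omega)
        (fun h => by
          rw [hk] at h
          have := hinj (t + 1 + 2) 1 (by omega) (by omega) (by simpa using h); omega)
      rw [hk] at step
      have := mul_pos ih step
      by_contra hc
      nlinarith [mul_self_nonneg (orient (P.vertex i) (P.vertex (i + 1))
        (P.vertex (i + ((t + 2 : ℕ) : Fin n))))]
  have hj : j = i + (((j - i : Fin n) : ℕ) : Fin n) := by simp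
  have hlt := (j - i).isLt
  have hne0 : ((j - i : Fin n) : ℕ) ≠ 0 := by
    intro h; rw [h] at hj; exact h1 (by simpa using hj)
  have hne1 : ((j - i : Fin n) : ℕ) ≠ 1 := by
    intro h; rw [h] at hj; exact h2 (by simpa using hj)
  have := key (((j - i : Fin n) : ℕ) - 2) (by omega)
  rwa [show ((j - i : Fin n) : ℕ) - 2 + 2 = ((j - i : Fin n) : ℕ) by omega, ← hj] at this

open Fin.NatCast Fin.CommRing in
/-- A simple polygon whose vertices are in convex position is a strictly convex path, possibly after
a reversal of the order of its vertices. -/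
theorem isStrictlyConvexPath_vertex_or_neg
    (hconv : ∀ i, P.vertex i ∉ convexHull ℝ (P.vertex '' {i}ᶜ)) :
    IsStrictlyConvexPath P.vertex ∨ IsStrictlyConvexPath fun i => P.vertex (-i) := by
  have h3n := P.isSimple.1
  set S : Fin n → ℝ := fun i => orient (P.vertex i) (P.vertex (i + 1)) (P.vertex (i + 2)) with hS
  have hstep : ∀ i, 0 < S (i + 1) * S i := by
    intro i
    have hi : i ≠ i + 1 := by have := P.finRotate_ne i; rw [finRotate_apply] at this; exact this.symm
    have h2 : i ≠ i + 1 + 1 := by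
      intro h
      have h' : ((0 : ℕ) : Fin n) = ((2 : ℕ) : Fin n) := by
        have : i + 0 = i + (1 + 1) := by rw [add_zero, ← add_assoc]; exact h
        have := add_left_cancel this
        push_cast; rw [this]; norm_num
      have := congrArg Fin.val h'
      rw [Fin.val_cast_of_lt (by omega), Fin.val_cast_of_lt (by omega)] at this
      omega
    have := P.orient_mul_orient_pos_of_ne hconv hi h2
    have e : orient (P.vertex (i + 1)) (P.vertex (i + 1 + 1)) (P.vertex i) = S i := by
      rw [orient_rotate, hS]
      simp only [add_assoc, one_add_one_eq_two]
    rwa [e] at this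
  have hall : ∀ i, 0 < S 0 * S i := by
    have hne : S 0 ≠ 0 := right_ne_zero_of_mul (hstep 0).ne'
    have : ∀ t : ℕ, 0 < S 0 * S (t : Fin n) := by
      intro t
      induction t with
      | zero => simpa using mul_self_pos.2 hne
      | succ t ih =>
        have h1 := hstep (t : Fin n)
        have h2 := mul_pos ih h1
        push_cast
        by_contra hc
        nlinarith [mul_self_nonneg (S (t : Fin n))]
    intro i
    have := this (i : ℕ)
    simpa using this
  have hmain : ∀ i j, j ≠ i → j ≠ i + 1 →
      0 < S 0 * orient (P.vertex i) (P.vertex (i + 1)) (P.vertex j) := by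
    intro i j h1 h2
    have e1 := hall i
    have e2 := P.orient_mul_orient_pos_of_ne hconv h1 h2
    have e3 := mul_pos e1 e2
    by_contra hc
    nlinarith [mul_self_nonneg (S i)]
  have hne : S 0 ≠ 0 := right_ne_zero_of_mul (hstep 0).ne'
  rcases lt_or_gt_of_ne hne with h0 | h0
  · right
    intro i j h1 h2
    have := hmain (-i - 1) (-j) (fun h => h2 ?_) (fun h => h1 ?_)
    · beta_reduce
      rw [sub_add_cancel, orient_swap] at this
      rw [show -(i + 1) = -i - 1 by ring]
      nlinarith
    · have := congrArg Neg.neg h; rw [neg_neg] at this; rw [this]; ring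
    · have := congrArg Neg.neg h; rw [neg_neg] at this; rw [this]; ring
  · left
    intro i j h1 h2
    have := hmain i j h1 h2
    exact (mul_pos_iff_of_pos_left h0).1 this

/-- A polygon of positive area bounded by a strictly convex path is the intersection of the half
planes to the left of its edges. -/
theorem region_eq_leftHalfPlanes {w : Fin n → Plane} (hw : IsStrictlyConvexPath w)
    (hrange : Set.range w = Set.range P.vertex)
    (hb : frontier P.region = ⋃ i, segment ℝ (w i) (w (i + 1)))
    (hne : ∀ i, w i ≠ w (i + 1)) (harea : P.area ≠ 0) : P.region = leftHalfPlanes w := by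
  set U : Set Plane := ⋂ i, {z | 0 < 1 * orient (w i) (w (i + 1)) z} with hU
  have hUconv : Convex ℝ U := convex_iInter fun i => convex_orient_pos _ _ _
  have hsub : P.region ⊆ leftHalfPlanes w := by
    refine P.region_subset_convexHull.trans ?_
    rw [← hrange]; exact hw.convexHull_subset
  have hnull : volume (leftHalfPlanes w \ U) = 0 := by
    refine measure_mono_null (t := ⋃ i, {z | orient (w i) (w (i + 1)) z = 0}) ?_
      (measure_iUnion_null fun i => volume_line_eq_zero (hne i))
    rintro z ⟨hz1, hz2⟩
    simp only [hU, Set.mem_iInter, Set.mem_ofPred_eq, one_mul, not_forall, not_lt] at hz2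
    obtain ⟨i, hi⟩ := hz2
    exact Set.mem_iUnion.2 ⟨i, le_antisymm hi (hz1 i)⟩
  have hne' : (U ∩ P.region).Nonempty := by
    by_contra hemp
    rw [Set.not_nonempty_iff_eq_empty] at hemp
    apply harea
    have : volume P.region = 0 := measure_mono_null (show P.region ⊆ leftHalfPlanes w \ U from
      fun z hz => ⟨hsub hz, fun hzU => Set.notMem_empty z (hemp ▸ ⟨hzU, hz⟩)⟩) hnull
    rw [area, Measure.real, this, ENNReal.toReal_zero]
  have hUR : U ⊆ P.region := by
    refine (hUconv.isPreconnected.subset_interior_of_disjoint_frontier ?_ hne').trans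
      interior_subset
    rw [hb]
    refine Set.disjoint_left.2 fun z hz hz' => ?_
    obtain ⟨i, hi⟩ := Set.mem_iUnion.1 hz'
    have := Set.mem_iInter.1 hz i
    rw [Set.mem_ofPred_eq, orient_eq_zero_of_mem_segment hi] at this
    simp at this
  refine Set.Subset.antisymm hsub fun z hz => ?_
  obtain ⟨u, hu, -⟩ := hne'
  rw [← P.isClosed_region.closure_eq]
  refine closure_mono hUR ?_
  rw [mem_closure_iff_seq_limit]
  refine ⟨fun k => (1 - 1 / ((k : ℝ) + 1)) • z + (1 / ((k : ℝ) + 1)) • u, fun k => ?_, ?_⟩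
  · have h0 : (0 : ℝ) < 1 / ((k : ℝ) + 1) := by positivity
    have h1 : 1 / ((k : ℝ) + 1) ≤ 1 := by
      rw [div_le_one (by positivity)]; linarith [(Nat.cast_nonneg k : (0 : ℝ) ≤ k)]
    refine Set.mem_iInter.2 fun i => ?_
    have hu' := Set.mem_iInter.1 hu i
    rw [Set.mem_ofPred_eq, one_mul] at hu' ⊢
    rw [orient_combo _ _ _ _ (by ring)]
    have := mul_pos h0 hu'
    have := mul_nonneg (sub_nonneg.2 h1) (hz i)
    linarith
  · have hlim := tendsto_one_div_add_atTop_nhds_zero_nat (𝕜 := ℝ)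
    have := ((tendsto_const_nhds (x := (1 : ℝ))).sub hlim).smul_const z
    simpa using this.add (hlim.smul_const u)

end SimplePolygon

/-! ### The isoperimetric inequality for given edge directions -/

/-- The tangent of half the exterior angle between two consecutive edge vectors, which is the
cotangent of half the interior angle. -/
noncomputable def tanHalf (u v : Plane) : ℝ := (‖u‖ * ‖v‖ - inner ℝ u v) / wedge u v

/-- The algebraic core of the isoperimetric inequality. The numbers `l i` are the lengths of the sides of
a pentagon, and `s i`, `c i` the sine and the cosine of the exterior angle between the sides `i - 1`
and `i`. The distances of a point to the sides are `r` for the sides `0`, `2`, `4`, and `r + g` and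
`r + h` for the sides `1` and `3`; `A` is the area. The conditions `h1` and `h3` say that the sines of
the sum of two consecutive exterior angles are nonnegative; they make the coefficients of `g ^ 2` and
`h ^ 2` in the isoperimetric deficit nonnegative. -/
theorem isoperimetric_algebra {s0 s1 s2 s3 s4 c0 c1 c2 c3 c4 r g h : ℝ}
    (hs0 : 0 < s0) (hs1 : 0 < s1) (hs2 : 0 < s2) (hs3 : 0 < s3) (hs4 : 0 < s4)
    (k0 : c0 ≤ 1) (k1 : c1 ≤ 1) (k2 : c2 ≤ 1) (k3 : c3 ≤ 1) (k4 : c4 ≤ 1)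
    (h1 : 0 ≤ s1 * c2 + c1 * s2) (h3 : 0 ≤ s3 * c4 + c3 * s4)
    {l0 l1 l2 l3 l4 A : ℝ}
    (e0 : l0 = (r - r * c0) / s0 + (r + g - r * c1) / s1)
    (e1 : l1 = (r - (r + g) * c1) / s1 + (r - (r + g) * c2) / s2)
    (e2 : l2 = (r + g - r * c2) / s2 + (r + h - r * c3) / s3)
    (e3 : l3 = (r - (r + h) * c3) / s3 + (r - (r + h) * c4) / s4)
    (e4 : l4 = (r + h - r * c4) / s4 + (r - r * c0) / s0)
    (hA : 2 * A = l0 * r + l1 * (r + g) + l2 * r + l3 * (r + h) + l4 * r) :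
    4 * A * ((1 - c0) / s0 + (1 - c1) / s1 + (1 - c2) / s2 + (1 - c3) / s3 + (1 - c4) / s4) ≤
      (l0 + l1 + l2 + l3 + l4) ^ 2 := by
  set t0 := (1 - c0) / s0 with ht0
  set t1 := (1 - c1) / s1 with ht1
  set t2 := (1 - c2) / s2 with ht2
  set t3 := (1 - c3) / s3 with ht3
  set t4 := (1 - c4) / s4 with ht4
  set C1 := c1 / s1 + c2 / s2 with hC1
  set C3 := c3 / s3 + c4 / s4 with hC3
  have hC1' : 0 ≤ C1 := by
    rw [hC1, div_add_div _ _ hs1.ne' hs2.ne']; apply div_nonneg _ (by positivity); linarith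
  have hC3' : 0 ≤ C3 := by
    rw [hC3, div_add_div _ _ hs3.ne' hs4.ne']; apply div_nonneg _ (by positivity); linarith
  have hl1 : l1 = r * (t1 + t2) - g * C1 := by rw [e1, ht1, ht2, hC1]; ring
  have hl3 : l3 = r * (t3 + t4) - h * C3 := by rw [e3, ht3, ht4, hC3]; ring
  set S := t0 + t1 + t2 + t3 + t4 with hS
  set L := g * (t1 + t2) + h * (t3 + t4) with hL
  have hp : l0 + l1 + l2 + l3 + l4 = 2 * r * S + L := by
    rw [e0, e1, e2, e3, e4, hS, hL, ht0, ht1, ht2, ht3, ht4]; ring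
  have hA' : 2 * A = r * (2 * r * S + L) + r * L - g ^ 2 * C1 - h ^ 2 * C3 := by
    rw [← hp, hA]
    have : l1 * g = r * (t1 + t2) * g - g ^ 2 * C1 := by rw [hl1]; ring
    have : l3 * h = r * (t3 + t4) * h - h ^ 2 * C3 := by rw [hl3]; ring
    rw [hL]; linarith
  have hSpos : 0 ≤ S := by
    rw [hS, ht0, ht1, ht2, ht3, ht4]
    have hq : ∀ {s c : ℝ}, 0 < s → c ≤ 1 → 0 ≤ (1 - c) / s :=
      fun hs hc => div_nonneg (by linarith) hs.le
    have := hq hs0 k0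
    have := hq hs1 k1
    have := hq hs2 k2
    have := hq hs3 k3
    have := hq hs4 k4
    linarith
  have hid : (2 * r * S + L) ^ 2 =
      4 * A * S + (L ^ 2 + 2 * (S * (g ^ 2 * C1)) + 2 * (S * (h ^ 2 * C3))) := by
    rw [show 4 * A * S = 2 * S * (2 * A) by ring, hA']; ring
  rw [hp, hid]
  have : 0 ≤ L ^ 2 + 2 * (S * (g ^ 2 * C1)) + 2 * (S * (h ^ 2 * C3)) := by positivity
  linarith

/-- The distances from a point to two adjacent sides of a polygon determine the distances between
their common vertex and the feet of the perpendiculars. -/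
theorem inner_eq_of_unit {e e' q : Plane} (he : ‖e‖ = 1) (he' : ‖e'‖ = 1) (hs : 0 < wedge e e') :
    inner ℝ q e' = (wedge e q - wedge e' q * inner ℝ e e') / wedge e e' ∧
      -inner ℝ q e = (wedge e' q - wedge e q * inner ℝ e e') / wedge e e' := by
  have h1 := plane_norm_sq e
  have h2 := plane_norm_sq e'
  rw [he] at h1
  rw [he'] at h2
  rw [eq_div_iff hs.ne', eq_div_iff hs.ne']
  simp only [plane_inner_eq, wedge] at *
  constructor
  · linear_combination (-(e 0 * q 1 - e 1 * q 0)) * h2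
  · linear_combination (-(e' 0 * q 1 - e' 1 * q 0)) * h1

/-- The isoperimetric inequality for a convex pentagon, in terms of its edge vectors, provided that
three of its sides bound a triangle (or a half strip) that contains the pentagon. The circle that
touches these three sides is used as a comparison circle. -/
theorem isoperimetric_of_wedge_nonneg {a b c d e : Plane}
    (hab : 0 < wedge (b - a) (c - b)) (hbc : 0 < wedge (c - b) (d - c))
    (hcd : 0 < wedge (d - c) (e - d)) (hde : 0 < wedge (e - d) (a - e))
    (hea : 0 < wedge (a - e) (b - a)) (hac : 0 < wedge (d - c) (a - c))
    (h1 : 0 ≤ wedge (b - a) (d - c)) (h3 : 0 ≤ wedge (d - c) (a - e)) :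
    2 * (orient a b c + orient a c d + orient a d e) *
        (tanHalf (a - e) (b - a) + tanHalf (b - a) (c - b) + tanHalf (c - b) (d - c) +
          tanHalf (d - c) (e - d) + tanHalf (e - d) (a - e)) ≤
      (‖b - a‖ + ‖c - b‖ + ‖d - c‖ + ‖e - d‖ + ‖a - e‖) ^ 2 := by
  have hunit : ∀ v : Plane, (∃ w, 0 < wedge v w) → ∃ l : ℝ, ∃ u : Plane, 0 < l ∧ ‖u‖ = 1 ∧
      v = l • u ∧ ‖v‖ = l := by
    rintro v ⟨w, hw⟩
    have hv : v ≠ 0 := by rintro rfl; simp [wedge] at hw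
    have hn : 0 < ‖v‖ := norm_pos_iff.2 hv
    exact ⟨‖v‖, ‖v‖⁻¹ • v, hn, by rw [norm_smul, norm_inv, norm_norm, inv_mul_cancel₀ hn.ne'],
      by rw [smul_smul, mul_inv_cancel₀ hn.ne', one_smul], rfl⟩
  obtain ⟨l0, u0, p0, n0, v0, m0⟩ := hunit _ ⟨_, hab⟩
  obtain ⟨l1, u1, p1, n1, v1, m1⟩ := hunit _ ⟨_, hbc⟩
  obtain ⟨l2, u2, p2, n2, v2, m2⟩ := hunit _ ⟨_, hcd⟩
  obtain ⟨l3, u3, p3, n3, v3, m3⟩ := hunit _ ⟨_, hde⟩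
  obtain ⟨l4, u4, p4, n4, v4, m4⟩ := hunit _ ⟨_, hea⟩
  have hw : ∀ {l l' : ℝ} {u u' : Plane}, wedge (l • u) (l' • u') = l * l' * wedge u u' := by
    intros; rw [wedge_smul_left, wedge_smul_right]; ring
  have htan : ∀ {l l' : ℝ} {u u' : Plane}, 0 < l → 0 < l' → ‖u‖ = 1 → ‖u'‖ = 1 →
      tanHalf (l • u) (l' • u') = (1 - inner ℝ u u') / wedge u u' := by
    intro l l' u u' hl hl' hu hu'
    rw [tanHalf, hw, real_inner_smul_left, real_inner_smul_right, norm_smul, norm_smul, hu, hu',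
      Real.norm_of_nonneg hl.le, Real.norm_of_nonneg hl'.le]
    rw [show l * 1 * (l' * 1) - l * (l' * inner ℝ u u') = l * l' * (1 - inner ℝ u u') by ring,
      mul_div_mul_left _ _ (by positivity)]
  rw [m0, m1, m2, m3, m4]
  have s1 : 0 < wedge u0 u1 := by
    rw [v0, v1, hw] at hab; exact (mul_pos_iff_of_pos_left (by positivity)).1 hab
  have s2 : 0 < wedge u1 u2 := by
    rw [v1, v2, hw] at hbc; exact (mul_pos_iff_of_pos_left (by positivity)).1 hbc
  have s3 : 0 < wedge u2 u3 := by
    rw [v2, v3, hw] at hcd; exact (mul_pos_iff_of_pos_left (by positivity)).1 hcd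
  have s4 : 0 < wedge u3 u4 := by
    rw [v3, v4, hw] at hde; exact (mul_pos_iff_of_pos_left (by positivity)).1 hde
  have s0 : 0 < wedge u4 u0 := by
    rw [v4, v0, hw] at hea; exact (mul_pos_iff_of_pos_left (by positivity)).1 hea
  have w1 : 0 ≤ wedge u0 u2 := by
    rw [v0, v2, hw] at h1; exact (mul_nonneg_iff_of_pos_left (by positivity)).1 h1
  have w3 : 0 ≤ wedge u2 u4 := by
    rw [v2, v4, hw] at h3; exact (mul_nonneg_iff_of_pos_left (by positivity)).1 h3
  have hD : 0 < wedge u2 (a - c) := by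
    rw [v2, wedge_smul_left] at hac; exact (mul_pos_iff_of_pos_left (by positivity)).1 hac
  -- the radius of the circle that touches the first, the third and the last side
  set K : ℝ := 1 + (wedge u0 u2 + wedge u2 u4) / wedge u4 u0 with hK
  have hKpos : 0 < K := by positivity
  set r : ℝ := wedge u2 (a - c) / K with hr
  -- and its center
  set O : Plane := a + (r / wedge u4 u0) • (u0 - u4) with hO
  have d0 : wedge u0 (O - a) = r := by
    rw [hO, add_sub_cancel_left, wedge_smul_right, wedge_sub_right, wedge_self, zero_sub,
      ← wedge_swap, div_mul_cancel₀ _ s0.ne']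
  have d4 : wedge u4 (O - a) = r := by
    rw [hO, add_sub_cancel_left, wedge_smul_right, wedge_sub_right, wedge_self, sub_zero,
      div_mul_cancel₀ _ s0.ne']
  have d2 : wedge u2 (O - c) = r := by
    have : O - c = (a - c) + (r / wedge u4 u0) • (u0 - u4) := by rw [hO]; abel
    rw [this, wedge_add_right, wedge_smul_right, wedge_sub_right u2 u0, wedge_swap u2 u0]
    have hrK : r * K = wedge u2 (a - c) := div_mul_cancel₀ _ hKpos.ne'
    rw [← hrK, hK]
    field_simp
    ring
  have shift : ∀ {u p q : Plane} {l : ℝ}, q - p = l • u → wedge u (O - q) = wedge u (O - p) := by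
    intro u p q l h
    rw [show O - p = (O - q) + (q - p) by abel, h, wedge_add_right, wedge_smul_right, wedge_self]
    ring
  have len : ∀ {u p q : Plane} {l : ℝ}, ‖u‖ = 1 → q - p = l • u →
      l = -inner ℝ (O - q) u + inner ℝ (O - p) u := by
    intro u p q l hu h
    rw [show O - p = (O - q) + (q - p) by abel, h, inner_add_left, real_inner_smul_left,
      real_inner_self_eq_norm_sq, hu]
    ring
  have f0 := inner_eq_of_unit (q := O - a) n4 n0 s0
  have f1 := inner_eq_of_unit (q := O - b) n0 n1 s1
  have f2 := inner_eq_of_unit (q := O - c) n1 n2 s2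
  have f3 := inner_eq_of_unit (q := O - d) n2 n3 s3
  have f4 := inner_eq_of_unit (q := O - e) n3 n4 s4
  have d0' : wedge u0 (O - b) = r := by rw [shift v0, d0]
  have d2' : wedge u2 (O - d) = r := by rw [shift v2, d2]
  have d4' : wedge u4 (O - e) = r := by rw [← shift v4, d4]
  have d1 : wedge u1 (O - b) = r + (wedge u1 (O - b) - r) := by ring
  have d1' : wedge u1 (O - c) = r + (wedge u1 (O - b) - r) := by rw [shift v1]; ring
  have d3 : wedge u3 (O - d) = r + (wedge u3 (O - d) - r) := by ring
  have d3' : wedge u3 (O - e) = r + (wedge u3 (O - d) - r) := by rw [shift v3]; ring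
  generalize hg : wedge u1 (O - b) - r = g at *
  generalize hh : wedge u3 (O - d) - r = h at *
  have hle : ∀ {u u' : Plane}, ‖u‖ = 1 → ‖u'‖ = 1 → (inner ℝ u u' : ℝ) ≤ 1 := by
    intro u u' hu hu'
    have := real_inner_le_norm u u'
    rwa [hu, hu', mul_one] at this
  have hsum : ∀ {u v w : Plane}, ‖v‖ = 1 → wedge u v * inner ℝ v w + inner ℝ u v * wedge v w =
      wedge u w := by
    intro u v w hv
    have := plane_norm_sq v
    rw [hv] at this
    simp only [plane_inner_eq, wedge]
    linear_combination (-(u 0 * w 1 - u 1 * w 0)) * this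
  have key := isoperimetric_algebra (r := r) (g := g) (h := h) s0 s1 s2 s3 s4
    (k0 := hle n4 n0) (k1 := hle n0 n1) (k2 := hle n1 n2) (k3 := hle n2 n3) (k4 := hle n3 n4)
    (by rw [hsum n1]; exact w1) (by rw [hsum n3]; exact w3)
    (l0 := l0) (l1 := l1) (l2 := l2) (l3 := l3) (l4 := l4)
    (A := (orient a b c + orient a c d + orient a d e) / 2)
    (by rw [len n0 v0, f1.2, f0.1, d0, d4, d1, d0']; ring)
    (by rw [len n1 v1, f2.2, f1.1, d0', d1, d1', d2]; ring)
    (by rw [len n2 v2, f3.2, f2.1, d1', d2, d2', d3]; ring)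
    (by rw [len n3 v3, f4.2, f3.1, d2', d3, d3', d4']; ring)
    (by rw [len n4 v4, f0.2, f4.1, d3', d4', d0, d4]; ring)
    (by
      have area : orient a b c + orient a c d + orient a d e =
          wedge (b - a) (O - a) + wedge (c - b) (O - b) + wedge (d - c) (O - c) +
            wedge (e - d) (O - d) + wedge (a - e) (O - e) := by
        simp [orient, wedge]; ring
      rw [mul_div_cancel₀ _ two_ne_zero, area, v0, v1, v2, v3, v4]
      simp only [wedge_smul_left]
      rw [d0, d1, d2, d3, d4'])
  rw [v0, v1, v2, v3, v4, htan p4 p0 n4 n0, htan p0 p1 n0 n1, htan p1 p2 n1 n2, htan p2 p3 n2 n3,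
    htan p3 p4 n3 n4]
  linarith

/-! ### Angles of convex pentagons and Lhuilier's inequality -/

/-- The cotangent of half an angle. -/
noncomputable def cotHalf (a : ℝ) : ℝ := (1 + Real.cos a) / Real.sin a

theorem angle_mem_Ioo_of_wedge_ne_zero {u v : Plane} (h : wedge u v ≠ 0) :
    InnerProductGeometry.angle u v ∈ Set.Ioo 0 Real.pi := by
  have hs := sin_angle_mul_norms u v
  have hpos : 0 < |wedge u v| := abs_pos.2 h
  refine ⟨lt_of_le_of_ne (InnerProductGeometry.angle_nonneg u v) fun h0 => ?_,
    lt_of_le_of_ne (InnerProductGeometry.angle_le_pi u v) fun h0 => ?_⟩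
  · rw [← h0, Real.sin_zero, mul_zero] at hs; linarith
  · rw [h0, Real.sin_pi, mul_zero] at hs; linarith

theorem tanHalf_eq_cotHalf {u v : Plane} (h : 0 < wedge u v) :
    tanHalf u v = cotHalf (InnerProductGeometry.angle (-u) v) := by
  have hs := sin_angle_mul_norms u v
  have hc := cos_angle_mul_norms u v
  have hu : u ≠ 0 := by rintro rfl; simp [wedge] at h
  have hv : v ≠ 0 := by rintro rfl; simp [wedge] at h
  have hun : 0 < ‖u‖ := norm_pos_iff.2 hu
  have hvn : 0 < ‖v‖ := norm_pos_iff.2 hv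
  rw [abs_of_pos h] at hs
  rw [tanHalf, cotHalf, InnerProductGeometry.angle_neg_left, Real.cos_pi_sub, Real.sin_pi_sub,
    ← hs, ← hc, show ‖u‖ * ‖v‖ - ‖u‖ * ‖v‖ * Real.cos (InnerProductGeometry.angle u v) =
      ‖u‖ * ‖v‖ * (1 + -Real.cos (InnerProductGeometry.angle u v)) by ring,
    mul_div_mul_left _ _ (by positivity)]

theorem sin_angle_add_angle {u v w : Plane} (h1 : 0 < wedge u v) (h2 : 0 < wedge v w) :
    ‖u‖ * ‖v‖ ^ 2 * ‖w‖ *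
        Real.sin (InnerProductGeometry.angle u v + InnerProductGeometry.angle v w) =
      ‖v‖ ^ 2 * wedge u w := by
  have s1 := sin_angle_mul_norms u v
  have s2 := sin_angle_mul_norms v w
  have c1 := cos_angle_mul_norms u v
  have c2 := cos_angle_mul_norms v w
  rw [abs_of_pos h1] at s1
  rw [abs_of_pos h2] at s2
  have hv2 := plane_norm_sq v
  generalize InnerProductGeometry.angle u v = α at *
  generalize InnerProductGeometry.angle v w = β at *
  rw [Real.sin_add]
  have : ‖u‖ * ‖v‖ ^ 2 * ‖w‖ * (Real.sin α * Real.cos β + Real.cos α * Real.sin β) =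
    (‖u‖ * ‖v‖ * Real.sin α) * (‖v‖ * ‖w‖ * Real.cos β) +
      (‖u‖ * ‖v‖ * Real.cos α) * (‖v‖ * ‖w‖ * Real.sin β) := by ring
  rw [this, s1, s2, c1, c2, hv2, plane_inner_eq, plane_inner_eq, wedge, wedge, wedge]
  ring

theorem angle_add_angle_lt_pi_iff {u v w : Plane} (h1 : 0 < wedge u v) (h2 : 0 < wedge v w) :
    (0 < wedge u w → InnerProductGeometry.angle u v + InnerProductGeometry.angle v w < Real.pi) ∧
    (wedge u w < 0 →
      Real.pi < InnerProductGeometry.angle u v + InnerProductGeometry.angle v w) := by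
  have hs := sin_angle_add_angle h1 h2
  obtain ⟨a1, a2⟩ := angle_mem_Ioo_of_wedge_ne_zero h1.ne'
  obtain ⟨b1, b2⟩ := angle_mem_Ioo_of_wedge_ne_zero h2.ne'
  have hu : u ≠ 0 := by rintro rfl; simp [wedge] at h1
  have hv : v ≠ 0 := by rintro rfl; simp [wedge] at h2
  have hw : w ≠ 0 := by rintro rfl; simp [wedge] at h2
  have hun : 0 < ‖u‖ := norm_pos_iff.2 hu
  have hvn : 0 < ‖v‖ := norm_pos_iff.2 hv
  have hwn : 0 < ‖w‖ := norm_pos_iff.2 hw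
  generalize InnerProductGeometry.angle u v = α at *
  generalize InnerProductGeometry.angle v w = β at *
  have hpos : 0 < ‖u‖ * ‖v‖ ^ 2 * ‖w‖ := by positivity
  constructor
  · intro h3
    by_contra hge
    have h4 : Real.sin (α + β - Real.pi) = -Real.sin (α + β) := Real.sin_sub_pi _
    have h0 : 0 ≤ Real.sin (α + β - Real.pi) :=
      Real.sin_nonneg_of_nonneg_of_le_pi (by linarith) (by linarith)
    have : 0 < ‖u‖ * ‖v‖ ^ 2 * ‖w‖ * Real.sin (α + β) := by rw [hs]; positivity
    have : 0 < Real.sin (α + β) := (mul_pos_iff_of_pos_left hpos).1 this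
    linarith
  · intro h3
    by_contra hge
    have h0 : 0 ≤ Real.sin (α + β) :=
      Real.sin_nonneg_of_nonneg_of_le_pi (by linarith) (by linarith)
    have : ‖v‖ ^ 2 * wedge u w < 0 := mul_neg_of_pos_of_neg (by positivity) h3
    have := mul_nonneg hpos.le h0
    linarith

/-- Angles between consecutive directions add up, as long as they add up to less than `π`. -/
theorem angle_add_of_wedge_pos {u v w : Plane} (h1 : 0 < wedge u v) (h2 : 0 < wedge v w)
    (h3 : 0 < wedge u w) : InnerProductGeometry.angle u w =
      InnerProductGeometry.angle u v + InnerProductGeometry.angle v w := by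
  have hsum := (angle_add_angle_lt_pi_iff h1 h2).1 h3
  set α := InnerProductGeometry.angle u v with hα
  set β := InnerProductGeometry.angle v w with hβ
  have s1 := sin_angle_mul_norms u v
  have s2 := sin_angle_mul_norms v w
  have c1 := cos_angle_mul_norms u v
  have c2 := cos_angle_mul_norms v w
  have c3 := cos_angle_mul_norms u w
  rw [abs_of_pos h1] at s1
  rw [abs_of_pos h2] at s2
  have hu : u ≠ 0 := by rintro rfl; simp [wedge] at h1
  have hv : v ≠ 0 := by rintro rfl; simp [wedge] at h2
  have hw : w ≠ 0 := by rintro rfl; simp [wedge] at h2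
  have hun : 0 < ‖u‖ := norm_pos_iff.2 hu
  have hvn : 0 < ‖v‖ := norm_pos_iff.2 hv
  have hwn : 0 < ‖w‖ := norm_pos_iff.2 hw
  have hv2 := plane_norm_sq v
  have hcos : ‖u‖ * ‖v‖ ^ 2 * ‖w‖ * Real.cos (α + β) = ‖v‖ ^ 2 * inner ℝ u w := by
    rw [Real.cos_add]
    have : ‖u‖ * ‖v‖ ^ 2 * ‖w‖ * (Real.cos α * Real.cos β - Real.sin α * Real.sin β) =
      (‖u‖ * ‖v‖ * Real.cos α) * (‖v‖ * ‖w‖ * Real.cos β) -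
        (‖u‖ * ‖v‖ * Real.sin α) * (‖v‖ * ‖w‖ * Real.sin β) := by ring
    rw [this, s1, s2, c1, c2, hv2, plane_inner_eq, plane_inner_eq, plane_inner_eq, wedge, wedge]
    ring
  refine Real.injOn_cos ⟨InnerProductGeometry.angle_nonneg _ _, InnerProductGeometry.angle_le_pi _ _⟩
    ⟨add_nonneg (InnerProductGeometry.angle_nonneg _ _) (InnerProductGeometry.angle_nonneg _ _),
      hsum.le⟩ ?_
  have : ‖u‖ * ‖v‖ ^ 2 * ‖w‖ * Real.cos (InnerProductGeometry.angle u w) =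
      ‖u‖ * ‖v‖ ^ 2 * ‖w‖ * Real.cos (α + β) := by
    rw [hcos, ← c3]; ring
  exact mul_left_cancel₀ (by positivity) this

open EuclideanGeometry in
theorem angle_add_of_orient_pos {o a b c : Plane} (h1 : 0 < orient o a b) (h2 : 0 < orient o b c)
    (h3 : 0 < orient o a c) : angle a o c = angle a o b + angle b o c :=
  angle_add_of_wedge_pos h1 h2 h3

theorem ne_of_orient_pos {a b c : Plane} (h : 0 < orient a b c) : a ≠ b := by
  rintro rfl; simp [orient, wedge] at h

section Angles

variable {n : ℕ} [NeZero n]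

/-- The interior angle of a convex polygon with vertices `w 0, …, w (n - 1)`. -/
noncomputable def interiorAngle (w : Fin n → Plane) (i : Fin n) : ℝ :=
  EuclideanGeometry.angle (w (i - 1)) (w i) (w (i + 1))

theorem IsStrictlyConvexPath.orient_pos {w : Fin 5 → Plane} (h : IsStrictlyConvexPath w)
    (i : Fin 5) : 0 < orient (w (i - 1)) (w i) (w (i + 1)) := by
  have := h (i - 1) (i + 1) (by revert i; decide) (by revert i; decide)
  rwa [sub_add_cancel] at this

theorem IsStrictlyConvexPath.interiorAngle_mem {w : Fin 5 → Plane} (h : IsStrictlyConvexPath w)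
    (i : Fin 5) : interiorAngle w i ∈ Set.Ioo 0 Real.pi := by
  refine angle_mem_Ioo_of_wedge_ne_zero ?_
  have : wedge (w (i - 1) -ᵥ w i) (w (i + 1) -ᵥ w i) = -orient (w (i - 1)) (w i) (w (i + 1)) := by
    simp [orient, wedge]; ring
  rw [this]; linarith [h.orient_pos i]

/-- The interior angles of a convex pentagon add up to `3π`. -/
theorem IsStrictlyConvexPath.sum_interiorAngle {w : Fin 5 → Plane} (h : IsStrictlyConvexPath w) :
    ∑ i, interiorAngle w i = 3 * Real.pi := by
  have o012 : 0 < orient (w 0) (w 1) (w 2) := h 0 2 (by decide) (by decide)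
  have o013 : 0 < orient (w 0) (w 1) (w 3) := h 0 3 (by decide) (by decide)
  have o014 : 0 < orient (w 0) (w 1) (w 4) := h 0 4 (by decide) (by decide)
  have o123 : 0 < orient (w 1) (w 2) (w 3) := h 1 3 (by decide) (by decide)
  have o120 : 0 < orient (w 1) (w 2) (w 0) := h 1 0 (by decide) (by decide)
  have o230 : 0 < orient (w 2) (w 3) (w 0) := h 2 0 (by decide) (by decide)
  have o231 : 0 < orient (w 2) (w 3) (w 1) := h 2 1 (by decide) (by decide)
  have o340 : 0 < orient (w 3) (w 4) (w 0) := h 3 0 (by decide) (by decide)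
  have o342 : 0 < orient (w 3) (w 4) (w 2) := h 3 2 (by decide) (by decide)
  have o023 : 0 < orient (w 0) (w 2) (w 3) := by rwa [← orient_rotate]
  have o034 : 0 < orient (w 0) (w 3) (w 4) := by rwa [← orient_rotate]
  have o024 : 0 < orient (w 0) (w 2) (w 4) := by
    have : 0 < orient (w 4) (w 0) (w 2) := h 4 2 (by decide) (by decide)
    rwa [orient_rotate (w 4) (w 0) (w 2)]
  have a0 : interiorAngle w 0 = EuclideanGeometry.angle (w 1) (w 0) (w 2) +
      EuclideanGeometry.angle (w 2) (w 0) (w 3) + EuclideanGeometry.angle (w 3) (w 0) (w 4) := by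
    rw [add_assoc, ← angle_add_of_orient_pos o023 o034 o024, ← angle_add_of_orient_pos o012 o024 o014,
      EuclideanGeometry.angle_comm]
    rfl
  have a2 : interiorAngle w 2 = EuclideanGeometry.angle (w 3) (w 2) (w 0) +
      EuclideanGeometry.angle (w 0) (w 2) (w 1) := by
    rw [← angle_add_of_orient_pos o230 (by rwa [orient_rotate (w 1) (w 2) (w 0)]) o231,
      EuclideanGeometry.angle_comm]
    rfl
  have a3 : interiorAngle w 3 = EuclideanGeometry.angle (w 4) (w 3) (w 0) +
      EuclideanGeometry.angle (w 0) (w 3) (w 2) := by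
    rw [← angle_add_of_orient_pos o340 (by rwa [orient_rotate]) o342,
      EuclideanGeometry.angle_comm]
    rfl
  have t1 := EuclideanGeometry.angle_add_angle_add_angle_eq_pi (w 2) (ne_of_orient_pos o012).symm
  have t2 := EuclideanGeometry.angle_add_angle_add_angle_eq_pi (w 3) (ne_of_orient_pos o023).symm
  have t3 := EuclideanGeometry.angle_add_angle_add_angle_eq_pi (w 4) (ne_of_orient_pos o034).symm
  have a1 : interiorAngle w 1 = EuclideanGeometry.angle (w 0) (w 1) (w 2) := rfl
  have a4 : interiorAngle w 4 = EuclideanGeometry.angle (w 3) (w 4) (w 0) := rfl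
  rw [Fin.sum_univ_five, a0, a1, a2, a3, a4]
  rw [EuclideanGeometry.angle_comm (w 2) (w 0) (w 1)] at t1
  rw [EuclideanGeometry.angle_comm (w 3) (w 0) (w 2), EuclideanGeometry.angle_comm (w 0) (w 2) (w 3)]
    at t2
  rw [EuclideanGeometry.angle_comm (w 4) (w 0) (w 3), EuclideanGeometry.angle_comm (w 0) (w 3) (w 4)]
    at t3
  rw [EuclideanGeometry.angle_comm (w 0) (w 2) (w 1), EuclideanGeometry.angle_comm (w 0) (w 3) (w 2)]
  linarith

/-- The signed area enclosed by a closed pentagonal path, as the sum of the signed areas of three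
triangles. -/
noncomputable def pentagonArea (w : Fin 5 → Plane) : ℝ :=
  (orient (w 0) (w 1) (w 2) + orient (w 0) (w 2) (w 3) + orient (w 0) (w 3) (w 4)) / 2

theorem pentagonArea_shift (w : Fin 5 → Plane) (k : Fin 5) :
    pentagonArea (fun i => w (i + k)) = pentagonArea w := by
  fin_cases k <;> simp [pentagonArea, orient, wedge] <;> ring

/-- **The isoperimetric inequality for convex pentagons with given angles** (Lhuilier). -/
theorem IsStrictlyConvexPath.isoperimetric {w : Fin 5 → Plane} (h : IsStrictlyConvexPath w) :
    4 * pentagonArea w * ∑ i, cotHalf (interiorAngle w i) ≤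
      (∑ i, dist (w i) (w (i + 1))) ^ 2 := by
  -- two angles at the ends of a side exceed `π` together unless the neighboring sides converge
  have hpair : ∀ i, wedge (w i - w (i - 1)) (w (i + 2) - w (i + 1)) < 0 →
      interiorAngle w i + interiorAngle w (i + 1) < Real.pi := by
    intro i hneg
    have hw : ∀ a b c : Plane, wedge (b - a) (c - b) = orient a b c := by
      intro a b c; simp [orient, wedge]; ring
    have q1 := h.orient_pos i
    have q2 := h.orient_pos (i + 1)
    rw [add_sub_cancel_right, add_assoc, show (1 + 1 : Fin 5) = 2 from rfl] at q2
    rw [← hw] at q1 q2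
    have hang := (angle_add_angle_lt_pi_iff q1 q2).2 hneg
    have e1 : interiorAngle w i =
        Real.pi - InnerProductGeometry.angle (w i - w (i - 1)) (w (i + 1) - w i) := by
      rw [← InnerProductGeometry.angle_neg_left, neg_sub]; rfl
    have e2 : interiorAngle w (i + 1) =
        Real.pi - InnerProductGeometry.angle (w (i + 1) - w i) (w (i + 2) - w (i + 1)) := by
      rw [← InnerProductGeometry.angle_neg_left, neg_sub, interiorAngle, add_sub_cancel_right,
        add_assoc]; rfl
    linarith
  have hshift : ∀ k, IsStrictlyConvexPath fun i => w (i + k) := by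
    intro k i j h1 h2
    have := h (i + k) (j + k) (by simpa using h1) (by rw [add_right_comm]; simpa using h2)
    rwa [add_right_comm] at this
  -- the claim, if the circle touching the sides `0`, `2`, `4` can be used
  have core : ∀ w : Fin 5 → Plane, IsStrictlyConvexPath w →
      0 ≤ wedge (w 1 - w 0) (w 3 - w 2) → 0 ≤ wedge (w 3 - w 2) (w 0 - w 4) →
      4 * pentagonArea w * ∑ i, cotHalf (interiorAngle w i) ≤
        (∑ i, dist (w i) (w (i + 1))) ^ 2 := by
    intro w h h1 h3
    have hw : ∀ a b c : Plane, wedge (b - a) (c - b) = orient a b c := by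
      intro a b c; simp [orient, wedge]; ring
    have q0 : 0 < orient (w 4) (w 0) (w 1) := h.orient_pos 0
    have q1 : 0 < orient (w 0) (w 1) (w 2) := h.orient_pos 1
    have q2 : 0 < orient (w 1) (w 2) (w 3) := h.orient_pos 2
    have q3 : 0 < orient (w 2) (w 3) (w 4) := h.orient_pos 3
    have q4 : 0 < orient (w 3) (w 4) (w 0) := h.orient_pos 4
    have q20 : 0 < orient (w 2) (w 3) (w 0) := h 2 0 (by decide) (by decide)
    have key := isoperimetric_of_wedge_nonneg (a := w 0) (b := w 1) (c := w 2) (d := w 3) (e := w 4)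
      (by rwa [hw]) (by rwa [hw]) (by rwa [hw]) (by rwa [hw]) (by rwa [hw]) q20 h1 h3
    have ht : ∀ a b c : Plane, 0 < orient a b c →
        tanHalf (b - a) (c - b) = cotHalf (EuclideanGeometry.angle a b c) := by
      intro a b c hp
      rw [tanHalf_eq_cotHalf (by rwa [hw]), neg_sub]; rfl
    rw [ht _ _ _ q0, ht _ _ _ q1, ht _ _ _ q2, ht _ _ _ q3, ht _ _ _ q4] at key
    rw [Fin.sum_univ_five, Fin.sum_univ_five]
    have hd : ∀ a b : Plane, dist a b = ‖b - a‖ := fun a b => by rw [dist_comm, dist_eq_norm]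
    simp only [hd]
    refine le_trans (le_of_eq ?_) key
    rw [pentagonArea, show ∀ x : ℝ, 4 * (x / 2) = 2 * x by intro x; ring]
    rfl
  have hsum := h.sum_interiorAngle
  have hidx : ∀ i : Fin 5, i + 2 - 1 = i + 1 ∧ i + 2 + 2 = i + 4 ∧ i + 2 + 1 = i + 3 := by decide
  have hor : ∀ i, 0 ≤ wedge (w i - w (i - 1)) (w (i + 2) - w (i + 1)) ∨
      0 ≤ wedge (w (i + 2) - w (i + 1)) (w (i + 4) - w (i + 3)) := by
    intro i
    by_contra hcon
    push Not at hcon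
    have b1 := hpair i hcon.1
    have b2 := hpair (i + 2) (by
      obtain ⟨e1, e2, e3⟩ := hidx i
      rw [e1, e2, e3]; exact hcon.2)
    have b3 := (h.interiorAngle_mem (i + 4)).2
    have hs : ∑ j, interiorAngle w j = interiorAngle w i + interiorAngle w (i + 1) +
        interiorAngle w (i + 2) + interiorAngle w (i + 2 + 1) + interiorAngle w (i + 4) := by
      rw [← Equiv.sum_comp (Equiv.addLeft i), Fin.sum_univ_five]
      simp only [Equiv.coe_addLeft, add_zero, add_assoc]
      rfl
    linarith
  have hfin : ∃ k : Fin 5, 0 ≤ wedge (w (k + 1) - w k) (w (k + 3) - w (k + 2)) ∧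
      0 ≤ wedge (w (k + 3) - w (k + 2)) (w k - w (k + 4)) := by
    have g0 := hor 0
    have g1 := hor 1
    have g2 := hor 2
    have g3 := hor 3
    have g4 := hor 4
    change 0 ≤ wedge (w 0 - w 4) (w 2 - w 1) ∨ 0 ≤ wedge (w 2 - w 1) (w 4 - w 3) at g0
    change 0 ≤ wedge (w 1 - w 0) (w 3 - w 2) ∨ 0 ≤ wedge (w 3 - w 2) (w 0 - w 4) at g1
    change 0 ≤ wedge (w 2 - w 1) (w 4 - w 3) ∨ 0 ≤ wedge (w 4 - w 3) (w 1 - w 0) at g2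
    change 0 ≤ wedge (w 3 - w 2) (w 0 - w 4) ∨ 0 ≤ wedge (w 0 - w 4) (w 2 - w 1) at g3
    change 0 ≤ wedge (w 4 - w 3) (w 1 - w 0) ∨ 0 ≤ wedge (w 1 - w 0) (w 3 - w 2) at g4
    have : (0 ≤ wedge (w 1 - w 0) (w 3 - w 2) ∧ 0 ≤ wedge (w 3 - w 2) (w 0 - w 4)) ∨
        (0 ≤ wedge (w 2 - w 1) (w 4 - w 3) ∧ 0 ≤ wedge (w 4 - w 3) (w 1 - w 0)) ∨
        (0 ≤ wedge (w 3 - w 2) (w 0 - w 4) ∧ 0 ≤ wedge (w 0 - w 4) (w 2 - w 1)) ∨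
        (0 ≤ wedge (w 4 - w 3) (w 1 - w 0) ∧ 0 ≤ wedge (w 1 - w 0) (w 3 - w 2)) ∨
        (0 ≤ wedge (w 0 - w 4) (w 2 - w 1) ∧ 0 ≤ wedge (w 2 - w 1) (w 4 - w 3)) := by tauto
    rcases this with h | h | h | h | h
    exacts [⟨0, h⟩, ⟨1, h⟩, ⟨2, h⟩, ⟨3, h⟩, ⟨4, h⟩]
  obtain ⟨k, hk1, hk2⟩ := hfin
  have := core _ (hshift k) (by simpa [add_comm] using hk1) (by simpa [add_comm] using hk2)
  rw [pentagonArea_shift] at this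
  have e1 : ∑ i, cotHalf (interiorAngle (fun i => w (i + k)) i) =
      ∑ i, cotHalf (interiorAngle w i) := by
    rw [← Equiv.sum_comp (Equiv.addRight k) fun i => cotHalf (interiorAngle w i)]
    refine Finset.sum_congr rfl fun i _ => ?_
    simp only [interiorAngle, Equiv.coe_addRight]
    rw [sub_add_eq_add_sub, add_right_comm]
  have e2 : ∑ i, dist (w (i + k)) (w (i + 1 + k)) = ∑ i, dist (w i) (w (i + 1)) := by
    rw [← Equiv.sum_comp (Equiv.addRight k) fun i => dist (w i) (w (i + 1))]
    refine Finset.sum_congr rfl fun i _ => ?_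
    simp only [Equiv.coe_addRight]
    rw [add_right_comm]
  rwa [e1, e2] at this

/-- A convex pentagon is covered by three triangles with a common vertex. -/
theorem IsStrictlyConvexPath.volume_leftHalfPlanes_le {w : Fin 5 → Plane}
    (h : IsStrictlyConvexPath w) : volume.real (leftHalfPlanes w) ≤ pentagonArea w := by
  have tri : ∀ {a b c z : Plane}, 0 < orient a b c → 0 ≤ orient a b z → 0 ≤ orient b c z →
      0 ≤ orient c a z → z ∈ convexHull ℝ {a, b, c} := by
    intro a b c z h h1 h2 h3
    rw [mem_convexHull_triple]
    refine ⟨orient c a z / orient a b c, orient a b z / orient a b c, by positivity, by positivity,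
      ?_, ?_⟩
    · rw [← add_div, div_le_one h]
      have : orient a b c = orient a b z + orient b c z + orient c a z := by
        simp [orient, wedge]; ring
      linarith
    · have hc : ∀ i, orient a b c * (z - a) i =
          orient c a z * (b - a) i + orient a b z * (c - a) i := by
        intro i
        fin_cases i <;> (simp [orient, wedge]; ring)
      have : z - a = (orient c a z / orient a b c) • (b - a) +
          (orient a b z / orient a b c) • (c - a) := by
        ext i
        have := hc i
        rw [PiLp.add_apply, PiLp.smul_apply, PiLp.smul_apply, smul_eq_mul, smul_eq_mul]
        field_simp
        linarith
      rw [← this]; abel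
  have o012 : 0 < orient (w 0) (w 1) (w 2) := h 0 2 (by decide) (by decide)
  have o230 : 0 < orient (w 2) (w 3) (w 0) := h 2 0 (by decide) (by decide)
  have o340 : 0 < orient (w 3) (w 4) (w 0) := h 3 0 (by decide) (by decide)
  have o023 : 0 < orient (w 0) (w 2) (w 3) := by rwa [← orient_rotate]
  have o034 : 0 < orient (w 0) (w 3) (w 4) := by rwa [← orient_rotate]
  have hsub : leftHalfPlanes w ⊆ convexHull ℝ {w 0, w 1, w 2} ∪
      (convexHull ℝ {w 0, w 2, w 3} ∪ convexHull ℝ {w 0, w 3, w 4}) := by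
    intro z hz
    rcases le_total 0 (orient (w 2) (w 0) z) with h1 | h1
    · exact Or.inl (tri o012 (hz 0) (hz 1) h1)
    · rcases le_total 0 (orient (w 3) (w 0) z) with h2 | h2
      · exact Or.inr (Or.inl (tri o023 (by rw [orient_swap]; linarith) (hz 2) h2))
      · exact Or.inr (Or.inr (tri o034 (by rw [orient_swap]; linarith) (hz 3) (hz 4)))
  have v : ∀ {a b c : Plane}, 0 < orient a b c →
      volume.real (convexHull ℝ {a, b, c}) = orient a b c / 2 := by
    intro a b c h
    rw [volume_real_convexHull_triple, ← abs_of_pos h]; rfl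
  calc volume.real (leftHalfPlanes w) ≤ _ :=
        measureReal_mono hsub (measure_union_ne_top (volume_triple_ne_top _ _ _)
          (measure_union_ne_top (volume_triple_ne_top _ _ _) (volume_triple_ne_top _ _ _)))
    _ ≤ _ := measureReal_union_le _ _
    _ ≤ _ := add_le_add le_rfl (measureReal_union_le _ _)
    _ = pentagonArea w := by rw [v o012, v o023, v o034, pentagonArea]; ring

end Angles

/-- The area of a circular sector with vertex `x`. -/
theorem volume_sector_inter_ball_at {u v x : Plane} (h : 0 < wedge u v) {ε : ℝ} (hε : 0 < ε) :
    volume.real ({z | 0 ≤ wedge u (z - x) ∧ 0 ≤ wedge (z - x) v} ∩ Metric.ball x ε) =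
      InnerProductGeometry.angle u v * ε ^ 2 / 2 := by
  have hset : {z | 0 ≤ wedge u (z - x) ∧ 0 ≤ wedge (z - x) v} ∩ Metric.ball x ε =
      (fun z => z + -x) ⁻¹' (sector u v ∩ Metric.ball 0 ε) := by
    ext z
    simp [sector, dist_eq_norm, sub_eq_add_neg]
  rw [hset, Measure.real, measure_preimage_add_right, volume_sector_inter_ball h hε,
    ENNReal.toReal_ofReal]
  have := InnerProductGeometry.angle_nonneg u v
  positivity

/-- Near a vertex, a convex pentagon is a circular sector. -/
theorem IsStrictlyConvexPath.exists_volume_inter_ball {w : Fin 5 → Plane}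
    (h : IsStrictlyConvexPath w) (i : Fin 5) : ∃ ε₀ > 0, ∀ ε > 0, ε ≤ ε₀ →
      volume.real (leftHalfPlanes w ∩ Metric.ball (w i) ε) = interiorAngle w i * ε ^ 2 / 2 := by
  have hopen : IsOpen (⋂ j ∈ ({i, i - 1}ᶜ : Set (Fin 5)), {z | 0 < orient (w j) (w (j + 1)) z}) :=
    Set.Finite.isOpen_biInter (Set.toFinite _)
      fun j _ => isOpen_lt continuous_const (continuous_orient _ _)
  have hmem : w i ∈ ⋂ j ∈ ({i, i - 1}ᶜ : Set (Fin 5)), {z | 0 < orient (w j) (w (j + 1)) z} := by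
    simp only [Set.mem_iInter]
    intro j hj
    simp only [Set.mem_compl_iff, Set.mem_insert_iff, Set.mem_singleton_iff, not_or] at hj
    exact h j i (fun e => hj.1 e.symm) (fun e => hj.2 (by rw [e, add_sub_cancel_right]))
  obtain ⟨ε₀, hε₀, hball⟩ := Metric.isOpen_iff.1 hopen _ hmem
  refine ⟨ε₀, hε₀, fun ε hε hle => ?_⟩
  have hset : leftHalfPlanes w ∩ Metric.ball (w i) ε =
      {z | 0 ≤ wedge (w (i + 1) - w i) (z - w i) ∧ 0 ≤ wedge (z - w i) (w (i - 1) - w i)} ∩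
        Metric.ball (w i) ε := by
    have e2 : ∀ z, wedge (z - w i) (w (i - 1) - w i) = orient (w (i - 1)) (w i) z := by
      intro z; simp [orient, wedge]; ring
    ext z
    simp only [Set.mem_inter_iff, Set.mem_ofPred_eq, e2]
    refine and_congr_left fun hz => ⟨fun hz' => ⟨hz' i, ?_⟩, fun hz' j => ?_⟩
    · have := hz' (i - 1); rwa [sub_add_cancel] at this
    · by_cases h1 : j = i
      · rw [h1]; exact hz'.1
      · by_cases h2 : j = i - 1
        · rw [h2, sub_add_cancel]; exact hz'.2
        · have := Set.mem_iInter₂.1 (hball (Metric.ball_subset_ball hle hz)) j (by simp [h1, h2])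
          exact this.le
  have hpos : 0 < wedge (w (i + 1) - w i) (w (i - 1) - w i) := by
    have := h.orient_pos i
    rw [← orient_rotate] at this
    exact this
  rw [hset, volume_sector_inter_ball_at hpos hε, InnerProductGeometry.angle_comm]
  rfl

/-! ### Circumscribed polygons -/

namespace SimplePolygon

variable {n : ℕ} (P : SimplePolygon n)

/-- A side of a convex polygon that a circle inside the polygon touches is tangent to the circle:
the polygon has a supporting line along the side. -/
theorem inner_touching_eq_zero (hP : P.IsConvex) {c t : Plane} {r : ℝ} (hr : 0 < r)
    (hball : Metric.closedBall c r ⊆ P.region) {k : Fin n} (ht : t ∈ P.edge k)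
    (hts : t ∈ Metric.sphere c r) :
    inner ℝ (t - c) (P.vertex (finRotate n k) - P.vertex k) = 0 := by
  have hm : midpoint ℝ (P.vertex k) (P.vertex (finRotate n k)) ∈ P.edge k := by
    rw [edge_eq_segment]; exact midpoint_mem_segment _ _
  have hmi := (P.edge_subset_frontier k hm).2
  obtain ⟨f, hf⟩ := geometric_hahn_banach_open_point (Convex.interior hP) isOpen_interior hmi
  have hf' : ∀ a ∈ P.region, f a ≤ f (midpoint ℝ (P.vertex k) (P.vertex (finRotate n k))) := by
    intro a ha
    rw [← P.closure_interior_region] at ha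
    exact closure_minimal (fun x hx => (hf x hx).le)
      (isClosed_le f.continuous continuous_const) ha
  have hfm : f (midpoint ℝ (P.vertex k) (P.vertex (finRotate n k))) =
      (f (P.vertex k) + f (P.vertex (finRotate n k))) / 2 := by
    rw [midpoint_eq_smul_add, map_smul, map_add, smul_eq_mul, invOf_eq_inv]; ring
  have g1 := hf' _ (P.edge_subset_region k (P.vertex_mem_edge k))
  have g2 := hf' _ (P.edge_subset_region k (P.vertex_rotate_mem_edge k))
  have hE : f (P.vertex (finRotate n k) - P.vertex k) = 0 := by rw [map_sub]; linarith
  have hft : f t = f (midpoint ℝ (P.vertex k) (P.vertex (finRotate n k))) := by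
    rw [edge_eq_segment] at ht
    obtain ⟨a, b, -, -, hab, rfl⟩ := ht
    rw [map_add, map_smul, map_smul, smul_eq_mul, smul_eq_mul]
    obtain rfl : a = 1 - b := by linarith
    have : f (P.vertex (finRotate n k)) = f (P.vertex k) := by linarith
    rw [hfm, this]; ring
  set a := (InnerProductSpace.toDual ℝ Plane).symm f with ha
  have hfa : ∀ z, f z = inner ℝ a z := fun z => (InnerProductSpace.toDual_symm_apply).symm
  have ha0 : a ≠ 0 := by
    intro h0
    have hc : c ∈ interior P.region := mem_interior.2
      ⟨Metric.ball c r, Metric.ball_subset_closedBall.trans hball, Metric.isOpen_ball,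
        Metric.mem_ball_self hr⟩
    have := hf c hc
    rw [hfa, hfa, h0, inner_zero_left, inner_zero_left] at this
    exact lt_irrefl _ this
  have han : 0 < ‖a‖ := norm_pos_iff.2 ha0
  have hmem : c + (r / ‖a‖) • a ∈ P.region := by
    apply hball
    rw [mem_closedBall_iff_norm, add_sub_cancel_left, norm_smul, Real.norm_of_nonneg (by positivity),
      div_mul_cancel₀ _ han.ne']
  have hle := hf' _ hmem
  rw [← hft, hfa, hfa, inner_add_right, real_inner_smul_right, real_inner_self_eq_norm_sq] at hle
  have htn : ‖t - c‖ = r := mem_sphere_iff_norm.1 hts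
  have h1 : ‖a‖ * ‖t - c‖ ≤ inner ℝ a (t - c) := by
    rw [htn, inner_sub_right]
    have : r / ‖a‖ * ‖a‖ ^ 2 = ‖a‖ * r := by field_simp
    linarith
  have h2 := inner_eq_norm_mul_iff_real.1 (le_antisymm (real_inner_le_norm _ _) h1)
  -- equality in the Cauchy–Schwarz inequality
  have h3 : ‖a‖ * inner ℝ (t - c) (P.vertex (finRotate n k) - P.vertex k) = 0 := by
    rw [← real_inner_smul_left, ← h2, real_inner_smul_left, ← hfa, hE, mul_zero]
  exact (mul_eq_zero.1 h3).resolve_left han.ne'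

/-- Two sides of a convex polygon seen from an interior point: the triangles they span with the point
overlap only in segments joining the point to vertices. -/
theorem aedisjoint_triangles (hP : P.IsConvex) {c : Plane} (hc : c ∈ interior P.region)
    {j k : Fin n} (hjk : j ≠ k) :
    AEDisjoint volume (convexHull ℝ {c, P.vertex j, P.vertex (finRotate n j)})
      (convexHull ℝ {c, P.vertex k, P.vertex (finRotate n k)}) := by
  have hsub : convexHull ℝ {c, P.vertex j, P.vertex (finRotate n j)} ∩
      convexHull ℝ {c, P.vertex k, P.vertex (finRotate n k)} ⊆
        ⋃ m, segment ℝ c (P.vertex m) := by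
    rintro x ⟨hx1, hx2⟩
    rw [convexHull_insert (by simp), convexHull_pair, ← edge_eq_segment] at hx1 hx2
    simp only [mem_convexJoin, Set.mem_singleton_iff, exists_eq_left] at hx1 hx2
    obtain ⟨y, hy, hxy⟩ := hx1
    obtain ⟨z, hz, hxz⟩ := hx2
    have hyz : x = c ∨ y = z := by
      have step : ∀ {y z : Plane} {s t : ℝ}, y ∈ P.region → z ∈ frontier P.region → 0 < s → s < t →
          c + s • (y - c) = c + t • (z - c) → False := by
        intro y z s t hy hz hs hst he
        have hzeq : z = (1 - s / t) • c + (s / t) • y := by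
          have ht : 0 < t := hs.trans hst
          have : t • (z - c) = s • (y - c) := (add_left_cancel he).symm
          have : z - c = (s / t) • (y - c) := by
            rw [div_eq_inv_mul, mul_smul, ← this, smul_smul, inv_mul_cancel₀ ht.ne', one_smul]
          rw [show z = c + (z - c) by abel, this]
          module
        have hop : z ∈ openSegment ℝ c y := by
          have ht : 0 < t := hs.trans hst
          refine ⟨_, _, ?_, ?_, ?_, hzeq.symm⟩
          · rw [sub_pos, div_lt_one ht]; exact hst
          · positivity
          · ring
        exact hz.2 (Convex.openSegment_interior_self_subset_interior hP hc hy hop)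
      obtain ⟨s, hs, rfl⟩ := (segment_eq_image' ℝ c y ▸ hxy : x ∈ (fun θ : ℝ => c + θ • (y - c)) '' _)
      obtain ⟨t, ht, he⟩ := (segment_eq_image' ℝ c z ▸ hxz : _ ∈ (fun θ : ℝ => c + θ • (z - c)) '' _)
      simp only at he ⊢
      rcases hs.1.eq_or_lt with h0 | h0
      · left; rw [← h0]; simp
      rcases ht.1.eq_or_lt with h0' | h0'
      · left; rw [← he, ← h0']; simp
      right
      rcases lt_trichotomy s t with h | h | h
      · exact (step (P.edge_subset_region j hy) (P.edge_subset_frontier k hz) h0 h he.symm).elim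
      · subst h
        have := smul_right_injective Plane h0.ne' (add_left_cancel he)
        exact (sub_left_injective this).symm
      · exact (step (P.edge_subset_region k hz) (P.edge_subset_frontier j hy) h0' h he).elim
    rcases hyz with rfl | rfl
    · exact Set.mem_iUnion.2 ⟨j, left_mem_segment _ _ _⟩
    · rcases (P.edge_inter_subset hjk ⟨hy, hz⟩).1 with rfl | rfl
      · exact Set.mem_iUnion.2 ⟨_, hxy⟩
      · exact Set.mem_iUnion.2 ⟨_, hxy⟩
  exact measure_mono_null hsub (measure_iUnion_null fun m => volume_segment_eq_zero _ _)

/-- A circumscribed convex polygon has at least the area `r * p / 2`. -/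
theorem inradius_mul_perimeter_le (hP : P.IsConvex) {c : Plane} {r : ℝ} (hr : 0 < r)
    (hball : Metric.closedBall c r ⊆ P.region)
    (ht : ∀ k, (Metric.sphere c r ∩ P.edge k).Nonempty) : r * P.perimeter / 2 ≤ P.area := by
  have hc : c ∈ interior P.region := mem_interior.2
    ⟨Metric.ball c r, Metric.ball_subset_closedBall.trans hball, Metric.isOpen_ball,
      Metric.mem_ball_self hr⟩
  have hvol : ∀ k, volume.real (convexHull ℝ {c, P.vertex k, P.vertex (finRotate n k)}) =
      r * dist (P.vertex k) (P.vertex (finRotate n k)) / 2 := by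
    intro k
    obtain ⟨t, hts, hte⟩ := ht k
    have horth := P.inner_touching_eq_zero hP hr hball hte hts
    rw [volume_real_convexHull_triple]
    have e1 : wedge (P.vertex k - c) (P.vertex (finRotate n k) - c) =
        wedge (t - c) (P.vertex (finRotate n k) - P.vertex k) := by
      rw [edge_eq_segment] at hte
      obtain ⟨a, b, -, -, hab, rfl⟩ := hte
      obtain rfl : a = 1 - b := by linarith
      simp [wedge]; ring
    have e2 := inner_sq_add_wedge_sq (t - c) (P.vertex (finRotate n k) - P.vertex k)
    rw [horth, mem_sphere_iff_norm.1 hts] at e2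
    rw [e1, dist_comm, dist_eq_norm]
    congr 1
    rw [← abs_of_pos hr, ← abs_norm (P.vertex (finRotate n k) - P.vertex k), ← abs_mul,
      ← sq_eq_sq_iff_abs_eq_abs]
    linarith
  have hdisj : Pairwise (Function.onFun (AEDisjoint volume)
      fun k => convexHull ℝ {c, P.vertex k, P.vertex (finRotate n k)}) :=
    fun j k hjk => P.aedisjoint_triangles hP hc hjk
  have hmeas : ∀ k, NullMeasurableSet (convexHull ℝ {c, P.vertex k, P.vertex (finRotate n k)})
      volume := fun k =>
    ((Set.toFinite _).isClosed_convexHull (𝕜 := ℝ)).measurableSet.nullMeasurableSet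
  have hU : ⋃ k, convexHull ℝ {c, P.vertex k, P.vertex (finRotate n k)} ⊆ P.region := by
    refine Set.iUnion_subset fun k => convexHull_min ?_ hP
    rintro _ (rfl | rfl | rfl)
    exacts [interior_subset hc, P.vertex_mem_region _, P.vertex_mem_region _]
  calc r * P.perimeter / 2
      = ∑ k, volume.real (convexHull ℝ {c, P.vertex k, P.vertex (finRotate n k)}) := by
        simp_rw [hvol]
        rw [perimeter, Finset.mul_sum, Finset.sum_div]
    _ = volume.real (⋃ k, convexHull ℝ {c, P.vertex k, P.vertex (finRotate n k)}) := by
        rw [Measure.real, measure_iUnion₀ hdisj hmeas, tsum_fintype, ENNReal.toReal_sum]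
        · rfl
        · exact fun k _ => volume_triple_ne_top _ _ _
    _ ≤ P.area := measureReal_mono hU P.volume_region_ne_top

/-- The tangent segments from the vertices of a circumscribed convex polygon to its circle: their
lengths add up to half the perimeter and are determined by the angles. -/
theorem exists_tangentLengths (hP : P.IsConvex) {c : Plane} {r : ℝ} (hr : 0 < r)
    (hball : Metric.closedBall c r ⊆ P.region)
    (ht : ∀ k, (Metric.sphere c r ∩ P.edge k).Nonempty) :
    ∃ τ : Fin n → ℝ, (∀ k, 0 ≤ τ k) ∧ P.perimeter = 2 * ∑ k, τ k ∧
      ∀ k, P.angle k ≠ 0 →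
        r ^ 2 * (1 + Real.cos (P.angle k)) = τ k ^ 2 * (1 - Real.cos (P.angle k)) := by
  choose t ht1 ht2 using ht
  have horth := fun k => P.inner_touching_eq_zero hP hr hball (ht2 k) (ht1 k)
  have htn : ∀ k, ‖t k - c‖ = r := fun k => mem_sphere_iff_norm.1 (ht1 k)
  -- Pythagoras
  have hpyth : ∀ k, dist (P.vertex k) (t k) ^ 2 = dist (P.vertex k) c ^ 2 - r ^ 2 ∧
      dist (P.vertex (finRotate n k)) (t k) ^ 2 = dist (P.vertex (finRotate n k)) c ^ 2 - r ^ 2 := by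
    intro k
    have hmem := ht2 k
    have ho := horth k
    have hn := htn k
    rw [edge_eq_segment] at hmem
    obtain ⟨a, b, -, -, hab, he⟩ := hmem
    obtain rfl : a = 1 - b := by linarith
    have key : ∀ x : Plane, (∃ s : ℝ, x - t k = s • (P.vertex (finRotate n k) - P.vertex k)) →
        dist x (t k) ^ 2 = dist x c ^ 2 - r ^ 2 := by
      rintro x ⟨s, hs⟩
      rw [dist_eq_norm, dist_eq_norm, show x - c = (x - t k) + (t k - c) by abel,
        norm_add_sq_real, hn, hs, real_inner_smul_left, real_inner_comm, ho]
      ring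
    exact ⟨key _ ⟨-b, by rw [← he]; module⟩, key _ ⟨1 - b, by rw [← he]; module⟩⟩
  refine ⟨fun k => dist (P.vertex k) (t k), fun k => dist_nonneg, ?_, ?_⟩
  · have hsame : ∀ k, dist (P.vertex (finRotate n k)) (t k) =
        dist (P.vertex (finRotate n k)) (t (finRotate n k)) := by
      intro k
      rw [← sq_eq_sq₀ dist_nonneg dist_nonneg, (hpyth k).2, (hpyth (finRotate n k)).1]
    have hsplit : ∀ k, dist (P.vertex k) (P.vertex (finRotate n k)) =
        dist (P.vertex k) (t k) + dist (P.vertex (finRotate n k)) (t (finRotate n k)) := by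
      intro k
      have hmem := ht2 k
      rw [edge_eq_segment] at hmem
      rw [← (mem_segment_iff_wbtw.1 hmem).dist_add_dist, dist_comm (t k), hsame]
    rw [perimeter, Finset.sum_congr rfl fun k _ => hsplit k, Finset.sum_add_distrib,
      Equiv.sum_comp (finRotate n) fun k => dist (P.vertex k) (t k)]
    ring
  · intro k hang
    beta_reduce
    set l := (finRotate n).symm k with hl
    have hlk : finRotate n l = k := Equiv.apply_symm_apply _ _
    set v := P.vertex k with hv
    set x := P.vertex (finRotate n k) - v with hx
    set u := P.vertex l - v with hu
    have hx0 : 0 < ‖x‖ := norm_pos_iff.2 (sub_ne_zero.2 (P.vertex_ne_vertex_rotate k).symm)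
    have hu0 : 0 < ‖u‖ := by
      have := P.vertex_ne_vertex_rotate l
      rw [hlk] at this
      exact norm_pos_iff.2 (sub_ne_zero.2 this)
    have hτ : dist v (t l) = dist v (t k) := by
      have h1 := (hpyth l).2
      rw [hlk] at h1
      rw [← sq_eq_sq₀ dist_nonneg dist_nonneg, h1, (hpyth k).1]
    have hcos : ‖u‖ * ‖x‖ * Real.cos (P.angle k) = inner ℝ u x := cos_angle_mul_norms u x
    have hcos1 : Real.cos (P.angle k) ≠ 1 := by
      intro h1
      apply hang
      have := Real.injOn_cos ⟨InnerProductGeometry.angle_nonneg _ _,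
        InnerProductGeometry.angle_le_pi _ _⟩ ⟨le_rfl, Real.pi_pos.le⟩
          (h1.trans Real.cos_zero.symm : Real.cos (InnerProductGeometry.angle u x) = _)
      exact this
    have hW : ‖c - v‖ ^ 2 = r ^ 2 + dist v (t k) ^ 2 := by
      rw [(hpyth k).1, dist_comm, dist_eq_norm]; ring
    -- both projections of `c - v` to the directions of the sides equal the tangent length
    have hproj : ∀ {y tt : Plane}, inner ℝ (tt - c) y = 0 → (∃ s : ℝ, 0 ≤ s ∧ tt - v = s • y) →
        inner ℝ (c - v) y = dist v tt * ‖y‖ := by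
      rintro y tt h0 ⟨s, hs, he⟩
      have : inner ℝ (c - v) y = inner ℝ (tt - v) y := by
        rw [show tt - v = (tt - c) + (c - v) by abel, inner_add_left, h0, zero_add]
      rw [this, dist_comm, dist_eq_norm, he, real_inner_smul_left, norm_smul,
        Real.norm_of_nonneg hs, real_inner_self_eq_norm_sq]
      ring
    have p1 : inner ℝ (c - v) x = dist v (t k) * ‖x‖ := by
      refine hproj (horth k) ?_
      have hmem := ht2 k
      rw [edge_eq_segment] at hmem
      obtain ⟨a, b, -, hb, hab, he⟩ := hmem
      obtain rfl : a = 1 - b := by linarith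
      exact ⟨b, hb, by rw [← he, hx, hv]; module⟩
    have p2 : inner ℝ (c - v) u = dist v (t k) * ‖u‖ := by
      rw [← hτ]
      refine hproj ?_ ?_
      · have := horth l
        rw [hlk] at this
        rw [hu, show P.vertex l - v = -(v - P.vertex l) by abel, inner_neg_right, this, neg_zero]
      · have hmem := ht2 l
        rw [edge_eq_segment, hlk] at hmem
        obtain ⟨a, b, ha, -, hab, he⟩ := hmem
        obtain rfl : b = 1 - a := by linarith
        exact ⟨a, ha, by rw [← he, hu, hv]; module⟩
    generalize dist v (t k) = τ at *
    generalize Real.cos (P.angle k) = g at *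
    generalize c - v = W at *
    -- the Gram determinant of three vectors of the plane vanishes
    have gram : ‖W‖ ^ 2 * (‖u‖ ^ 2 * ‖x‖ ^ 2 - (inner ℝ u x) ^ 2) -
        ((inner ℝ W u) ^ 2 * ‖x‖ ^ 2 - 2 * inner ℝ W u * inner ℝ W x * inner ℝ u x +
          (inner ℝ W x) ^ 2 * ‖u‖ ^ 2) = 0 := by
      simp only [plane_norm_sq, plane_inner_eq]; ring
    rw [p1, p2, ← hcos, hW] at gram
    have hfac : ‖u‖ ^ 2 * ‖x‖ ^ 2 * ((1 - g) * (r ^ 2 * (1 + g) - τ ^ 2 * (1 - g))) = 0 := by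
      rw [← gram]; ring
    rcases mul_eq_zero.1 hfac with h | h
    · exact absurd h (by positivity)
    · rcases mul_eq_zero.1 h with h | h
      · exact absurd (by linarith) hcos1
      · linarith

theorem perimeter_nonneg : 0 ≤ P.perimeter := Finset.sum_nonneg fun _ _ => dist_nonneg

/-- The perimeter of a Cairo or a Prismatic pentagon of unit area is at most `2 * √(2 + √3)`. -/
theorem perimeter_sq_le_of_isCairo_or_isPrismatic (C : SimplePolygon 5)
    (hC : C.IsCairo ∨ C.IsPrismatic) (harea : C.area = 1) :
    C.perimeter ^ 2 ≤ 4 * (2 + √3) := by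
  have hconv : C.IsConvex := by rcases hC with h | h <;> exact h.1
  obtain ⟨c, r, hr, hball, ht⟩ : C.IsCircumscribed := by rcases hC with h | h <;> exact h.2.1
  obtain ⟨τ, hτ, hper, hang⟩ := C.exists_tangentLengths hconv hr hball ht
  have hA := C.inradius_mul_perimeter_le hconv hr hball ht
  rw [harea] at hA
  have h3 : (0 : ℝ) < √3 := by positivity
  have h33 : √3 * √3 = 3 := Real.mul_self_sqrt (by norm_num)
  have hright : ∀ k, C.angle k = Real.pi / 2 → τ k = r := by
    intro k hk
    have := hang k (by rw [hk]; positivity)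
    rw [hk, Real.cos_pi_div_two] at this
    exact ((sq_eq_sq₀ hr.le (hτ k)).1 (by linarith)).symm
  have hobt : ∀ k, C.angle k = 2 * Real.pi / 3 → τ k = r * √3 / 3 := by
    intro k hk
    have := hang k (by rw [hk]; positivity)
    have hc : Real.cos (2 * Real.pi / 3) = -(1 / 2) := by
      rw [show 2 * Real.pi / 3 = Real.pi - Real.pi / 3 by ring, Real.cos_pi_sub,
        Real.cos_pi_div_three]
    rw [hk, hc] at this
    refine (sq_eq_sq₀ (hτ k) (by positivity)).1 ?_
    rw [div_pow, mul_pow, sq √3, h33]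
    linarith
  have hsum : ∀ k : Fin 5, ∑ j, τ j = τ k + τ (k + 1) + τ (k + 2) + τ (k + 3) + τ (k + 4) := by
    intro k
    rw [← Equiv.sum_comp (Equiv.addLeft k), Fin.sum_univ_five]
    simp only [Equiv.coe_addLeft, add_zero]
  have hτsum : ∑ j, τ j = r * (2 + √3) := by
    rcases hC with ⟨-, -, k, a0, a1, a2, a3, a4⟩ | ⟨-, -, k, a0, a1, a2, a3, a4⟩
    · rw [hsum k, hright _ a0, hobt _ a1, hright _ a2, hobt _ a3, hobt _ a4]; ring
    · rw [hsum k, hright _ a0, hright _ a1, hobt _ a2, hobt _ a3, hobt _ a4]; ring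
  rw [hτsum] at hper
  have hp := C.perimeter_nonneg
  have : C.perimeter ^ 2 = 4 * (2 + √3) * (r * C.perimeter / 2) := by
    rw [sq]; nth_rewrite 1 [hper]; ring
  rw [this]
  have h4 : (0 : ℝ) ≤ 4 * (2 + √3) := by positivity
  nlinarith

end SimplePolygon

/-! ### Short pentagons and non-convex quadrilaterals -/

/-- A triangle lies in the angular sector at each of its vertices. -/
theorem volume_triple_inter_ball_le {a b c : Plane} (h : orient a b c ≠ 0) {ε : ℝ} (hε : 0 < ε) :
    volume.real (convexHull ℝ {a, b, c} ∩ Metric.ball a ε) ≤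
      EuclideanGeometry.angle b a c * ε ^ 2 / 2 := by
  wlog hpos : 0 < orient a b c generalizing b c
  · have hsw : orient a c b = -orient a b c := by simp [orient, wedge]; ring
    have := this (b := c) (c := b) (by rwa [hsw, neg_ne_zero])
      (by rw [hsw]; have := lt_of_le_of_ne (not_lt.1 hpos) h; linarith)
    rwa [Set.pair_comm, EuclideanGeometry.angle_comm]
  have hsec := volume_sector_inter_ball_at (x := a) hpos hε
  refine (measureReal_mono ?_ ?_).trans_eq hsec
  · refine Set.inter_subset_inter_left _ fun z hz => ?_
    obtain ⟨s, t, hs, ht, -, rfl⟩ := mem_convexHull_triple.1 hz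
    rw [Set.mem_ofPred_eq, add_sub_cancel_left, wedge_add_right, wedge_smul_right, wedge_smul_right,
      wedge_self]
    refine ⟨?_, ?_⟩
    · rw [mul_zero, zero_add]; exact mul_nonneg ht hpos.le
    · have : wedge (s • (b - a) + t • (c - a)) (c - a) = s * orient a b c := by
        simp [orient, wedge]; ring
      rw [this]; exact mul_nonneg hs hpos.le
  · exact measure_ne_top_of_subset Set.inter_subset_right measure_ball_lt_top.ne

theorem sum_volume_triple_inter_ball_le {a b c : Plane} (h : orient a b c ≠ 0) {ε : ℝ}
    (hε : 0 < ε) :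
    volume.real (convexHull ℝ {a, b, c} ∩ Metric.ball a ε) +
      volume.real (convexHull ℝ {a, b, c} ∩ Metric.ball b ε) +
      volume.real (convexHull ℝ {a, b, c} ∩ Metric.ball c ε) ≤ Real.pi * ε ^ 2 / 2 := by
  have h1 := volume_triple_inter_ball_le h hε
  have h2 := volume_triple_inter_ball_le (a := b) (b := c) (c := a) (by rwa [orient_rotate]) hε
  have h3 := volume_triple_inter_ball_le (a := c) (b := a) (c := b)
    (by rwa [orient_rotate, orient_rotate]) hε
  rw [show ({b, c, a} : Set Plane) = {a, b, c} by
    ext x; simp only [Set.mem_insert_iff, Set.mem_singleton_iff]; tauto] at h2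
  rw [show ({c, a, b} : Set Plane) = {a, b, c} by
    ext x; simp only [Set.mem_insert_iff, Set.mem_singleton_iff]; tauto] at h3
  have hab : b ≠ a := by rintro rfl; simp [orient, wedge] at h
  have hpi := EuclideanGeometry.angle_add_angle_add_angle_eq_pi c hab
  rw [EuclideanGeometry.angle_comm a b c, EuclideanGeometry.angle_comm c a b,
    EuclideanGeometry.angle_comm b c a] at hpi
  rw [← hpi]
  linarith

namespace SimplePolygon

variable {n : ℕ}

theorem range_vertex_eq_insert (P : SimplePolygon n) (i : Fin n) :
    Set.range P.vertex = insert (P.vertex i) (P.vertex '' {i}ᶜ) := by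
  rw [← Set.image_insert_eq, ← Set.image_univ]
  congr 1
  ext j; simp [em]

/-- A polygon of positive area with vertices in convex position is the intersection of the half
planes to the left of its edges, if its vertices are ordered counterclockwise. -/
theorem exists_path_of_convexPosition [NeZero n] (P : SimplePolygon n) (harea : P.area ≠ 0)
    (hconv : ∀ i, P.vertex i ∉ convexHull ℝ (P.vertex '' {i}ᶜ)) :
    ∃ (w : Fin n → Plane) (e : Fin n ≃ Fin n), (∀ k, w (e k) = P.vertex k) ∧
      IsStrictlyConvexPath w ∧ P.region = leftHalfPlanes w ∧
      P.perimeter = ∑ i, dist (w i) (w (i + 1)) := by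
  have hne : ∀ i, P.vertex i ≠ P.vertex (i + 1) := fun i => by
    have := P.vertex_ne_vertex_rotate i; rwa [finRotate_apply] at this
  rcases P.isStrictlyConvexPath_vertex_or_neg hconv with h | h
  · refine ⟨P.vertex, Equiv.refl _, fun _ => rfl, h, ?_, ?_⟩
    · refine P.region_eq_leftHalfPlanes h rfl ?_ hne harea
      rw [frontier_eq_iUnion_edge]
      simp only [edge_eq_segment, finRotate_apply]
    · simp only [perimeter, finRotate_apply]
  · have hidx : ∀ i : Fin n, -(-i - 1 + 1) = i := fun i => by
      rw [sub_add_cancel, neg_neg]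
    have hidx2 : ∀ i : Fin n, -(i + 1) + 1 = -i := fun i => by
      rw [neg_add, neg_add_cancel_right]
    refine ⟨fun i => P.vertex (-i), Equiv.neg _, fun k => by simp, h, ?_, ?_⟩
    · refine P.region_eq_leftHalfPlanes h ?_ ?_ (fun i => ?_) harea
      · exact (Equiv.neg (Fin n)).surjective.range_comp P.vertex
      · rw [frontier_eq_iUnion_edge]
        refine Set.Subset.antisymm (Set.iUnion_subset fun i => ?_) (Set.iUnion_subset fun i => ?_)
        · refine Set.subset_iUnion_of_subset (-(i + 1)) ?_
          rw [edge_eq_segment, finRotate_apply, hidx2, neg_neg, neg_neg, segment_symm]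
        · refine Set.subset_iUnion_of_subset (-(i + 1)) ?_
          rw [edge_eq_segment, finRotate_apply, hidx2, segment_symm]
      · have := (hne (-(i + 1))).symm
        rwa [hidx2] at this
    · rw [perimeter, ← Equiv.sum_comp ((Equiv.addRight 1).trans (Equiv.neg (Fin n)))]
      refine Finset.sum_congr rfl fun i _ => ?_
      simp only [Equiv.trans_apply, Equiv.coe_addRight, Equiv.neg_apply]
      rw [finRotate_apply, hidx2, dist_comm]

/-- A short pentagon of unit area is convex, so that its angles are those of a strictly convex path;
they are described here by the areas that it cuts out of small disks about its vertices. -/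
theorem exists_angles_of_perimeter_le (P : SimplePolygon 5) (harea : P.area = 1)
    (hper : P.perimeter ^ 2 ≤ 4 * (2 + √3)) :
    ∃ α : Fin 5 → ℝ, (∀ k, α k ∈ Set.Ioo 0 Real.pi) ∧ ∑ k, α k = 3 * Real.pi ∧
      4 * ∑ k, cotHalf (α k) ≤ P.perimeter ^ 2 ∧
      ∃ ε₀ > 0, ∀ ε > 0, ε ≤ ε₀ → ∀ k,
        volume.real (P.region ∩ Metric.ball (P.vertex k) ε) = α k * ε ^ 2 / 2 := by
  have hconv : ∀ i, P.vertex i ∉ convexHull ℝ (P.vertex '' {i}ᶜ) := by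
    intro i hi
    have hcompl : ∀ i j : Fin 5, ¬j = i ↔ j = i + 1 ∨ j = i + 2 ∨ j = i + 3 ∨ j = i + 4 := by
      decide
    have himg : P.vertex '' {i}ᶜ =
        {P.vertex (i + 1), P.vertex (i + 2), P.vertex (i + 3), P.vertex (i + 4)} := by
      rw [show ({i}ᶜ : Set (Fin 5)) = {i + 1, i + 2, i + 3, i + 4} by
        ext j; simp only [Set.mem_compl_iff, Set.mem_singleton_iff, Set.mem_insert_iff]
        exact hcompl i j]
      simp only [Set.image_insert_eq, Set.image_singleton]
    have hsub : P.region ⊆ convexHull ℝ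
        {P.vertex (i + 1), P.vertex (i + 2), P.vertex (i + 3), P.vertex (i + 4)} := by
      refine P.region_subset_convexHull.trans ?_
      rw [P.range_vertex_eq_insert i, convexHull_insert_of_mem hi, himg]
    have h1 : P.area ≤ _ := measureReal_mono hsub
      ((Set.toFinite _).isCompact_convexHull ℝ).measure_ne_top
    have h2 := volume_real_convexHull_four_le (P.vertex (i + 1)) (P.vertex (i + 2))
      (P.vertex (i + 3)) (P.vertex (i + 4))
    have h3 : P.perimeter = dist (P.vertex i) (P.vertex (i + 1)) +
        dist (P.vertex (i + 1)) (P.vertex (i + 2)) + dist (P.vertex (i + 2)) (P.vertex (i + 3)) +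
        dist (P.vertex (i + 3)) (P.vertex (i + 4)) + dist (P.vertex (i + 4)) (P.vertex i) := by
      have hidx : ∀ i : Fin 5, i + 1 + 1 = i + 2 ∧ i + 2 + 1 = i + 3 ∧ i + 3 + 1 = i + 4 ∧
        i + 4 + 1 = i := by decide
      obtain ⟨e1, e2, e3, e4⟩ := hidx i
      rw [perimeter, ← Equiv.sum_comp (Equiv.addLeft i), Fin.sum_univ_five]
      simp only [Equiv.coe_addLeft, add_zero, finRotate_apply, e1, e2, e3, e4]
    have h4 := dist_triangle (P.vertex (i + 4)) (P.vertex i) (P.vertex (i + 1))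
    have h5 : (dist (P.vertex (i + 1)) (P.vertex (i + 2)) + dist (P.vertex (i + 2)) (P.vertex (i + 3))
        + dist (P.vertex (i + 3)) (P.vertex (i + 4)) +
        dist (P.vertex (i + 4)) (P.vertex (i + 1))) ^ 2 ≤ P.perimeter ^ 2 :=
      pow_le_pow_left₀ (by positivity) (by rw [h3]; linarith) 2
    have h6 : √3 < 2 := by rw [Real.sqrt_lt' (by norm_num)]; norm_num
    linarith
  obtain ⟨w, e, hwe, hw, hreg, hperim⟩ :=
    P.exists_path_of_convexPosition (by rw [harea]; exact one_ne_zero) hconv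
  refine ⟨fun k => interiorAngle w (e k), fun k => hw.interiorAngle_mem _, ?_, ?_, ?_⟩
  · rw [Equiv.sum_comp e (interiorAngle w), hw.sum_interiorAngle]
  · rw [Equiv.sum_comp e fun k => cotHalf (interiorAngle w k), hperim]
    refine le_trans ?_ hw.isoperimetric
    have hA : 1 ≤ pentagonArea w := by
      rw [← harea, area, hreg]; exact hw.volume_leftHalfPlanes_le
    have hS : 0 ≤ ∑ k, cotHalf (interiorAngle w k) := by
      refine Finset.sum_nonneg fun k _ => div_nonneg ?_ ?_
      · linarith [Real.neg_one_le_cos (interiorAngle w k)]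
      · obtain ⟨h1, h2⟩ := hw.interiorAngle_mem k
        exact (Real.sin_pos_of_pos_of_lt_pi h1 h2).le
    nlinarith
  · choose ε₀ hpos h using hw.exists_volume_inter_ball
    refine ⟨Finset.univ.inf' Finset.univ_nonempty ε₀, ?_, ?_⟩
    · exact (Finset.lt_inf'_iff _).2 fun i _ => hpos i
    · intro ε hε hle k
      rw [hreg, ← hwe]
      exact h (e k) ε hε (hle.trans (Finset.inf'_le _ (Finset.mem_univ _)))

/-- A quadrilateral of unit area that is not convex lies in the triangle of three of its vertices.
Hence its perimeter is at least that of the triangle, and its angles at these three vertices add up to at most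
`π`; the crude bound `2π` is used for the remaining angle. -/
theorem nonconvex_quadrilateral_bounds (P : SimplePolygon 4) (harea : P.area = 1)
    (hP : ¬ P.IsConvex) :
    432 ≤ P.perimeter ^ 4 ∧ ∀ ε > 0,
      ∑ k, volume.real (P.region ∩ Metric.ball (P.vertex k) ε) ≤ 3 * Real.pi * ε ^ 2 / 2 := by
  have hnot : ∃ i, P.vertex i ∈ convexHull ℝ (P.vertex '' {i}ᶜ) := by
    by_contra hcon
    push Not at hcon
    obtain ⟨w, e, -, -, hreg, -⟩ :=
      P.exists_path_of_convexPosition (by rw [harea]; exact one_ne_zero) hcon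
    exact hP (by rw [IsConvex, hreg]; exact convex_leftHalfPlanes w)
  obtain ⟨i, hi⟩ := hnot
  have hcompl : ∀ i j : Fin 4, ¬j = i ↔ j = i + 1 ∨ j = i + 2 ∨ j = i + 3 := by decide
  have himg : P.vertex '' {i}ᶜ = {P.vertex (i + 1), P.vertex (i + 2), P.vertex (i + 3)} := by
    rw [show ({i}ᶜ : Set (Fin 4)) = {i + 1, i + 2, i + 3} by
      ext j; simp only [Set.mem_compl_iff, Set.mem_singleton_iff, Set.mem_insert_iff]
      exact hcompl i j]
    simp only [Set.image_insert_eq, Set.image_singleton]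
  have hsub : P.region ⊆ convexHull ℝ {P.vertex (i + 1), P.vertex (i + 2), P.vertex (i + 3)} := by
    refine P.region_subset_convexHull.trans ?_
    rw [P.range_vertex_eq_insert i, convexHull_insert_of_mem hi, himg]
  have h1 : P.area ≤ _ := measureReal_mono hsub (volume_triple_ne_top _ _ _)
  rw [harea, volume_real_convexHull_triple] at h1
  have hidx : ∀ i : Fin 4, i + 1 + 1 = i + 2 ∧ i + 2 + 1 = i + 3 ∧ i + 3 + 1 = i := by decide
  obtain ⟨e1, e2, e3⟩ := hidx i
  constructor
  · have h2 := triangle_area_sq_le (P.vertex (i + 1)) (P.vertex (i + 2)) (P.vertex (i + 3))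
    have h3 : P.perimeter = dist (P.vertex i) (P.vertex (i + 1)) +
        dist (P.vertex (i + 1)) (P.vertex (i + 2)) + dist (P.vertex (i + 2)) (P.vertex (i + 3)) +
        dist (P.vertex (i + 3)) (P.vertex i) := by
      rw [perimeter, ← Equiv.sum_comp (Equiv.addLeft i), Fin.sum_univ_four]
      simp only [Equiv.coe_addLeft, add_zero, finRotate_apply, e1, e2, e3]
    have h4 := dist_triangle (P.vertex (i + 3)) (P.vertex i) (P.vertex (i + 1))
    calc (432 : ℝ) ≤ 432 * (|wedge (P.vertex (i + 2) - P.vertex (i + 1))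
          (P.vertex (i + 3) - P.vertex (i + 1))| / 2) ^ 2 := by nlinarith
      _ ≤ _ := h2
      _ ≤ P.perimeter ^ 4 := pow_le_pow_left₀ (by positivity) (by rw [h3]; linarith) 4
  · intro ε hε
    rw [← Equiv.sum_comp (Equiv.addLeft i), Fin.sum_univ_four]
    simp only [Equiv.coe_addLeft, add_zero]
    have ho : orient (P.vertex (i + 1)) (P.vertex (i + 2)) (P.vertex (i + 3)) ≠ 0 := by
      intro h0
      rw [orient] at h0
      rw [h0, abs_zero] at h1
      norm_num at h1
    have htri := sum_volume_triple_inter_ball_le ho hε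
    have hm : ∀ x : Plane, volume.real (P.region ∩ Metric.ball x ε) ≤ volume.real
        (convexHull ℝ {P.vertex (i + 1), P.vertex (i + 2), P.vertex (i + 3)} ∩ Metric.ball x ε) :=
      fun x => measureReal_mono (Set.inter_subset_inter_left _ hsub)
        (measure_ne_top_of_subset Set.inter_subset_right measure_ball_lt_top.ne)
    have hD : volume.real (P.region ∩ Metric.ball (P.vertex i) ε) ≤ Real.pi * ε ^ 2 := by
      calc _ ≤ volume.real (Metric.ball (P.vertex i) ε) :=
            measureReal_mono Set.inter_subset_right measure_ball_lt_top.ne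
        _ = Real.pi * ε ^ 2 := by
            rw [Measure.real, EuclideanSpace.volume_ball_fin_two, ENNReal.toReal_mul,
              ENNReal.toReal_pow, ENNReal.toReal_ofReal hε.le, ENNReal.toReal_ofReal Real.pi_pos.le,
              mul_comm]
    linarith [hm (P.vertex (i + 1)), hm (P.vertex (i + 2)), hm (P.vertex (i + 3))]

/-- The perimeter is the one-dimensional Hausdorff measure of the boundary, hence invariant under
isometries. -/
theorem hausdorffMeasure_frontier (P : SimplePolygon n) :
    (μH[1] (frontier P.region)).toReal = P.perimeter := by
  have hdisj : Pairwise (Function.onFun (AEDisjoint μH[1]) P.edge) := by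
    intro i j hij
    refine measure_mono_null ((P.edge_inter_subset hij).trans Set.inter_subset_left) ?_
    have : NullSingletonClass (μH[1] : Measure Plane) :=
      Measure.nullSingletonClass_hausdorff Plane one_pos
    exact (Set.toFinite _).measure_zero _
  have hmeas : ∀ k, NullMeasurableSet (P.edge k) μH[1] := by
    intro k
    rw [edge_eq_segment, ← convexHull_pair]
    exact ((Set.toFinite _).isClosed_convexHull (𝕜 := ℝ)).measurableSet.nullMeasurableSet
  rw [frontier_eq_iUnion_edge, measure_iUnion₀ hdisj hmeas, tsum_fintype, perimeter,
    ENNReal.toReal_sum]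
  · refine Finset.sum_congr rfl fun k _ => ?_
    rw [edge_eq_segment, hausdorffMeasure_segment, edist_dist, ENNReal.toReal_ofReal dist_nonneg]
  · intro k _
    rw [edge_eq_segment, hausdorffMeasure_segment]
    exact edist_ne_top _ _

theorem Congruent.perimeter_eq {m : ℕ} {P : SimplePolygon m} {Q : SimplePolygon n}
    (h : P.Congruent Q) : P.perimeter = Q.perimeter := by
  obtain ⟨g, hg, -⟩ := h
  rw [← hausdorffMeasure_frontier, ← hausdorffMeasure_frontier, ← hg,
    ← IsometryEquiv.coe_toHomeomorph, ← Homeomorph.image_frontier, IsometryEquiv.coe_toHomeomorph,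
    g.hausdorffMeasure_image]

theorem Congruent.sides_eq {m : ℕ} {P : SimplePolygon m} {Q : SimplePolygon n}
    (h : P.Congruent Q) : m = n := by
  obtain ⟨g, -, hg⟩ := h
  have h1 : (Set.range P.vertex).ncard = m := by
    rw [← Set.image_univ, Set.ncard_image_of_injective _ P.vertex_injective, Set.ncard_univ,
      Nat.card_fin]
  have h2 : (Set.range Q.vertex).ncard = n := by
    rw [← Set.image_univ, Set.ncard_image_of_injective _ Q.vertex_injective, Set.ncard_univ,
      Nat.card_fin]
  rw [← h1, ← h2, ← hg, Set.ncard_image_of_injective _ g.injective]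

end SimplePolygon

/-! ### Edges of tilings -/

/-- A point of a segment is an endpoint if it is an endpoint of a segment that contains it. -/
theorem eq_or_eq_of_mem_segment {a b c d : Plane} (ha : a ∈ segment ℝ c d)
    (hc : c ∈ segment ℝ a b) (hd : d ∈ segment ℝ a b) : a = c ∨ a = d := by
  obtain ⟨s, ⟨hs, -⟩, rfl⟩ := (segment_eq_image' ℝ a b ▸ hc : c ∈ (fun θ : ℝ => a + θ • (b - a)) '' _)
  obtain ⟨t, ⟨ht, -⟩, rfl⟩ := (segment_eq_image' ℝ a b ▸ hd : d ∈ (fun θ : ℝ => a + θ • (b - a)) '' _)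
  obtain ⟨p, q, hp, hq, hpq, he⟩ := ha
  simp only at he ⊢
  have h0 : (p * s + q * t) • (b - a) = 0 := by
    obtain rfl : p = 1 - q := by linarith
    have : ((1 - q) * s + q * t) • (b - a) =
        ((1 - q) • (a + s • (b - a)) + q • (a + t • (b - a))) - a := by module
    rw [this, he, sub_self]
  rcases smul_eq_zero.1 h0 with h | h
  · have h1 : p * s = 0 := by nlinarith [mul_nonneg hp hs, mul_nonneg hq ht]
    have h2 : q * t = 0 := by nlinarith [mul_nonneg hp hs, mul_nonneg hq ht]
    rcases mul_eq_zero.1 h1 with h | h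
    · rcases mul_eq_zero.1 h2 with h' | h'
      · linarith
      · right; rw [h']; simp
    · left; rw [h]; simp
  · left; rw [h]; simp

theorem endpoint_mem_of_segment_eq {a b c d : Plane} (h : segment ℝ a b = segment ℝ c d) :
    a = c ∨ a = d :=
  eq_or_eq_of_mem_segment (b := b) (h ▸ left_mem_segment ℝ a b) (h.symm ▸ left_mem_segment ℝ c d)
    (h.symm ▸ right_mem_segment ℝ c d)

theorem midpoint_eq_of_segment_eq {a b c d : Plane} (h : segment ℝ a b = segment ℝ c d) :
    midpoint ℝ a b = midpoint ℝ c d := by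
  have h1 := endpoint_mem_of_segment_eq h
  have h2 := endpoint_mem_of_segment_eq ((segment_symm ℝ b a).trans h)
  have h3 := endpoint_mem_of_segment_eq h.symm
  have h4 := endpoint_mem_of_segment_eq ((segment_symm ℝ d c).trans h.symm)
  rcases h1 with rfl | rfl
  · rcases h4 with rfl | rfl
    · rcases h2 with rfl | rfl <;> rfl
    · rfl
  · rcases h3 with rfl | rfl
    · rcases h2 with rfl | rfl <;> rfl
    · exact midpoint_comm ..

theorem exists_mem_ball_midpoint_orient {a b : Plane} (hab : a ≠ b) (σ : Bool) {ε : ℝ} (hε : 0 < ε) :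
    ∃ z ∈ Metric.ball (midpoint ℝ a b) ε, 0 < (bif σ then 1 else -1) * orient a b z := by
  set n : Plane := !₂[-(b - a) 1, (b - a) 0] with hn
  have hpos : 0 < ‖b - a‖ ^ 2 := by
    have := norm_pos_iff.2 (sub_ne_zero.2 hab.symm)
    positivity
  have ho : ∀ δ : ℝ, orient a b (midpoint ℝ a b + δ • n) = δ * ‖b - a‖ ^ 2 := by
    intro δ
    rw [plane_norm_sq, midpoint_eq_smul_add]
    simp [orient, wedge, hn]
    ring
  have hδ : 0 < ε / (2 * (‖n‖ + 1)) := by positivity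
  have hlt : ε / (2 * (‖n‖ + 1)) * ‖n‖ < ε := by
    rw [div_mul_eq_mul_div, div_lt_iff₀ (by positivity)]
    nlinarith [norm_nonneg n]
  refine ⟨midpoint ℝ a b + ((bif σ then 1 else -1) * (ε / (2 * (‖n‖ + 1)))) • n, ?_, ?_⟩
  · rw [mem_ball_iff_norm, add_sub_cancel_left, norm_smul, norm_mul, Real.norm_of_nonneg hδ.le]
    cases σ <;> simpa using hlt
  · rw [ho]
    have := mul_pos hδ hpos
    cases σ <;> simp <;> linarith

theorem SimplePolygon.edge_injective {n : ℕ} (P : SimplePolygon n) {j k : Fin n}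
    (h : P.edge j = P.edge k) : j = k := by
  by_contra hjk
  have hm : midpoint ℝ (P.vertex j) (P.vertex (finRotate n j)) ∈ P.edge j := by
    rw [P.edge_eq_segment]; exact midpoint_mem_segment _ _
  have hne := P.vertex_ne_vertex_rotate j
  rcases (P.edge_inter_subset hjk ⟨hm, h ▸ hm⟩).1 with h | h
  · exact hne ((midpoint_eq_left_iff ℝ).1 h)
  · exact hne ((midpoint_eq_right_iff ℝ).1 h)

namespace TorusTiles

variable (D : TorusTiles)

theorem liftRegion_eq (p : D.Lift) :
    D.liftRegion p = (p.2 : Plane) +ᵥ (D.tile p.1).region := rfl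

theorem mem_liftRegion {p : D.Lift} {x : Plane} :
    x ∈ D.liftRegion p ↔ x - p.2 ∈ (D.tile p.1).region := by
  rw [liftRegion, Set.mem_vadd_set_iff_neg_vadd_mem, vadd_eq_add, neg_add_eq_sub]

theorem diam_sideSet (s : D.Side) : Metric.diam (D.sideSet s) =
    dist ((D.tile s.1).vertex s.2) ((D.tile s.1).vertex (finRotate _ s.2)) := by
  rw [sideSet, SimplePolygon.edge_eq_segment, ← convexHull_pair, convexHull_diam, Metric.diam_pair]

theorem sum_diam_sideSet : ∑ s : D.Side, Metric.diam (D.sideSet s) =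
    ∑ i, (D.tile i).perimeter := by
  rw [Fintype.sum_sigma]
  exact Finset.sum_congr rfl fun i _ => Finset.sum_congr rfl fun k _ => D.diam_sideSet ⟨i, k⟩

/-- The lift of a polygon by a lattice vector contains one of the half disks at the midpoint of each
of its sides. -/
theorem exists_halfDisk_subset_lift {s : D.Side} {t : Plane} (ht : t ∈ D.lattice) {a b : Plane}
    (hab : t +ᵥ D.sideSet s = segment ℝ a b) :
    ∃ σ : Bool, ∃ ε > 0, ∀ z ∈ Metric.ball (midpoint ℝ a b) ε,
      0 < (bif σ then 1 else -1) * orient a b z →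
        z ∈ interior (D.liftRegion (s.1, ⟨t, ht⟩)) := by
  have hseg : segment ℝ (a - t) (b - t) = (D.tile s.1).edge s.2 := by
    change _ = D.sideSet s
    rw [← neg_vadd_vadd t (D.sideSet s), hab, sub_eq_neg_add, sub_eq_neg_add]
    exact (segment_translate_image ℝ (-t) a b).symm
  have hne := (D.tile s.1).vertex_ne_vertex_rotate s.2
  have hseg' := hseg
  rw [SimplePolygon.edge_eq_segment] at hseg'
  have hmid := midpoint_eq_of_segment_eq hseg'
  have hab' : a - t ≠ b - t := by
    intro h
    rw [h, segment_same] at hseg'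
    have h1 := left_mem_segment ℝ ((D.tile s.1).vertex s.2)
      ((D.tile s.1).vertex (finRotate _ s.2))
    have h2 := right_mem_segment ℝ ((D.tile s.1).vertex s.2)
      ((D.tile s.1).vertex (finRotate _ s.2))
    rw [← hseg', Set.mem_singleton_iff] at h1 h2
    exact hne (h1.trans h2.symm)
  obtain ⟨σ, ε, hε, h⟩ := (D.tile s.1).exists_halfDisk_subset s.2 hseg hab'
    (by rw [hmid]; exact fun h => hne ((midpoint_eq_left_iff ℝ).1 h))
    (by rw [hmid]; exact fun h => hne ((midpoint_eq_right_iff ℝ).1 h))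
  refine ⟨σ, ε, hε, fun z hz hzσ => ?_⟩
  have hm : midpoint ℝ (a - t) (b - t) = midpoint ℝ a b - t := by
    rw [midpoint_eq_smul_add, midpoint_eq_smul_add]
    rw [show a - t + (b - t) = (a + b) - (2 : ℝ) • t by module, smul_sub, smul_smul]
    simp
  have := h (z - t) (by rw [hm, Metric.mem_ball, dist_sub_right]; exact hz) (by
    have : orient (a - t) (b - t) (z - t) = orient a b z := by simp [orient]
    rwa [this])
  rw [liftRegion_eq, interior_vadd, Set.mem_vadd_set_iff_neg_vadd_mem, vadd_eq_add, neg_add_eq_sub]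
  exact this

/-- The point of the plane at which a corner of one of the polygons lies. The corners are indexed like
the sides. -/
def cornerPoint (c : D.Side) : Plane := (D.tile c.1).vertex c.2

/-- Two corners lie at the same vertex of the torus if a lattice translation carries one to the
other. -/
def cornerSetoid : Setoid D.Side where
  r c c' := ∃ t ∈ D.lattice, t + D.cornerPoint c = D.cornerPoint c'
  iseqv :=
    { refl := fun _ => ⟨0, D.lattice.zero_mem, zero_add _⟩
      symm := by
        rintro c c' ⟨t, ht, h⟩
        exact ⟨-t, D.lattice.neg_mem ht, by rw [← h, neg_add_cancel_left]⟩
      trans := by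
        rintro c c' c'' ⟨t, ht, h⟩ ⟨u, hu, h'⟩
        exact ⟨u + t, D.lattice.add_mem hu ht, by rw [← h', ← h, add_assoc]⟩ }

/-- The polygons near a point that do not contain the point keep a positive distance from it. -/
theorem exists_ball_inter_liftRegion (x : Plane) : ∃ ε₀ > 0, ∀ p : D.Lift,
    (D.liftRegion p ∩ Metric.ball x ε₀).Nonempty → x ∈ D.liftRegion p := by
  set F : Set D.Lift := {p | (D.liftRegion p ∩ Metric.ball x 1).Nonempty} with hF
  have hfin : F.Finite := by
    have hi : ∀ i, {t : D.lattice | (i, t) ∈ F}.Finite := by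
      intro i
      have hb : Bornology.IsBounded (Metric.ball x 1 - (D.tile i).region) :=
        Metric.isBounded_ball.sub (D.tile i).isCompact_region.isBounded
      have h := ZSpan.setFinite_inter D.basis hb
      refine Set.Finite.of_finite_image (f := ((↑) : D.lattice → Plane)) (h.subset ?_)
        Subtype.val_injective.injOn
      rintro _ ⟨t, ⟨y, hy1, hy2⟩, rfl⟩
      refine ⟨⟨y, hy2, y - t, D.mem_liftRegion.1 hy1, by simp⟩, ?_⟩
      have h : (t : Plane) ∈ (Submodule.span ℤ (Set.range D.basis)).toAddSubgroup := by
        rw [Submodule.span_int_eq_addSubgroupClosure]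
        exact t.2
      exact h
    have : F ⊆ ⋃ i, (Prod.mk i) '' {t : D.lattice | (i, t) ∈ F} := by
      rintro ⟨i, t⟩ h
      exact Set.mem_iUnion.2 ⟨i, t, h, rfl⟩
    exact (Set.finite_iUnion fun i => (hi i).image _).subset this
  have hclosed : IsClosed (⋃ p ∈ F ∩ {p | x ∉ D.liftRegion p}, D.liftRegion p) := by
    refine (hfin.subset Set.inter_subset_left).isClosed_biUnion fun p _ => ?_
    exact (D.tile p.1).isClosed_region.vadd _
  obtain ⟨ε, hε, h⟩ := Metric.isOpen_iff.1 hclosed.isOpen_compl x (by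
    simp only [Set.mem_compl_iff, Set.mem_iUnion, not_exists]
    exact fun p hp => hp.2)
  refine ⟨min ε 1, lt_min hε one_pos, fun p ⟨y, hy1, hy2⟩ => ?_⟩
  by_contra hx
  refine h (Metric.ball_subset_ball (min_le_left _ _) hy2) (Set.mem_biUnion ⟨?_, hx⟩ hy1)
  exact ⟨y, hy1, Metric.ball_subset_ball (min_le_right _ _) hy2⟩

end TorusTiles

namespace TorusTiling

variable (T : TorusTiling)

/-- An edge of the tiling belongs to at most two sides of polygons: lifts of the polygons to a common
edge contain one of the two half disks at its midpoint, and different lifts have disjoint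
interiors. -/
theorem card_sides_le_two [DecidableRel T.sideSetoid.r] (s₀ : T.Side) :
    (Finset.univ.filter fun s => T.sideSetoid.r s s₀).card ≤ 2 := by
  set a := (T.tile s₀.1).vertex s₀.2
  set b := (T.tile s₀.1).vertex (finRotate _ s₀.2)
  have hs₀ : T.sideSet s₀ = segment ℝ a b := SimplePolygon.edge_eq_segment _ _
  have hab : a ≠ b := (T.tile s₀.1).vertex_ne_vertex_rotate s₀.2
  have hex : ∀ s : T.Side, ∃ t : T.lattice, ∃ σ : Bool, T.sideSetoid.r s s₀ →
      (t : Plane) +ᵥ T.sideSet s = segment ℝ a b ∧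
      ∃ ε > 0, ∀ z ∈ Metric.ball (midpoint ℝ a b) ε,
        0 < (bif σ then 1 else -1) * orient a b z → z ∈ interior (T.liftRegion (s.1, t)) := by
    intro s
    by_cases h : T.sideSetoid.r s s₀
    · obtain ⟨t, ht, he⟩ := h
      rw [hs₀] at he
      obtain ⟨σ, hσ⟩ := T.exists_halfDisk_subset_lift ht he
      exact ⟨⟨t, ht⟩, σ, fun _ => ⟨he, hσ⟩⟩
    · exact ⟨0, true, fun h' => absurd h' h⟩
  choose t σ hσ using hex
  rw [← Fintype.card_bool, ← Finset.card_univ]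
  refine Finset.card_le_card_of_injOn σ (fun _ _ => Finset.mem_coe.2 (Finset.mem_univ _)) ?_
  intro s hs s' hs' he
  simp only [Finset.coe_filter, Finset.mem_univ, true_and, Set.mem_ofPred_eq] at hs hs'
  obtain ⟨h1, ε, hε, h2⟩ := hσ s hs
  obtain ⟨h1', ε', hε', h2'⟩ := hσ s' hs'
  by_contra hne
  have hlift : ((s.1, t s) : T.Lift) ≠ (s'.1, t s') := by
    intro heq
    obtain ⟨e1, e2⟩ := Prod.mk.inj heq
    rw [e2, ← h1'] at h1
    have h3 : T.sideSet s = T.sideSet s' := vadd_left_cancel _ h1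
    obtain ⟨i, k⟩ := s
    obtain ⟨i', k'⟩ := s'
    obtain rfl : i = i' := e1
    obtain rfl := (T.tile i).edge_injective h3
    exact hne rfl
  obtain ⟨z, hz, hzσ⟩ := exists_mem_ball_midpoint_orient hab (σ s) (lt_min hε hε')
  exact Set.disjoint_left.1 (T.disjoint_interiors _ _ hlift)
    (h2 z (Metric.ball_subset_ball (min_le_left _ _) hz) hzσ)
    (h2' z (Metric.ball_subset_ball (min_le_right _ _) hz) (he ▸ hzσ))

end TorusTiling

/-! ### Vertices of tilings -/

namespace TorusTiling

variable (T : TorusTiling)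

/-- The perimeters of the tiles count each edge of the tiling at most twice. -/
theorem sum_perimeter_le : ∑ i, (T.tile i).perimeter ≤ 2 * T.perimeter := by
  classical
  rw [← T.sum_diam_sideSet, TorusTiles.perimeter, finsum_eq_sum_of_fintype, Finset.mul_sum,
    ← Finset.sum_fiberwise Finset.univ (fun s : T.Side => (Quotient.mk T.sideSetoid s))]
  refine Finset.sum_le_sum fun e _ => ?_
  induction e using Quotient.inductionOn with | _ s₀
  have hval : ∀ s ∈ Finset.univ.filter (fun s : T.Side =>
      Quotient.mk T.sideSetoid s = Quotient.mk T.sideSetoid s₀),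
      Metric.diam (T.sideSet s) = T.edgeLength (Quotient.mk T.sideSetoid s₀) := by
    intro s hs
    rw [← (Finset.mem_filter.1 hs).2]
    rfl
  rw [Finset.sum_congr rfl hval, Finset.sum_const, nsmul_eq_mul]
  have hnn : 0 ≤ T.edgeLength (Quotient.mk T.sideSetoid s₀) := Metric.diam_nonneg
  refine mul_le_mul_of_nonneg_right ?_ hnn
  have := T.card_sides_le_two s₀
  have heq : (Finset.univ.filter (fun s : T.Side =>
      Quotient.mk T.sideSetoid s = Quotient.mk T.sideSetoid s₀)) =
      Finset.univ.filter fun s => T.sideSetoid.r s s₀ :=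
    Finset.filter_congr fun s _ => Quotient.eq
  rw [heq]
  exact_mod_cast this

theorem liftEdge_eq_segment (p : T.Lift) (k : Fin (T.sides p.1)) :
    T.liftEdge p k = segment ℝ (T.liftVertex p k) (T.liftVertex p (finRotate _ k)) := by
  rw [TorusTiles.liftEdge, SimplePolygon.edge_eq_segment]
  exact segment_translate_image ℝ _ _ _

/-- In an edge-to-edge tiling a corner of one polygon is a corner of every polygon that contains
it. -/
theorem exists_eq_liftVertex (c : T.Side) {p : T.Lift} (h : T.cornerPoint c ∈ T.liftRegion p) :
    ∃ l, T.cornerPoint c = T.liftVertex p l := by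
  set q : T.Lift := (c.1, 0) with hq
  have hv : ∀ k, T.liftVertex q k = (T.tile c.1).vertex k := fun k => by
    simp only [TorusTiles.liftVertex, hq, ZeroMemClass.coe_zero, zero_vadd]
    rfl
  have hx : T.cornerPoint c ∈ T.liftRegion q := by
    rw [TorusTiles.mem_liftRegion]
    simpa [hq, TorusTiles.cornerPoint] using (T.tile c.1).vertex_mem_region c.2
  by_cases hpq : q = p
  · subst hpq
    exact ⟨c.2, (hv c.2).symm⟩
  rcases T.edge_to_edge q p hpq _ ⟨hx, h⟩ with ⟨k, l, -, h⟩ | ⟨k, l, h1, h2⟩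
  · exact ⟨l, h⟩
  · have he : T.liftEdge q k = (T.tile c.1).edge k := by
      simp only [TorusTiles.liftEdge, hq, ZeroMemClass.coe_zero, zero_vadd]
      rfl
    rw [he] at h2
    -- the corner is an endpoint of the common edge, hence a vertex of `p` as well
    have hend := (T.tile c.1).eq_of_vertex_mem_edge h2
    rw [liftEdge_eq_segment, liftEdge_eq_segment] at h1
    have h1' := h1
    rw [segment_symm] at h1'
    rcases hend with e | e
    · rcases endpoint_mem_of_segment_eq h1 with h | h
      · exact ⟨l, by rw [← h, hv]; exact e⟩
      · exact ⟨_, by rw [← h, hv]; exact e⟩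
    · rcases endpoint_mem_of_segment_eq h1' with h | h
      · exact ⟨l, by rw [← h, hv]; exact e⟩
      · exact ⟨_, by rw [← h, hv]; exact e⟩

/-- Different lifts overlap in a null set, because polygons are closures of their interiors and have
null frontiers. -/
theorem aedisjoint_liftRegion {p q : T.Lift} (h : p ≠ q) :
    AEDisjoint volume (T.liftRegion p) (T.liftRegion q) := by
  have hsub : T.liftRegion p ∩ T.liftRegion q ⊆ (p.2 : Plane) +ᵥ frontier (T.tile p.1).region := by
    rintro x ⟨hp, hq⟩
    have hcl : T.liftRegion q = closure (interior (T.liftRegion q)) := by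
      rw [TorusTiles.liftRegion_eq, interior_vadd, closure_vadd,
        (T.tile q.1).closure_interior_region]
    have hd : Disjoint (interior (T.liftRegion p)) (T.liftRegion q) := by
      rw [hcl]
      exact (T.disjoint_interiors p q h).closure_right isOpen_interior
    have hx : x ∉ interior (T.liftRegion p) := fun hx => Set.disjoint_left.1 hd hx hq
    rw [TorusTiles.liftRegion_eq, interior_vadd, Set.mem_vadd_set_iff_neg_vadd_mem] at hx
    rw [TorusTiles.liftRegion_eq, Set.mem_vadd_set_iff_neg_vadd_mem] at hp
    rw [Set.mem_vadd_set_iff_neg_vadd_mem]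
    exact ⟨subset_closure hp, hx⟩
  refine measure_mono_null hsub ?_
  rw [measure_vadd]
  exact (T.tile p.1).volume_frontier

/-- The parts of the polygons near their corners at one vertex of the tiling fill a disk. -/
theorem exists_sum_volume_inter_ball [DecidableRel T.cornerSetoid.r] (c : T.Side) :
    ∃ ε₀ > 0, ∀ ε > 0, ε ≤ ε₀ → ∑ c' with T.cornerSetoid.r c' c,
      volume.real ((T.tile c'.1).region ∩ Metric.ball (T.cornerPoint c') ε) =
        Real.pi * ε ^ 2 := by
  obtain ⟨ε₀, hε₀, hnear⟩ := T.exists_ball_inter_liftRegion (T.cornerPoint c)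
  refine ⟨ε₀, hε₀, fun ε hε hle => ?_⟩
  set x := T.cornerPoint c with hx
  have hex : ∀ c' : T.Side, ∃ t : T.lattice,
      T.cornerSetoid.r c' c → (t : Plane) + T.cornerPoint c' = x := by
    intro c'
    by_cases h : T.cornerSetoid.r c' c
    · obtain ⟨t, ht, h'⟩ := h
      exact ⟨⟨t, ht⟩, fun _ => h'⟩
    · exact ⟨0, fun h' => absurd h' h⟩
  choose t ht using hex
  -- each corner `c'` at this vertex belongs to exactly one lift that has its corner at `x`
  set S := Finset.univ.filter fun c' => T.cornerSetoid.r c' c with hS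
  have hmem : ∀ c' ∈ S, (t c' : Plane) + T.cornerPoint c' = x :=
    fun c' h => ht c' (Finset.mem_filter.1 h).2
  set U : T.Side → Set Plane := fun c' => T.liftRegion (c'.1, t c') ∩ Metric.ball x ε with hU
  have hvol : ∀ c' ∈ S, volume (U c') =
      volume ((T.tile c'.1).region ∩ Metric.ball (T.cornerPoint c') ε) := by
    intro c' hc'
    have : U c' = (t c' : Plane) +ᵥ ((T.tile c'.1).region ∩ Metric.ball (T.cornerPoint c') ε) := by
      rw [Set.vadd_set_inter, Metric.vadd_ball, vadd_eq_add, hmem c' hc']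
      rfl
    rw [this, measure_vadd]
  have hcover : ⋃ c' ∈ S, U c' = Metric.ball x ε := by
    refine Set.Subset.antisymm (Set.iUnion₂_subset fun _ _ => Set.inter_subset_right) ?_
    intro y hy
    obtain ⟨p, hp⟩ := T.covers y
    have hxp := hnear p ⟨y, hp, Metric.ball_subset_ball hle hy⟩
    obtain ⟨l, hl⟩ := T.exists_eq_liftVertex c hxp
    have hc' : (⟨p.1, l⟩ : T.Side) ∈ S :=
      Finset.mem_filter.2 ⟨Finset.mem_univ _, p.2, p.2.2, hl.symm⟩
    refine Set.mem_biUnion hc' ⟨?_, hy⟩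
    have h1 : (t ⟨p.1, l⟩ : Plane) + (T.tile p.1).vertex l = p.2 + (T.tile p.1).vertex l :=
      (hmem _ hc').trans hl
    have h2 : t ⟨p.1, l⟩ = p.2 := Subtype.ext (add_right_cancel h1)
    show y ∈ T.liftRegion (p.1, t ⟨p.1, l⟩)
    rw [h2]
    exact hp
  have hdisj : (S : Set T.Side).Pairwise fun a b => AEDisjoint volume (U a) (U b) := by
    intro a ha b hb hab
    refine (T.aedisjoint_liftRegion ?_).mono Set.inter_subset_left Set.inter_subset_left
    intro heq
    obtain ⟨e1, e2⟩ := Prod.mk.inj heq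
    have h1 := (hmem a ha).trans (hmem b hb).symm
    rw [e2] at h1
    have h2 := add_left_cancel h1
    obtain ⟨i, k⟩ := a
    obtain ⟨i', k'⟩ := b
    obtain rfl : i = i' := e1
    obtain rfl := (T.tile i).vertex_injective h2
    exact hab rfl
  have hnull : ∀ c' ∈ S, NullMeasurableSet (U c') volume := fun c' _ =>
    ((((T.tile c'.1).isClosed_region.vadd _).measurableSet).inter
      measurableSet_ball).nullMeasurableSet
  have hsum := measure_biUnion_finset₀ hdisj hnull
  rw [hcover, EuclideanSpace.volume_ball_fin_two] at hsum
  have hreal := congrArg ENNReal.toReal hsum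
  rw [ENNReal.toReal_sum (fun c' hc' => by
    rw [hvol c' hc']
    exact measure_ne_top_of_subset Set.inter_subset_left (T.tile c'.1).volume_region_ne_top)] at hreal
  have e : ∀ c' ∈ S, (volume (U c')).toReal =
      volume.real ((T.tile c'.1).region ∩ Metric.ball (T.cornerPoint c') ε) := fun c' hc' => by
    rw [hvol c' hc']; rfl
  rw [← Finset.sum_congr rfl e, ← hreal]
  simp [ENNReal.toReal_ofReal hε.le, ENNReal.toReal_ofReal Real.pi_pos.le, mul_comm]

end TorusTiling

/-! ### Half-angle cotangents around a vertex -/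

theorem hasDerivAt_cotHalf {a : ℝ} (ha : a ∈ Set.Ioo 0 Real.pi) :
    HasDerivAt cotHalf (-(1 - Real.cos a)⁻¹) a := by
  have hs := Real.sin_pos_of_mem_Ioo ha
  have h1 : Real.cos a < 1 := by nlinarith [Real.sin_sq_add_cos_sq a, Real.cos_le_one a]
  have h : HasDerivAt cotHalf
      ((-Real.sin a * Real.sin a - (1 + Real.cos a) * Real.cos a) / Real.sin a ^ 2) a :=
    ((Real.hasDerivAt_cos a).const_add 1).div (Real.hasDerivAt_sin a) hs.ne'
  have h2 : 1 - Real.cos a ≠ 0 := by linarith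
  have he : -(1 - Real.cos a)⁻¹ =
      (-Real.sin a * Real.sin a - (1 + Real.cos a) * Real.cos a) / Real.sin a ^ 2 := by
    rw [eq_div_iff (by positivity), neg_mul, inv_mul_eq_div, neg_eq_iff_eq_neg, div_eq_iff h2]
    linear_combination (Real.cos a) * (Real.sin_sq_add_cos_sq a)
  rwa [he]

theorem convexOn_cotHalf : ConvexOn ℝ (Set.Ioo 0 Real.pi) cotHalf := by
  refine MonotoneOn.convexOn_of_deriv (convex_Ioo 0 Real.pi)
    (fun a ha => (hasDerivAt_cotHalf ha).continuousAt.continuousWithinAt) ?_ ?_ <;>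
    rw [interior_Ioo]
  · exact fun a ha => (hasDerivAt_cotHalf ha).differentiableAt.differentiableWithinAt
  · intro a ha b hb hab
    rw [(hasDerivAt_cotHalf ha).deriv, (hasDerivAt_cotHalf hb).deriv]
    have hs := Real.sin_pos_of_mem_Ioo ha
    have h1 : Real.cos a < 1 := by nlinarith [Real.sin_sq_add_cos_sq a, Real.cos_le_one a]
    have h2 : Real.cos b ≤ Real.cos a :=
      Real.cos_le_cos_of_nonneg_of_le_pi ha.1.le hb.2.le hab
    exact neg_le_neg (inv_anti₀ (by linarith) (by linarith))

/-- The tangents of the convex function `cotHalf` lie below it. -/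
theorem tangent_le_cotHalf {a b : ℝ} (ha : a ∈ Set.Ioo 0 Real.pi) (hb : b ∈ Set.Ioo 0 Real.pi) :
    cotHalf b - (1 - Real.cos b)⁻¹ * (a - b) ≤ cotHalf a := by
  rcases lt_trichotomy a b with h | rfl | h
  · have := convexOn_cotHalf.slope_le_of_hasDerivAt ha hb h (hasDerivAt_cotHalf hb)
    rw [slope_def_field, div_le_iff₀ (by linarith)] at this
    linarith
  · simp
  · have := convexOn_cotHalf.le_slope_of_hasDerivAt hb ha h (hasDerivAt_cotHalf hb)
    rw [slope_def_field, le_div_iff₀ (by linarith)] at this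
    linarith

theorem tangent_two_pi_div_three {a : ℝ} (ha : a ∈ Set.Ioo 0 Real.pi) :
    √3 / 3 - 2 / 3 * (a - 2 * Real.pi / 3) ≤ cotHalf a := by
  have hpi := Real.pi_pos
  have hc : Real.cos (2 * Real.pi / 3) = -1 / 2 := by
    rw [show 2 * Real.pi / 3 = Real.pi - Real.pi / 3 by ring, Real.cos_pi_sub, Real.cos_pi_div_three]
    norm_num
  have hs : Real.sin (2 * Real.pi / 3) = √3 / 2 := by
    rw [show 2 * Real.pi / 3 = Real.pi - Real.pi / 3 by ring, Real.sin_pi_sub, Real.sin_pi_div_three]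
  have h := tangent_le_cotHalf ha (b := 2 * Real.pi / 3) ⟨by positivity, by linarith⟩
  have hv : cotHalf (2 * Real.pi / 3) = √3 / 3 := by
    have h3 : √3 * √3 = 3 := Real.mul_self_sqrt (by norm_num)
    have : √3 ≠ 0 := by positivity
    rw [cotHalf, hc, hs]
    field_simp
    linarith
  rw [hv, hc] at h
  norm_num at h ⊢
  linarith

theorem tangent_pi_div_two {a : ℝ} (ha : a ∈ Set.Ioo 0 Real.pi) :
    1 - (a - Real.pi / 2) ≤ cotHalf a := by
  have hpi := Real.pi_pos
  have h := tangent_le_cotHalf ha (b := Real.pi / 2) ⟨by positivity, by linarith⟩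
  simpa [cotHalf] using h

/-- The linear bound for the contribution of one vertex of the tiling, with angles `α c` of pentagons
and total angle `β` of quadrilaterals. Equality holds for three angles `2π/3` and for four angles
`π/2`, which determines the first two coefficients. -/
theorem sum_cotHalf_ge_of_sum_eq_two_pi {ι : Type*} (K : Finset ι) (α : ι → ℝ)
    (hα : ∀ c ∈ K, α c ∈ Set.Ioo 0 Real.pi) {β : ℝ} (hβ : 0 ≤ β)
    (hsum : ∑ c ∈ K, α c + β = 2 * Real.pi) :
    (4 - √3) * K.card + (4 * √3 - 12) + 2 / 3 * β ≤ ∑ c ∈ K, cotHalf (α c) := by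
  have h3 : √3 * √3 = 3 := Real.mul_self_sqrt (by norm_num)
  have h3l : 1.73 < √3 := by rw [Real.lt_sqrt] <;> norm_num
  have h3u : √3 < 1.74 := by rw [Real.sqrt_lt'] <;> norm_num
  have hpl := Real.pi_gt_d2
  have hpu := Real.pi_lt_d2
  -- the tangent at `2π/3` serves for at most three corners, the one at `π/2` for more
  rcases Nat.lt_or_ge K.card 4 with hk | hk
  · have h := Finset.sum_le_sum fun c hc => tangent_two_pi_div_three (hα c hc)
    simp only [Finset.sum_sub_distrib, ← Finset.mul_sum, Finset.sum_const, nsmul_eq_mul] at h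
    have hk' : (K.card : ℝ) ≤ 3 := by exact_mod_cast Nat.le_of_lt_succ hk
    nlinarith
  · have h := Finset.sum_le_sum fun c hc => tangent_pi_div_two (hα c hc)
    simp only [Finset.sum_sub_distrib, Finset.sum_const, nsmul_eq_mul] at h
    have hk' : (4 : ℝ) ≤ K.card := by exact_mod_cast hk
    nlinarith

/-- The bounds at the single vertices, added up over all vertices of a tiling. The corners `c` with
`pent c` are those of the pentagons. -/
theorem sum_cotHalf_corners_ge {ι V : Type*} [Fintype ι] [Fintype V] [DecidableEq V] (f : ι → V)
    (pent : ι → Prop) [DecidablePred pent] (α : ι → ℝ)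
    (hα : ∀ c, pent c → α c ∈ Set.Ioo 0 Real.pi) (hα0 : ∀ c, 0 ≤ α c)
    (hsum : ∀ v, ∑ c with f c = v, α c = 2 * Real.pi) :
    (4 - √3) * (∑ c with pent c, (1 : ℝ)) + (4 * √3 - 12) * ((∑ c, α c) / (2 * Real.pi)) +
      2 / 3 * ∑ c with ¬pent c, α c ≤ ∑ c with pent c, cotHalf (α c) := by
  -- the number of vertices of the tiling
  have hcard : (∑ c, α c) / (2 * Real.pi) = ∑ _v : V, (1 : ℝ) := by
    rw [← Finset.sum_fiberwise Finset.univ f, Finset.sum_congr rfl fun v _ => hsum v]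
    have := Real.pi_pos
    simp
  rw [hcard]
  have hfib : ∀ (p : ι → Prop) [DecidablePred p] (g : ι → ℝ), ∑ c with p c, g c =
      ∑ v, ∑ c ∈ Finset.univ.filter fun c => f c = v ∧ p c, g c := by
    intro p _ g
    rw [← Finset.sum_fiberwise _ f]
    refine Finset.sum_congr rfl fun v _ => Finset.sum_congr ?_ fun _ _ => rfl
    ext c; simp [and_comm]
  rw [hfib, hfib, hfib, Finset.mul_sum, Finset.mul_sum, Finset.mul_sum, ← Finset.sum_add_distrib,
    ← Finset.sum_add_distrib]
  refine Finset.sum_le_sum fun v _ => ?_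
  have h := sum_cotHalf_ge_of_sum_eq_two_pi (Finset.univ.filter fun c => f c = v ∧ pent c) α
    (fun c hc => hα c (Finset.mem_filter.1 hc).2.2)
    (β := ∑ c ∈ Finset.univ.filter fun c => f c = v ∧ ¬pent c, α c)
    (Finset.sum_nonneg fun c _ => hα0 c) (by
      rw [← hsum v, ← Finset.filter_filter, ← Finset.filter_filter,
        Finset.sum_filter_add_sum_filter_not])
  simpa using h

/-- The numerical end of the argument, for `n` pentagons of perimeter `p` and `m` quadrilaterals.
The defect `n * (4 * (2 + √3) - p ^ 2)` of the pentagons is at most `5.2982 * m`, and dividing by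
`2 * √(2 + √3) + p`, which is at least `7.64`, leaves less than the surplus `0.6952 * m` of the
quadrilaterals. The number `4.559` bounds the perimeter of a quadrilateral, and `14.337` is a lower
bound for the squared perimeter of a convex pentagon of unit area. -/
theorem perimeter_arith {n m p S : ℝ} (hm : 0 ≤ m) (hn : 0 ≤ n) (hp : 0 ≤ p)
    (hS0 : n * (2 + √3) - (18 - 6 * √3 - 2 * Real.pi) * m ≤ S) (hSp : 4 * S ≤ n * p ^ 2)
    (hp1 : 0 < n → 14.337 ≤ p ^ 2) :
    (n + m) * (2 * √(2 + √3)) ≤ n * p + 4.559 * m := by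
  have h3l : 1.73205 < √3 := by rw [Real.lt_sqrt] <;> norm_num
  have h3u : √3 < 1.73206 := by rw [Real.sqrt_lt'] <;> norm_num
  have hpl := Real.pi_gt_d6
  have hY : √(2 + √3) ^ 2 = 2 + √3 := Real.sq_sqrt (by positivity)
  set Y := √(2 + √3)
  have hY0 : 0 ≤ Y := Real.sqrt_nonneg _
  have hYl : 1.93185 ≤ Y := by nlinarith
  have hYu : Y ≤ 1.93186 := by nlinarith
  rcases hn.eq_or_lt with rfl | hn
  · nlinarith
  have hp2 : 3.7863 ≤ p := by nlinarith [hp1 hn]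
  have hdef : n * (4 * Y ^ 2 - p ^ 2) ≤ 5.2982 * m := by rw [hY]; nlinarith
  have hfac : n * (4 * Y ^ 2 - p ^ 2) = n * (2 * Y - p) * (2 * Y + p) := by ring
  have hgoal : n * (2 * Y - p) ≤ 0.6952 * m := by
    by_contra! hlt
    nlinarith
  nlinarith

/-! ### The perimeter of the tiling -/

/-- The angle at the `k`-th vertex as seen by the disk of radius `ε`: the angle of the circular sector
of the same area as the part of the polygon in that disk. For small `ε` this is the interior angle,
whether the polygon is convex at the vertex or not. -/
noncomputable def SimplePolygon.diskAngle {n : ℕ} (P : SimplePolygon n) (ε : ℝ) (k : Fin n) : ℝ :=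
  2 * volume.real (P.region ∩ Metric.ball (P.vertex k) ε) / ε ^ 2

theorem SimplePolygon.eventually_diskAngle_of_perimeter_le {n : ℕ} (hn : n = 5) (P : SimplePolygon n)
    (harea : P.area = 1) (hper : P.perimeter ^ 2 ≤ 4 * (2 + √3)) :
    ∀ᶠ ε in 𝓝[>] (0 : ℝ), (∀ k, P.diskAngle ε k ∈ Set.Ioo 0 Real.pi) ∧
      ∑ k, P.diskAngle ε k = 3 * Real.pi ∧
      4 * ∑ k, cotHalf (P.diskAngle ε k) ≤ P.perimeter ^ 2 := by
  subst hn
  obtain ⟨α, h1, h2, h3, ε₀, hε₀, h⟩ := P.exists_angles_of_perimeter_le harea hper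
  filter_upwards [Ioc_mem_nhdsGT hε₀] with ε hε
  have hα : P.diskAngle ε = α := by
    funext k
    have := hε.1
    rw [diskAngle, h ε hε.1 hε.2 k]
    field_simp
  rw [hα]
  exact ⟨h1, h2, h3⟩

theorem SimplePolygon.nonconvex_quadrilateral_diskAngle {n : ℕ} (hn : n = 4) (P : SimplePolygon n)
    (harea : P.area = 1) (hP : ¬P.IsConvex) :
    4.559 ≤ P.perimeter ∧ ∀ ε > 0, ∑ k, P.diskAngle ε k ≤ 3 * Real.pi := by
  subst hn
  obtain ⟨h1, h2⟩ := P.nonconvex_quadrilateral_bounds harea hP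
  refine ⟨?_, fun ε hε => ?_⟩
  · by_contra! h
    have := pow_lt_pow_left₀ h P.perimeter_nonneg (n := 4) (by norm_num)
    norm_num at this
    linarith
  · have := h2 ε hε
    simp only [diskAngle]
    rw [← Finset.sum_div, ← Finset.mul_sum, div_le_iff₀ (by positivity)]
    linarith

namespace TorusTiling

variable (T : TorusTiling)

theorem eventually_sum_diskAngle [DecidableRel T.cornerSetoid.r] (c : T.Side) :
    ∀ᶠ ε in 𝓝[>] (0 : ℝ), ∑ c' with T.cornerSetoid.r c' c,
      (T.tile c'.1).diskAngle ε c'.2 = 2 * Real.pi := by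
  obtain ⟨ε₀, hε₀, h⟩ := T.exists_sum_volume_inter_ball c
  filter_upwards [Ioc_mem_nhdsGT hε₀] with ε hε
  have := hε.1
  simp only [SimplePolygon.diskAngle]
  rw [← Finset.sum_div, ← Finset.mul_sum, div_eq_iff (by positivity)]
  have := h ε hε.1 hε.2
  unfold TorusTiles.cornerPoint at this
  rw [this]
  ring

theorem sum_filter_sides (p : ℕ → Prop) [DecidablePred p] (g : T.Side → ℝ) :
    ∑ c : T.Side with p (T.sides c.1), g c = ∑ i with p (T.sides i), ∑ k, g ⟨i, k⟩ := by
  rw [Finset.sum_filter, Finset.sum_filter, Fintype.sum_sigma]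
  refine Finset.sum_congr rfl fun i _ => ?_
  by_cases h : p (T.sides i) <;> simp [h]

/-- The bound for the half-angle cotangents of all pentagon corners of a tiling. The number of vertices
is eliminated by counting the angles: each pentagon contributes `3π`, and each quadrilateral at most
`3π`. -/
theorem sum_cotHalf_ge {ε : ℝ} (hε : 0 < ε) [DecidableRel T.cornerSetoid.r]
    (hpent : ∀ i, T.sides i = 5 → (∀ k, (T.tile i).diskAngle ε k ∈ Set.Ioo 0 Real.pi) ∧
      ∑ k, (T.tile i).diskAngle ε k = 3 * Real.pi)
    (hquad : ∀ i, T.sides i ≠ 5 → ∑ k, (T.tile i).diskAngle ε k ≤ 3 * Real.pi)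
    (hsum : ∀ c : T.Side, ∑ c' with T.cornerSetoid.r c' c,
      (T.tile c'.1).diskAngle ε c'.2 = 2 * Real.pi) :
    (2 + √3) * (Finset.univ.filter fun i => T.sides i = 5).card -
      (18 - 6 * √3 - 2 * Real.pi) * (Finset.univ.filter fun i => T.sides i ≠ 5).card ≤
      ∑ i with T.sides i = 5, ∑ k, cotHalf ((T.tile i).diskAngle ε k) := by
  classical
  have h0 : ∀ c : T.Side, 0 ≤ (T.tile c.1).diskAngle ε c.2 := fun c => by
    unfold SimplePolygon.diskAngle; positivity
  have h := sum_cotHalf_corners_ge (Quotient.mk T.cornerSetoid) (fun c => T.sides c.1 = 5)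
    (fun c => (T.tile c.1).diskAngle ε c.2) (fun c hc => (hpent c.1 hc).1 c.2) h0 (by
      intro v
      induction v using Quotient.inductionOn with | _ c
      rw [← hsum c]
      exact Finset.sum_congr (Finset.filter_congr fun s _ => Quotient.eq) fun _ _ => rfl)
  have e1 := T.sum_filter_sides (· = 5) fun _ => (1 : ℝ)
  have e2 := T.sum_filter_sides (· = 5) fun c => cotHalf ((T.tile c.1).diskAngle ε c.2)
  have e3 := T.sum_filter_sides (fun m => ¬m = 5) fun c => (T.tile c.1).diskAngle ε c.2
  have e4 := T.sum_filter_sides (· = 5) fun c => (T.tile c.1).diskAngle ε c.2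
  rw [← Finset.sum_filter_add_sum_filter_not Finset.univ (fun c : T.Side => T.sides c.1 = 5)
    (fun c => (T.tile c.1).diskAngle ε c.2), e1, e2, e3, e4] at h
  have e5 : ∑ i with T.sides i = 5, ∑ _k : Fin (T.sides i), (1 : ℝ) =
      5 * (Finset.univ.filter fun i => T.sides i = 5).card := by
    rw [Finset.sum_congr rfl (g := fun _ => (5 : ℝ))]
    · simp [mul_comm]
    · intro i hi
      simp [(Finset.mem_filter.1 hi).2]
  have e6 : ∑ i with T.sides i = 5, ∑ k, (T.tile i).diskAngle ε k =
      3 * Real.pi * (Finset.univ.filter fun i => T.sides i = 5).card := by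
    rw [Finset.sum_congr rfl (g := fun _ => 3 * Real.pi)]
    · simp [mul_comm]
    · exact fun i hi => (hpent i (Finset.mem_filter.1 hi).2).2
  have e7 : ∑ i with ¬T.sides i = 5, ∑ k, (T.tile i).diskAngle ε k ≤
      3 * Real.pi * (Finset.univ.filter fun i => T.sides i ≠ 5).card := by
    refine (Finset.sum_le_sum fun i hi => hquad i (Finset.mem_filter.1 hi).2).trans_eq ?_
    simp [mul_comm]
  rw [e5, e6] at h
  generalize (∑ i with ¬T.sides i = 5, ∑ k, (T.tile i).diskAngle ε k) = q at h e7
  generalize ((Finset.univ.filter fun i => T.sides i = 5).card : ℝ) = n at h ⊢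
  generalize ((Finset.univ.filter fun i => T.sides i ≠ 5).card : ℝ) = m at e7 ⊢
  refine le_trans ?_ h
  have hpi := Real.pi_pos
  have h3l : 1.73 < √3 := by rw [Real.lt_sqrt] <;> norm_num
  have h3u : √3 < 1.74 := by rw [Real.sqrt_lt'] <;> norm_num
  have hpu := Real.pi_lt_d2
  have hdiv : (3 * Real.pi * n + q) / (2 * Real.pi) = 3 / 2 * n + q / (2 * Real.pi) := by
    field_simp
  have hq : q / (2 * Real.pi) ≤ 3 / 2 * m := by
    rw [div_le_iff₀ (by positivity)]; linarith
  have hq' : q = 2 * Real.pi * (q / (2 * Real.pi)) := by field_simp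
  rw [hdiv]
  generalize q / (2 * Real.pi) = r at *
  subst hq'
  nlinarith

end TorusTiling

/-- The bound for the angles of a single convex pentagon, from the tangent at `2π/3`. -/
theorem sum_cotHalf_ge_of_sum_eq_three_pi {α : Fin 5 → ℝ} (hα : ∀ k, α k ∈ Set.Ioo 0 Real.pi)
    (hsum : ∑ k, α k = 3 * Real.pi) : 14.337 ≤ 4 * ∑ k, cotHalf (α k) := by
  have h := Finset.sum_le_sum fun k (_ : k ∈ Finset.univ) => tangent_two_pi_div_three (hα k)
  simp only [Finset.sum_sub_distrib, ← Finset.mul_sum, Finset.sum_const, nsmul_eq_mul, hsum] at h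
  have h3l : 1.73205 < √3 := by rw [Real.lt_sqrt] <;> norm_num
  have hpl := Real.pi_gt_d6
  simp at h
  linarith

theorem theorem3p10
    (P : SimplePolygon 5) (hP : P.IsEfficient)
    (T : TorusTiling)
    (hT : ∀ i, (T.tile i).area = 1 ∧
      (P.Congruent (T.tile i) ∨ (T.sides i = 4 ∧ ¬ (T.tile i).IsConvex)))
    (C : SimplePolygon 5) (hC : C.IsCairo ∨ C.IsPrismatic) (hCarea : C.area = 1) :
    ¬ (T.perimeterPerTile < C.perimeter / 2) := by
  classical
  obtain ⟨hParea, C', hC', hC'area, hle⟩ := hP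
  have hper : P.perimeter ^ 2 ≤ 4 * (2 + √3) :=
    (pow_le_pow_left₀ P.perimeter_nonneg hle 2).trans
      (C'.perimeter_sq_le_of_isCairo_or_isPrismatic (Or.inl hC') hC'area)
  have hp : ∀ i, T.sides i = 5 → (T.tile i).perimeter = P.perimeter := by
    intro i hi
    rcases (hT i).2 with h | ⟨h, -⟩
    · exact h.perimeter_eq.symm
    · omega
  have hq : ∀ i, T.sides i ≠ 5 → 4.559 ≤ (T.tile i).perimeter ∧
      ∀ ε > 0, ∑ k, (T.tile i).diskAngle ε k ≤ 3 * Real.pi := by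
    intro i hi
    rcases (hT i).2 with h | ⟨h, h'⟩
    · exact absurd h.sides_eq.symm hi
    · exact (T.tile i).nonconvex_quadrilateral_diskAngle h (hT i).1 h'
  -- a radius that is small enough for all tiles and all vertices at once
  have hev1 : ∀ᶠ ε in 𝓝[>] (0 : ℝ), ∀ i, T.sides i = 5 →
      (∀ k, (T.tile i).diskAngle ε k ∈ Set.Ioo 0 Real.pi) ∧
      ∑ k, (T.tile i).diskAngle ε k = 3 * Real.pi ∧
      4 * ∑ k, cotHalf ((T.tile i).diskAngle ε k) ≤ P.perimeter ^ 2 := by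
    refine eventually_all.2 fun i => ?_
    by_cases hi : T.sides i = 5
    · have := (T.tile i).eventually_diskAngle_of_perimeter_le hi (hT i).1 (by rwa [hp i hi])
      rw [hp i hi] at this
      exact this.mono fun ε h _ => h
    · exact Eventually.of_forall fun ε h => absurd h hi
  have hev2 := eventually_all.2 T.eventually_sum_diskAngle
  obtain ⟨ε, ⟨h1, h2⟩, hε⟩ := ((hev1.and hev2).and self_mem_nhdsWithin).exists
  have hcot := T.sum_cotHalf_ge hε (fun i hi => ⟨(h1 i hi).1, (h1 i hi).2.1⟩)
    (fun i hi => (hq i hi).2 ε hε) h2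
  set n := (Finset.univ.filter fun i => T.sides i = 5).card with hn
  set m := (Finset.univ.filter fun i => T.sides i ≠ 5).card with hm
  have hnm : (n : ℝ) + m = T.numTiles := by
    rw [← Nat.cast_add, hn, hm, Finset.card_filter_add_card_filter_not, Finset.card_univ,
      Fintype.card_fin]
  have hSp : 4 * ∑ i with T.sides i = 5, ∑ k, cotHalf ((T.tile i).diskAngle ε k) ≤
      n * P.perimeter ^ 2 := by
    rw [Finset.mul_sum]
    refine (Finset.sum_le_sum fun i hi => (h1 i (Finset.mem_filter.1 hi).2).2.2).trans_eq ?_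
    simp [hn]
  have hp1 : 0 < (n : ℝ) → 14.337 ≤ P.perimeter ^ 2 := by
    intro h
    obtain ⟨i, hi⟩ := Finset.card_pos.1 (Nat.cast_pos.1 h)
    obtain ⟨a1, a2, a3⟩ := h1 i (Finset.mem_filter.1 hi).2
    refine le_trans ?_ a3
    have key : ∀ N, N = 5 → ∀ α : Fin N → ℝ, (∀ k, α k ∈ Set.Ioo 0 Real.pi) →
        ∑ k, α k = 3 * Real.pi → 14.337 ≤ 4 * ∑ k, cotHalf (α k) := by
      rintro N rfl α h h'
      exact sum_cotHalf_ge_of_sum_eq_three_pi h h'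
    exact key _ (Finset.mem_filter.1 hi).2 _ a1 a2
  have harith := perimeter_arith (m := m) (n := n) (Nat.cast_nonneg _) (Nat.cast_nonneg _)
    P.perimeter_nonneg (by linarith) hSp hp1
  have htot : n * P.perimeter + 4.559 * m ≤ 2 * T.perimeter := by
    refine le_trans ?_ T.sum_perimeter_le
    rw [← Finset.sum_filter_add_sum_filter_not _ fun i => T.sides i = 5]
    refine add_le_add ?_ ?_
    · rw [Finset.sum_congr rfl fun i hi => hp i (Finset.mem_filter.1 hi).2]
      simp [hn]
    · refine le_trans (by simp [hm, mul_comm])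
        (Finset.sum_le_sum fun i hi => (hq i (Finset.mem_filter.1 hi).2).1)
  have hNpos : (0 : ℝ) < T.numTiles := by
    obtain ⟨p, -⟩ := T.covers 0
    exact_mod_cast p.1.pos
  have hCle : C.perimeter ≤ 2 * √(2 + √3) := by
    refine le_of_sq_le_sq ?_ (by positivity)
    rw [mul_pow, Real.sq_sqrt (by positivity)]
    linarith [C.perimeter_sq_le_of_isCairo_or_isPrismatic hC hCarea]
  rw [not_lt, TorusTiles.perimeterPerTile, le_div_iff₀ hNpos, ← hnm]
  nlinarith [mul_le_mul_of_nonneg_left hCle (hnm ▸ hNpos.le)]
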